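/- **Setting.** Let $d\ge 1$ and let $B=(B_{jk})$ be a smooth closed 2-form on $\mathbb R^d$ whose components are bounded together with all their derivatives. Put $A_k(x)=\sum_{j}\int_0^1 s\,x_jB_{jk}(sx)\,ds$ and let $\varphi(x,y)=\int_{[y,x]}A$ be the circulation of $A$ along the segment from $y$ to $x$. Write $\mathscr S,\mathscr S'$ for Schwartz functions and tempered distributions, $\langle\cdot,\cdot\rangle$ for the bilinear pairing of $\mathscr S'$ with $\mathscr S$, and $\langle X\rangle=\sqrt{1+|X|^2}$; $\mathscr S\subset\mathscr S'$ through $\langle f,g\rangle=\int fg$, $\mathscr S'$ carries the strong topology, and $\mathcal B(V,W)$ denotes the continuous linear maps. Points of $\mathbb R^{4d}$ are written $\mathbf X=(X_L,X_R)=(x_L,\xi_L,x_R,\xi_R)$. *Kernels.* For $\kappa\in\mathscr S'(\mathbb R^{2d})$ let $\mathfrak{int}(\kappa)\in\mathcal B(\mathscr S(\mathbb R^d),\mathscr S'(\mathbb R^d))$ be given by $\langle\mathfrak{int}(\kappa)f,g\rangle=\langle\kappa,g\otimes f\rangle$, and let $\mathfrak{Int}\colon\mathscr S'(\mathbb R^{4d})\to\mathcal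 B(\mathscr S(\mathbb R^{2d}),\mathscr S'(\mathbb R^{2d}))$ be given by the same formula. By the Schwartz kernel theorem $\mathfrak{int}$ is a bijection, and it restricts to a bijection of $\mathscr S(\mathbb R^{2d})$ onto the smoothing operators $\mathcal B(\mathscr S'(\mathbb R^d),\mathscr S(\mathbb R^d))\subset\mathcal B(\mathscr S(\mathbb R^d),\mathscr S'(\mathbb R^d))$. For $R\in\mathcal B(\mathscr S,\mathscr S')$ and $T\in\mathcal B(\mathscr S',\mathscr S)$ put $\langle R,T\rangle_{\mathcal B',\mathcal B}=\langle\mathfrak{int}^{-1}(R),\mathfrak{int}^{-1}(T)\rangle$. *Magnetic super Weyl quantization.* For $\Phi\in\mathscr S(\mathbb R^{4d})$ let $$(K^A\Phi)(x_L,x_R,y_L,y_R)=\frac1{(2\pi)^{2d}}\int d\xi_L\,d\xi_R\;e^{i[\xi_L\cdot(x_L-y_L)-\xi_R\cdot(x_R-y_R)]}e^{i[\varphi(x_L,y_L)-\varphi(x_R,y_R)]}\,\Phi\Big(\frac{x_L+y_L}2,\xi_L,\frac{x_R+y_R}2,\xi_R\Big),$$ extended by duality to $\Phi\in\mathscr S'(\mathbb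 R^{4d})$, and for $\Phi\in\mathscr S'(\mathbb R^{4d})$ let $\mathfrak{Op}^A(\Phi)=\mathfrak{int}\circ\mathfrak{Int}(K^A\Phi)\circ\mathfrak{int}^{-1}$, a map from $\mathcal B(\mathscr S',\mathscr S)$ to $\mathcal B(\mathscr S,\mathscr S')$. *Frame.* Fix a real function $\mathfrak g\in C_c^\infty(\mathbb R^d)$ with $\operatorname{supp}\mathfrak g\subset(-1,1)^d$ and $\sum_{\alpha\in\mathbb Z^d}\mathfrak g(x-\alpha)^2=1$ for all $x$. For $\tilde\alpha=(\alpha,\alpha')\in\mathbb Z^{2d}$ put $\mathcal G_{\tilde\alpha}^A(x)=(2\pi)^{-d/2}e^{i\varphi(x,\alpha)}\mathfrak g(x-\alpha)e^{i\alpha'\cdot(x-\alpha)}$, and put $\mathcal T^A_{\tilde\alpha,\tilde\beta}=\mathfrak{int}\big(\mathcal G^A_{\tilde\alpha}\otimes\overline{\mathcal G^A_{\tilde\beta}}\big)$, $\overline{\mathcal T^A_{\tilde\alpha,\tilde\beta}}=\mathfrak{int}\big(\overline{\mathcal G^A_{\tilde\alpha}}\otimes\mathcal G^A_{\tilde\beta}\big)$.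 The matrix of a map $\mathfrak T\colon\mathcal B(\mathscr S',\mathscr S)\to\mathcal B(\mathscr S,\mathscr S')$ is $$\mathbb M^A_{(\tilde\alpha,\tilde\beta),(\tilde\gamma,\tilde\delta)}[\mathfrak T]=\big\langle\mathfrak T\,\mathcal T^A_{\tilde\gamma,\tilde\delta},\overline{\mathcal T^A_{\tilde\alpha,\tilde\beta}}\big\rangle_{\mathcal B',\mathcal B},$$ and $\mathcal T^A_{\tilde\alpha,\tilde\beta}\bowtie\overline{\mathcal T^A_{\tilde\gamma,\tilde\delta}}$ is the map $S\mapsto\big\langle S,\overline{\mathcal T^A_{\tilde\gamma,\tilde\delta}}\big\rangle_{\mathcal B',\mathcal B}\,\mathcal T^A_{\tilde\alpha,\tilde\beta}$. *Symbols.* A tempered weight is a function $M\colon\mathbb R^{4d}\to(0,\infty)$ for which there are $a,C>0$ with $M(\mathbf X+\mathbf Y)\le C\,M(\mathbf X)\langle\mathbf Y\rangle^a$ for all $\mathbf X,\mathbf Y$. The class $S_0(M)$ consists of the $\Phi\in C^\infty(\mathbb R^{4d})$ for which all the seminorms $$\|\Phi\|_{S_0(M),k}=\sum_{|\gamma|\le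 k}\sup_{\mathbf X}M(\mathbf X)^{-1}|\partial^\gamma\Phi(\mathbf X)|,\qquad k\in\mathbb N_0,$$ have finite terms. For complex numbers $N=(N_{i,j})_{i,j\in\mathbb Z^{4d}}$ put $$|N|_{M,n}=\sup_{i,j\in\mathbb Z^{4d}}\langle i-j\rangle^n\,M\Big(\frac{i+j}2\Big)^{-1}|N_{i,j}|\in[0,\infty],\qquad n\in\mathbb N_0,$$ where $i=(\tilde\alpha,\tilde\beta)$ and $j=(\tilde\gamma,\tilde\delta)$ are regarded as points $(X_L,X_R)$ of $\mathbb R^{4d}$. **Theorem 3.3.** Let $M$ be a tempered weight on $\mathbb R^{4d}$. (i) For every $n\in\mathbb N_0$ there are $C>0$ and $k\in\mathbb N_0$ such that for all $\Phi\in S_0(M)$ $$\big|\mathbb M^A[\mathfrak{Op}^A(\Phi)]\big|_{M,n}\le C\,\|\Phi\|_{S_0(M),k}.$$ (ii) Each map $\mathcal T^A_{i}\bowtie\overline{\mathcal T^A_{j}}$ $(i,j\in\mathbb Z^{4d})$, restricted to smoothing operators, is $\mathfrak{Op}^A$ of a Schwartz function, denoted $(\mathfrak{Op}^A)^{-1}\big(\mathcal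 T^A_{i}\bowtie\overline{\mathcal T^A_{j}}\big)$. If complex numbers $N=(N_{i,j})_{i,j\in\mathbb Z^{4d}}$ satisfy $|N|_{M,n}<\infty$ for all $n\in\mathbb N_0$, then the series $$\sum_{i,j\in\mathbb Z^{4d}}N_{i,j}\,(\mathfrak{Op}^A)^{-1}\Big(\mathcal T^A_{i}\bowtie\overline{\mathcal T^A_{j}}\Big)$$ converges unconditionally, uniformly on compact sets, to a member of $S_0(M)$. Moreover, for every $k\in\mathbb N_0$ there are $C>0$ and $n\in\mathbb N_0$, independent of $N$, such that the limit $\Phi$ satisfies $\|\Phi\|_{S_0(M),k}\le C\,|N|_{M,n}$ for all such $N$. -/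

import Mathlib

noncomputable section

namespace MagneticWeyl

open MeasureTheory SchwartzMap
open scoped ContDiff Topology

set_option linter.unusedSectionVars false
set_option linter.unusedVariables false

/-! ### Partial Fourier transforms of Schwartz functions -/

section PartialFourier

variable {U V : Type} [NormedAddCommGroup U] [NormedSpace ℝ U]
  [NormedAddCommGroup V] [InnerProductSpace ℝ V] [FiniteDimensional ℝ V] [MeasurableSpace V]
  [BorelSpace V]

/-- The partial Fourier integral `(u, ξ) ↦ ∫ e^{i s ξ·v} F(u, v) dv`. -/
def partialFourierFun {W : Type} [NormedAddCommGroup W] [NormedSpace ℝ W] [NormedSpace ℂ W]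
    [IsScalarTower ℝ ℂ W] (s : ℝ)
    (F : U × V → W) (p : U × V) : W :=
  ∫ v : V, Complex.exp (Complex.I * ((s * inner ℝ p.2 v : ℝ) : ℂ)) • F (p.1, v)

theorem norm_expI (t : ℝ) : ‖Complex.exp (Complex.I * (t : ℂ))‖ = 1 := by
  rw [mul_comm]; exact Complex.norm_exp_ofReal_mul_I t

theorem norm_expI_smul {W : Type} [NormedAddCommGroup W] [NormedSpace ℂ W] (t : ℝ) (w : W) :
    ‖Complex.exp (Complex.I * (t : ℂ)) • w‖ = ‖w‖ := by
  rw [norm_smul, norm_expI, one_mul]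

section
variable {W : Type} [NormedAddCommGroup W] [NormedSpace ℝ W] [NormedSpace ℂ W]
    [IsScalarTower ℝ ℂ W]

theorem exists_seminorm_bound (n : ℕ) (W : Type) [NormedAddCommGroup W] [NormedSpace ℝ W] [NormedSpace ℂ W]
    [IsScalarTower ℝ ℂ W] {E : Type}
    [NormedAddCommGroup E] [NormedSpace ℝ E] :
    ∃ q : Seminorm ℂ 𝓢(E, W), Continuous q ∧
    ∀ (F : 𝓢(E, W)) (x : E), (1 + ‖x‖) ^ n * ‖F x‖ ≤ q F := by
  set p : Seminorm ℂ 𝓢(E, W) := (Finset.Iic (n, 0)).sup (schwartzSeminormFamily ℂ E W)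
  have hp : Continuous p := Seminorm.continuous_finsetSup
    (fun _ _ => (schwartz_withSeminorms ℂ E W).continuous_seminorm _)
  refine ⟨((2 : NNReal) ^ n) • p, ?_, fun F x => ?_⟩
  · exact hp.const_smul ((2 : NNReal) ^ n)
  · have h1 := one_add_le_sup_seminorm_apply (𝕜 := ℂ) (m := (n, 0)) (k := n) (n := 0)
      le_rfl le_rfl F x
    rw [norm_iteratedFDeriv_zero] at h1
    exact h1

theorem exists_slice_bound (k : ℕ) : ∃ q : Seminorm ℂ 𝓢(U × V, W), Continuous q ∧
    ∀ (F : 𝓢(U × V, W)) (u : U) (v : V),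
      ‖u‖ ^ k * ‖F (u, v)‖ ≤ q F * (1 + ‖v‖) ^ (-((Module.finrank ℝ V + 1 : ℕ) : ℝ)) := by
  obtain ⟨q, hq, h⟩ := exists_seminorm_bound (k + (Module.finrank ℝ V + 1)) W (E := U × V)
  refine ⟨q, hq, fun F u v => ?_⟩
  have hu : ‖u‖ ≤ 1 + ‖(u, v)‖ := (norm_fst_le (u, v)).trans (by simp)
  have hv : 1 + ‖v‖ ≤ 1 + ‖(u, v)‖ := by gcongr; exact norm_snd_le (u, v)
  rw [Real.rpow_neg (by positivity), Real.rpow_natCast, ← div_eq_mul_inv, le_div_iff₀ (by positivity)]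
  refine le_trans ?_ (h F (u, v))
  calc _ = ‖u‖ ^ k * (1 + ‖v‖) ^ (Module.finrank ℝ V + 1) * ‖F (u, v)‖ := by ring
    _ ≤ _ := by rw [pow_add (1 + ‖(u, v)‖) k]; gcongr

theorem integrable_weight : Integrable (fun v : V =>
    (1 + ‖v‖) ^ (-((Module.finrank ℝ V + 1 : ℕ) : ℝ))) :=
  integrable_one_add_norm (by push_cast; linarith)

theorem integrable_slice (F : 𝓢(U × V, W)) (u : U) : Integrable (fun v : V => F (u, v)) := by
  obtain ⟨q, -, h⟩ := exists_slice_bound (U := U) (V := V) (W := W) 0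
  refine (integrable_weight.const_mul (q F)).mono' ?_ (Filter.Eventually.of_forall fun v => ?_)
  · exact (F.continuous.comp (by fun_prop)).aestronglyMeasurable
  · simpa using h F u v

theorem integrable_expI_slice (s : ℝ) (F : 𝓢(U × V, W)) (p : U × V) : Integrable (fun v : V =>
    Complex.exp (Complex.I * ((s * inner ℝ p.2 v : ℝ) : ℂ)) • F (p.1, v)) := by
  refine ((integrable_slice F p.1).norm).mono' ?_ (Filter.Eventually.of_forall fun v => ?_)
  · refine Continuous.aestronglyMeasurable ?_
    have := F.continuous
    fun_prop
  · rw [norm_smul, norm_expI, one_mul]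

theorem exists_partialFourier_bound_left (k : ℕ) : ∃ q : Seminorm ℂ 𝓢(U × V, W), Continuous q ∧
    ∀ (s : ℝ) (F : 𝓢(U × V, W)) (p : U × V), ‖p.1‖ ^ k * ‖partialFourierFun s F p‖ ≤ q F := by
  obtain ⟨q, hq, h⟩ := exists_slice_bound (U := U) (V := V) (W := W) k
  set c : NNReal := ⟨∫ v : V, (1 + ‖v‖) ^ (-((Module.finrank ℝ V + 1 : ℕ) : ℝ)),
    integral_nonneg fun v => by positivity⟩
  refine ⟨c • q, hq.const_smul c, fun s F p => ?_⟩
  calc ‖p.1‖ ^ k * ‖partialFourierFun s F p‖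
      ≤ ‖p.1‖ ^ k * ∫ v : V, ‖F (p.1, v)‖ := by
        gcongr
        refine (norm_integral_le_integral_norm _).trans (le_of_eq ?_)
        simp only [norm_smul, norm_expI, one_mul]
    _ = ∫ v : V, ‖p.1‖ ^ k * ‖F (p.1, v)‖ := (integral_const_mul _ _).symm
    _ ≤ ∫ v : V, q F * (1 + ‖v‖) ^ (-((Module.finrank ℝ V + 1 : ℕ) : ℝ)) :=
        integral_mono ((integrable_slice F p.1).norm.const_mul _)
          (integrable_weight.const_mul _) (fun v => h F p.1 v)
    _ = c * q F := by rw [integral_const_mul, mul_comm]; rfl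
    _ = (c • q) F := rfl

/-- Integration by parts in the integrated variable. -/
theorem inner_mul_partialFourierFun (s : ℝ) (F : 𝓢(U × V, W)) (p : U × V) (e : V) :
    (Complex.I * ((s * inner ℝ p.2 e : ℝ) : ℂ)) • partialFourierFun s F p =
      -partialFourierFun s (LineDeriv.lineDerivOp ((0, e) : U × V) F) p := by
  have hd : ∀ v : V, HasFDerivAt
      (fun v : V => Complex.exp (Complex.I * ((s * inner ℝ p.2 v : ℝ) : ℂ)))
      (Complex.exp (Complex.I * ((s * inner ℝ p.2 v : ℝ) : ℂ)) •
        (Complex.I • Complex.ofRealCLM.comp (s • innerSL ℝ p.2))) v := by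
    intro v
    have h1 : HasFDerivAt (fun v : V => Complex.I * ((s * inner ℝ p.2 v : ℝ) : ℂ))
        (Complex.I • Complex.ofRealCLM.comp (s • innerSL ℝ p.2)) v := by
      have := ((Complex.ofRealCLM.comp (s • innerSL ℝ p.2)).hasFDerivAt (x := v)).const_mul Complex.I
      simpa using this
    exact h1.cexp
  have hF : ∀ v : V, HasFDerivAt (fun v : V => F (p.1, v))
      ((fderiv ℝ F (p.1, v)).comp (ContinuousLinearMap.inr ℝ U V)) v := by
    intro v
    exact (F.differentiableAt.hasFDerivAt).comp v (hasFDerivAt_prodMk_right p.1 v)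
  have key := integral_smul_fderiv_eq_neg_fderiv_smul_of_integrable (μ := (volume : Measure V))
    (f := fun v : V => Complex.exp (Complex.I * ((s * inner ℝ p.2 v : ℝ) : ℂ)))
    (g := fun v : V => F (p.1, v)) (v := e) ?_ ?_ ?_ (fun v _ => (hd v).differentiableAt)
    (fun v _ => (hF v).differentiableAt)
  · simp only [(hF _).fderiv, (hd _).fderiv] at key
    unfold partialFourierFun
    rw [← integral_smul, eq_comm]
    simp only [lineDerivOp_apply_eq_fderiv]
    refine Eq.trans (congrArg Neg.neg ?_) ((congrArg Neg.neg key).trans ((neg_neg _).trans ?_))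
    · simp
    · refine integral_congr_ae (Filter.Eventually.of_forall fun v => ?_)
      simp [smul_smul]
      congr 1
      ring
  · simp only [(hd _).fderiv]
    refine ((integrable_expI_slice s F p).smul (Complex.I * ((s * inner ℝ p.2 e : ℝ) : ℂ))).congr
      (Filter.Eventually.of_forall fun v => ?_)
    simp [smul_smul]
    congr 1
    ring
  · simp only [(hF _).fderiv]
    refine (integrable_expI_slice s (LineDeriv.lineDerivOp ((0, e) : U × V) F) p).congr
      (Filter.Eventually.of_forall fun v => ?_)
    simp [lineDerivOp_apply_eq_fderiv]
  · exact integrable_expI_slice s F p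

theorem exists_partialFourier_bound_right (s : ℝ) (hs : s ≠ 0) (k : ℕ) :
    ∃ q : Seminorm ℂ 𝓢(U × V, W), Continuous q ∧
    ∀ (F : 𝓢(U × V, W)) (p : U × V), ‖p.2‖ ^ k * ‖partialFourierFun s F p‖ ≤ q F := by
  induction k with
  | zero =>
    obtain ⟨q, hq, h⟩ := exists_partialFourier_bound_left (U := U) (V := V) (W := W) 0
    exact ⟨q, hq, fun F p => by simpa using h s F p⟩
  | succ k ih =>
    obtain ⟨q, hq, h⟩ := ih
    let b := stdOrthonormalBasis ℝ V
    let D : Fin (Module.finrank ℝ V) → 𝓢(U × V, W) →L[ℂ] 𝓢(U × V, W) := fun i =>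
      LineDeriv.lineDerivOpCLM ℂ 𝓢(U × V, W) ((0, b i) : U × V)
    let c : NNReal := ⟨|s|⁻¹, by positivity⟩
    refine ⟨c • ∑ i, q.comp (D i).toLinearMap, ?_, fun F p => ?_⟩
    · refine Continuous.const_smul (g := ⇑(∑ i, q.comp (D i).toLinearMap)) ?_ c
      exact Seminorm.continuous_finsetSum fun i _ => hq.comp (D i).continuous
    · have h1 : ‖p.2‖ ≤ ∑ i, |inner ℝ p.2 (b i)| := by
        conv_lhs => rw [← b.sum_repr' p.2]
        refine (norm_sum_le _ _).trans (le_of_eq ?_)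
        simp [norm_smul, real_inner_comm]
      have h2 : ∀ i, |inner ℝ p.2 (b i)| * ‖partialFourierFun s F p‖ =
          |s|⁻¹ * ‖partialFourierFun s (D i F) p‖ := by
        intro i
        have := congrArg norm (inner_mul_partialFourierFun s F p (b i))
        rw [norm_smul, norm_neg, norm_mul, Complex.norm_I, one_mul, Complex.norm_real,
          Real.norm_eq_abs, abs_mul] at this
        have hs' : |s| ≠ 0 := by simpa using hs
        rw [eq_inv_mul_iff_mul_eq₀ hs', ← mul_assoc, this]
        rfl
      calc ‖p.2‖ ^ (k + 1) * ‖partialFourierFun s F p‖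
          ≤ ‖p.2‖ ^ k * (∑ i, |inner ℝ p.2 (b i)|) * ‖partialFourierFun s F p‖ := by
            rw [pow_succ]; gcongr
        _ = ∑ i, |s|⁻¹ * (‖p.2‖ ^ k * ‖partialFourierFun s (D i F) p‖) := by
            rw [mul_assoc, Finset.sum_mul, Finset.mul_sum]
            refine Finset.sum_congr rfl fun i _ => ?_
            rw [h2]; ring
        _ ≤ ∑ i, |s|⁻¹ * q (D i F) := by
            gcongr with i _
            exact h _ _
        _ = (c • ∑ i, q.comp (D i).toLinearMap) F := by
            rw [← Finset.mul_sum, smul_apply, sum_apply]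
            rfl

theorem exists_partialFourier_bound (s : ℝ) (hs : s ≠ 0) (k : ℕ) :
    ∃ q : Seminorm ℂ 𝓢(U × V, W), Continuous q ∧
    ∀ (F : 𝓢(U × V, W)) (p : U × V), ‖p‖ ^ k * ‖partialFourierFun s F p‖ ≤ q F := by
  obtain ⟨q1, hq1, h1⟩ := exists_partialFourier_bound_left (U := U) (V := V) (W := W) k
  obtain ⟨q2, hq2, h2⟩ := exists_partialFourier_bound_right (U := U) (V := V) (W := W) s hs k
  refine ⟨q1 + q2, hq1.add hq2, fun F p => ?_⟩
  have h : ‖p‖ ^ k ≤ ‖p.1‖ ^ k + ‖p.2‖ ^ k := by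
    rw [Prod.norm_def]
    rcases max_cases ‖p.1‖ ‖p.2‖ with h | h <;> rw [h.1] <;>
      linarith [pow_nonneg (norm_nonneg p.1) k, pow_nonneg (norm_nonneg p.2) k]
  calc _ ≤ (‖p.1‖ ^ k + ‖p.2‖ ^ k) * ‖partialFourierFun s F p‖ := by gcongr
    _ ≤ q1 F + q2 F := by rw [add_mul]; exact add_le_add (h1 s F p) (h2 F p)

end

section
variable {W : Type} [NormedAddCommGroup W] [NormedSpace ℝ W] [NormedSpace ℂ W]
    [IsScalarTower ℝ ℂ W]

variable (U V) in
/-- The bilinear form `((u, ξ), (u', v)) ↦ s ξ·v`. -/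
def phaseForm (s : ℝ) : U × V →L[ℝ] U × V →L[ℝ] ℝ :=
  s • ((innerSL ℝ).bilinearComp (ContinuousLinearMap.snd ℝ U V) (ContinuousLinearMap.snd ℝ U V))

variable (U V W) in
/-- Restriction of a linear map on `U × V` to the first factor. -/
def restrictLeft : (U × V →L[ℝ] W) →L[ℂ] (U × V →L[ℝ] W) :=
  LinearMap.mkContinuous (𝕜 := ℂ) (E := U × V →L[ℝ] W) (F := U × V →L[ℝ] W) (σ := RingHom.id ℂ)
    { toFun := fun L => ContinuousLinearMap.comp L ((ContinuousLinearMap.inl ℝ U V).comp (ContinuousLinearMap.fst ℝ U V))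
      map_add' := fun _ _ => rfl
      map_smul' := fun _ _ => rfl }
    ‖(ContinuousLinearMap.inl ℝ U V).comp (ContinuousLinearMap.fst ℝ U V)‖
    (fun L => (ContinuousLinearMap.opNorm_comp_le _ _).trans (le_of_eq (mul_comm _ _)))

variable (U V W) in
/-- The operator on Schwartz functions that differentiation of the partial Fourier integral turns into. -/
def partialFourierDeriv (s : ℝ) : 𝓢(U × V, W) →L[ℂ] 𝓢(U × V, U × V →L[ℝ] W) :=
  (postcompCLM (restrictLeft U V W)) ∘L (fderivCLM ℂ (U × V) W)
  + Complex.I • smulRightCLM ℂ W (phaseForm U V s)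

theorem partialFourierDeriv_apply (s : ℝ) (F : 𝓢(U × V, W)) (p : U × V) :
    partialFourierDeriv U V W s F p =
      (fderiv ℝ F p).comp ((ContinuousLinearMap.inl ℝ U V).comp (ContinuousLinearMap.fst ℝ U V)) +
      Complex.I • (phaseForm U V s p).smulRight (F p) := by
  simp only [partialFourierDeriv, add_apply, smul_apply, smulRightCLM_apply_apply,
    ContinuousLinearMap.comp_apply, postcompCLM_apply, fderivCLM_apply]
  rfl

theorem hasFDerivAt_expI_smul (s : ℝ) (F : 𝓢(U × V, W)) (v : V) (p : U × V) :
    HasFDerivAt (fun p : U × V =>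
        Complex.exp (Complex.I * ((s * inner ℝ p.2 v : ℝ) : ℂ)) • F (p.1, v))
      (Complex.exp (Complex.I * ((s * inner ℝ p.2 v : ℝ) : ℂ)) •
        partialFourierDeriv U V W s F (p.1, v)) p := by
  have h0 : HasFDerivAt (fun p : U × V => s * inner ℝ p.2 v) (phaseForm U V s (p.1, v)) p := by
    have h := (phaseForm U V s (p.1, v)).hasFDerivAt (x := p)
    refine h.congr_of_eventuallyEq (Filter.Eventually.of_forall fun x => ?_)
    simp [phaseForm, real_inner_comm]
  have h1 : HasFDerivAt (fun p : U × V => Complex.exp (Complex.I * ((s * inner ℝ p.2 v : ℝ) : ℂ)))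
      (Complex.exp (Complex.I * ((s * inner ℝ p.2 v : ℝ) : ℂ)) •
        (Complex.I • Complex.ofRealCLM.comp (phaseForm U V s (p.1, v)))) p :=
    ((Complex.ofRealCLM.hasFDerivAt.comp p h0).const_mul Complex.I).cexp
  have h2 : HasFDerivAt (fun p : U × V => F (p.1, v))
      ((fderiv ℝ F (p.1, v)).comp
        ((ContinuousLinearMap.inl ℝ U V).comp (ContinuousLinearMap.fst ℝ U V))) p :=
    HasFDerivAt.comp (f := fun p : U × V => (p.1, v)) p (F.differentiableAt.hasFDerivAt)
      (HasFDerivAt.comp (f := Prod.fst) (g := fun u => (u, v)) p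
        (hasFDerivAt_prodMk_left p.1 v) hasFDerivAt_fst)
  refine (h1.smul h2).congr_fderiv ?_
  rw [partialFourierDeriv_apply]
  ext x
  · simp [phaseForm, smul_smul]
  · have h (r : ℝ) (w : W) : (r : ℂ) • w = r • w := algebraMap_smul ℂ r w
    simp [phaseForm, smul_smul]
    rw [mul_smul]
    congr 1
    rw [← Complex.ofReal_mul, h]

theorem hasFDerivAt_partialFourierFun (s : ℝ) (F : 𝓢(U × V, W)) (p : U × V) :
    HasFDerivAt (partialFourierFun s F) (partialFourierFun s (partialFourierDeriv U V W s F) p) p := by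
  obtain ⟨q, -, hq⟩ := exists_slice_bound (U := U) (V := V) (W := U × V →L[ℝ] W) 0
  generalize hG : partialFourierDeriv U V W s F = G
  have h1 : ∀ᵐ v : V, ∀ p ∈ (Set.univ : Set (U × V)),
      ‖Complex.exp (Complex.I * ((s * inner ℝ p.2 v : ℝ) : ℂ)) • G (p.1, v)‖ ≤
        q G * (1 + ‖v‖) ^ (-((Module.finrank ℝ V + 1 : ℕ) : ℝ)) := by
    refine Filter.Eventually.of_forall fun v p _ => ?_
    exact (norm_expI_smul _ _).trans_le (by simpa only [pow_zero, one_mul] using hq G p.1 v)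
  have h2 : ∀ᵐ v : V, ∀ p ∈ (Set.univ : Set (U × V)), HasFDerivAt (fun p : U × V =>
        Complex.exp (Complex.I * ((s * inner ℝ p.2 v : ℝ) : ℂ)) • F (p.1, v))
      (Complex.exp (Complex.I * ((s * inner ℝ p.2 v : ℝ) : ℂ)) • G (p.1, v)) p := by
    refine Filter.Eventually.of_forall fun v p _ => ?_
    rw [← hG]
    exact hasFDerivAt_expI_smul s F v p
  exact hasFDerivAt_integral_of_dominated_of_fderiv_le (𝕜 := ℝ) (s := Set.univ) Filter.univ_mem
    (Filter.Eventually.of_forall fun p => (integrable_expI_slice s F p).aestronglyMeasurable)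
    (integrable_expI_slice s F p) (integrable_expI_slice s G p).aestronglyMeasurable
    h1 (integrable_weight.const_mul (q G)) h2

theorem differentiable_partialFourierFun (s : ℝ) (F : 𝓢(U × V, W)) :
    Differentiable ℝ (partialFourierFun s F) :=
  fun p => (hasFDerivAt_partialFourierFun s F p).differentiableAt

theorem fderiv_partialFourierFun (s : ℝ) (F : 𝓢(U × V, W)) :
    fderiv ℝ (partialFourierFun s F) = partialFourierFun s (partialFourierDeriv U V W s F) :=
  funext fun p => (hasFDerivAt_partialFourierFun s F p).fderiv

end

theorem contDiff_partialFourierFun (s : ℝ) (n : ℕ) : ∀ (W : Type) [NormedAddCommGroup W]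
    [NormedSpace ℝ W] [NormedSpace ℂ W]
    [IsScalarTower ℝ ℂ W] (F : 𝓢(U × V, W)), ContDiff ℝ n (partialFourierFun s F) := by
  induction n with
  | zero =>
    intro W _ _ _ _ F
    exact contDiff_zero.2 (differentiable_partialFourierFun s F).continuous
  | succ n ih =>
    intro W _ _ _ _ F
    rw [Nat.cast_succ, contDiff_succ_iff_fderiv]
    refine ⟨differentiable_partialFourierFun s F, by simp, ?_⟩
    rw [fderiv_partialFourierFun]
    exact ih _ _

theorem exists_partialFourier_deriv_bound (s : ℝ) (hs : s ≠ 0) (k n : ℕ) : ∀ (W : Type)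
    [NormedAddCommGroup W] [NormedSpace ℝ W] [NormedSpace ℂ W]
    [IsScalarTower ℝ ℂ W], ∃ q : Seminorm ℂ 𝓢(U × V, W), Continuous q ∧
    ∀ (F : 𝓢(U × V, W)) (p : U × V),
      ‖p‖ ^ k * ‖iteratedFDeriv ℝ n (partialFourierFun s F) p‖ ≤ q F := by
  induction n with
  | zero =>
    intro W _ _ _ _
    obtain ⟨q, hq, h⟩ := exists_partialFourier_bound (U := U) (V := V) (W := W) s hs k
    exact ⟨q, hq, fun F p => by simpa using h F p⟩
  | succ n ih =>
    intro W _ _ _ _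
    obtain ⟨q, hq, h⟩ := ih (U × V →L[ℝ] W)
    let q' : Seminorm ℂ 𝓢(U × V, W) := q.comp (partialFourierDeriv U V W s).toLinearMap
    have hq' : Continuous q' := hq.comp (partialFourierDeriv U V W s).continuous
    refine ⟨q', hq', fun F p => ?_⟩
    rw [← norm_iteratedFDeriv_fderiv, fderiv_partialFourierFun]
    exact h _ p

variable (U V) in
/-- The partial Fourier transform `F ↦ ((u, ξ) ↦ ∫ e^{i s ξ·v} F(u, v) dv)` as a continuous linear map of
the Schwartz space. -/
def partialFourier (s : ℝ) (hs : s ≠ 0) : 𝓢(U × V, ℂ) →L[ℂ] 𝓢(U × V, ℂ) :=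
  mkCLM (fun F => partialFourierFun s F)
    (fun F G p => by
      simp only [partialFourierFun, add_apply, smul_add]
      exact integral_add (integrable_expI_slice s F p) (integrable_expI_slice s G p))
    (fun a F p => by
      simp only [partialFourierFun, smul_apply, smul_comm _ a]
      exact integral_smul a _)
    (fun F => contDiff_infty.2 fun n => contDiff_partialFourierFun s n ℂ F)
    (fun n => by
      obtain ⟨q, hq, h⟩ := exists_partialFourier_deriv_bound (U := U) (V := V) s hs n.1 n.2 ℂ
      obtain ⟨t, C, -, hC⟩ := Seminorm.bound_of_continuous (schwartz_withSeminorms ℂ (U × V) ℂ) q hq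
      exact ⟨t, C, C.2, fun F p => (h F p).trans (hC F)⟩)

theorem partialFourier_apply (s : ℝ) (hs : s ≠ 0) (F : 𝓢(U × V, ℂ)) (p : U × V) :
    partialFourier U V s hs F p =
      ∫ v : V, Complex.exp (Complex.I * ((s * inner ℝ p.2 v : ℝ) : ℂ)) * F (p.1, v) := rfl

end PartialFourier

/-! ### Integrals depending on a parameter -/

section ParamIntegral
variable {E : Type} [NormedAddCommGroup E] [NormedSpace ℝ E]

theorem hasFDerivAt_paramIntegral {F : Type} [NormedAddCommGroup F] [NormedSpace ℝ F]
    [FiniteDimensional ℝ E]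
    (h : ℝ × E → F) (hh : ContDiff ℝ ∞ h) (x : E) :
    HasFDerivAt (fun x => ∫ t in (0 : ℝ)..1, h (t, x))
      (∫ t in (0 : ℝ)..1, (fderiv ℝ h (t, x)).comp (ContinuousLinearMap.inr ℝ ℝ E)) x := by
  have hc : Continuous (fun p : ℝ × E => (fderiv ℝ h p).comp (ContinuousLinearMap.inr ℝ ℝ E)) :=
    ((ContinuousLinearMap.compL ℝ E (ℝ × E) F).flip
      (ContinuousLinearMap.inr ℝ ℝ E)).continuous.comp (hh.continuous_fderiv (by simp))
  obtain ⟨C, hC⟩ := (isCompact_Icc.prod (isCompact_closedBall x 1)).exists_bound_of_continuousOn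
    (f := fun p : ℝ × E => (fderiv ℝ h p).comp (ContinuousLinearMap.inr ℝ ℝ E))
    (s := Set.Icc (0 : ℝ) 1 ×ˢ Metric.closedBall x 1) hc.continuousOn
  refine intervalIntegral.hasFDerivAt_integral_of_dominated_of_fderiv_le (𝕜 := ℝ)
    (F := fun x t => h (t, x)) (bound := fun _ => C)
    (F' := fun x t => (fderiv ℝ h (t, x)).comp (ContinuousLinearMap.inr ℝ ℝ E))
    (Metric.closedBall_mem_nhds x one_pos) (Filter.Eventually.of_forall fun y => ?_)
    ?_ ?_ (Filter.Eventually.of_forall fun t ht y hy => ?_) (by simp)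
    (Filter.Eventually.of_forall fun t ht y hy => ?_)
  · exact (hh.continuous.comp (by fun_prop : Continuous fun t : ℝ => (t, y))).aestronglyMeasurable
  · exact (hh.continuous.comp (by fun_prop : Continuous fun t : ℝ => (t, x))).intervalIntegrable _ _
  · exact (hc.comp (by fun_prop : Continuous fun t : ℝ => (t, x))).aestronglyMeasurable
  · rw [Set.uIoc_of_le zero_le_one] at ht
    exact hC (t, y) ⟨Set.Ioc_subset_Icc_self ht, hy⟩
  · exact HasFDerivAt.comp (f := fun y => (t, y)) y
      (hh.differentiable (by simp) (t, y)).hasFDerivAt (hasFDerivAt_prodMk_right t y)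

theorem paramIntegral_aux [FiniteDimensional ℝ E] (n : ℕ) : ∀ (F : Type) [NormedAddCommGroup F]
    [NormedSpace ℝ F] (h : ℝ × E → F), h.HasTemperateGrowth →
    ContDiff ℝ n (fun x => ∫ t in (0 : ℝ)..1, h (t, x)) ∧
    ∃ (k : ℕ) (C : ℝ), ∀ x,
      ‖iteratedFDeriv ℝ n (fun x => ∫ t in (0 : ℝ)..1, h (t, x)) x‖ ≤ C * (1 + ‖x‖) ^ k := by
  induction n with
  | zero =>
    intro F _ _ h hh
    refine ⟨contDiff_zero.2 (continuous_iff_continuousAt.2 fun x =>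
      (hasFDerivAt_paramIntegral h hh.1 x).continuousAt), ?_⟩
    obtain ⟨k, C, hC⟩ := hh.2 0
    refine ⟨k, C * 2 ^ k, fun x => ?_⟩
    have h0 : 0 ≤ C := by simpa using (norm_nonneg _).trans (hC 0)
    rw [norm_iteratedFDeriv_zero]
    refine (intervalIntegral.norm_integral_le_of_norm_le_const (C := C * 2 ^ k * (1 + ‖x‖) ^ k)
      fun t ht => ?_).trans (by simp)
    rw [Set.uIoc_of_le zero_le_one] at ht
    have h1 := hC (t, x)
    rw [norm_iteratedFDeriv_zero] at h1
    refine h1.trans ?_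
    rw [mul_assoc, ← mul_pow]
    have : ‖(t, x)‖ ≤ 1 + ‖x‖ := by
      rw [Prod.norm_def]
      refine max_le ?_ (by simp)
      have : ‖t‖ ≤ 1 := by rw [Real.norm_of_nonneg ht.1.le]; exact ht.2
      linarith [norm_nonneg x]
    gcongr
    linarith [norm_nonneg x]
  | succ n ih =>
    intro F _ _ h hh
    have hd : fderiv ℝ (fun x => ∫ t in (0 : ℝ)..1, h (t, x)) = fun x => ∫ t in (0 : ℝ)..1,
        ((fun p : ℝ × E => (fderiv ℝ h p).comp (ContinuousLinearMap.inr ℝ ℝ E)) (t, x)) :=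
      funext fun x => (hasFDerivAt_paramIntegral h hh.1 x).fderiv
    have ht : Function.HasTemperateGrowth
        (fun p : ℝ × E => (fderiv ℝ h p).comp (ContinuousLinearMap.inr ℝ ℝ E)) := by
      have h1 : (fderiv ℝ h).HasTemperateGrowth :=
        ⟨hh.1.fderiv_right (m := ∞) (by simp), fun n => by
          obtain ⟨k, C, hC⟩ := hh.2 (n + 1)
          exact ⟨k, C, fun x => norm_iteratedFDeriv_fderiv.trans_le (hC x)⟩⟩
      exact (((ContinuousLinearMap.compL ℝ E (ℝ × E) F).flip
        (ContinuousLinearMap.inr ℝ ℝ E)).hasTemperateGrowth).comp h1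
    obtain ⟨h1, k, C, h2⟩ := ih _ _ ht
    refine ⟨?_, k, C, fun x => ?_⟩
    · rw [Nat.cast_succ, contDiff_succ_iff_fderiv]
      refine ⟨fun x => (hasFDerivAt_paramIntegral h hh.1 x).differentiableAt, by simp, ?_⟩
      rw [hd]; exact h1
    · rw [← norm_iteratedFDeriv_fderiv, hd]; exact h2 x

theorem hasTemperateGrowth_paramIntegral [FiniteDimensional ℝ E] {F : Type} [NormedAddCommGroup F]
    [NormedSpace ℝ F] {h : ℝ × E → F} (hh : h.HasTemperateGrowth) :
    (fun x => ∫ t in (0 : ℝ)..1, h (t, x)).HasTemperateGrowth :=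
  ⟨contDiff_infty.2 fun n => (paramIntegral_aux n F h hh).1, fun n => (paramIntegral_aux n F h hh).2⟩

theorem hasTemperateGrowth_expI :
    (fun t : ℝ => Complex.exp (Complex.I * (t : ℂ))).HasTemperateGrowth := by
  have hd (t : ℝ) : HasDerivAt (fun t : ℝ => Complex.exp (Complex.I * (t : ℂ)))
      (Complex.I * Complex.exp (Complex.I * (t : ℂ))) t := by
    have := (((Complex.ofRealCLM.hasDerivAt (x := t)).const_mul Complex.I).cexp)
    simpa [mul_comm] using this
  have hn (n : ℕ) : iteratedDeriv n (fun t : ℝ => Complex.exp (Complex.I * (t : ℂ))) =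
      fun t : ℝ => Complex.I ^ n * Complex.exp (Complex.I * (t : ℂ)) := by
    induction n with
    | zero => simp
    | succ n ih =>
      rw [iteratedDeriv_succ, ih]
      funext t
      rw [((hd t).const_mul _).deriv]
      ring
  refine ⟨(contDiff_const.mul Complex.ofRealCLM.contDiff).cexp, fun n => ⟨0, 1, fun t => ?_⟩⟩
  rw [norm_iteratedFDeriv_eq_norm_iteratedDeriv, hn, norm_mul, norm_pow, Complex.norm_I, one_pow,
    mul_comm Complex.I, Complex.norm_exp_ofReal_mul_I]
  simp
end ParamIntegral

/-! ### The magnetic field, its potential, and the magnetic super Weyl transform -/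

/-- Position space `ℝ^d` with the Euclidean norm. -/
abbrev Pos (d : ℕ) : Type := EuclideanSpace ℝ (Fin d)
/-- `ℝ^{2d}`, as pairs. -/
abbrev Pos2 (d : ℕ) : Type := Pos d × Pos d
/-- `ℝ^{4d}`. Points where super symbols live are written `((x_L, ξ_L), (x_R, ξ_R))`; points where super
kernels live are written `((x_L, x_R), (y_L, y_R))`. -/
abbrev Pos4 (d : ℕ) : Type := Pos2 d × Pos2 d

instance (d : ℕ) : (volume : Measure (Pos2 d)).IsAddHaarMeasure :=
  inferInstanceAs ((volume : Measure (Pos d)).prod (volume : Measure (Pos d))).IsAddHaarMeasure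

instance (d : ℕ) : (volume : Measure (Pos4 d)).IsAddHaarMeasure :=
  Measure.prod.instIsAddHaarMeasure (volume : Measure (Pos2 d)) (volume : Measure (Pos2 d))

/-- A regular magnetic field on `ℝ^d`: a smooth closed 2-form `B` whose components `B_{jk}` are bounded
together with all their derivatives. -/
structure RegularMagneticField (d : ℕ) where
  B : Fin d → Fin d → Pos d → ℝ
  antisymm : ∀ j k x, B j k x = -B k j x
  smooth : ∀ j k, ContDiff ℝ ∞ (B j k)
  bounded : ∀ j k (n : ℕ), ∃ C : ℝ, ∀ x, ‖iteratedFDeriv ℝ n (B j k) x‖ ≤ C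
  closed : ∀ i j k x, fderiv ℝ (B j k) x (EuclideanSpace.single i 1) +
    fderiv ℝ (B k i) x (EuclideanSpace.single j 1) +
    fderiv ℝ (B i j) x (EuclideanSpace.single k 1) = 0

variable {d : ℕ}

namespace RegularMagneticField

/-- The potential in the transversal gauge, `A_k(x) = ∑_j ∫₀¹ s x_j B_{jk}(s x) ds`. -/
def potential (𝓑 : RegularMagneticField d) (k : Fin d) (x : Pos d) : ℝ :=
  ∑ j, ∫ s in (0 : ℝ)..1, s * x j * 𝓑.B j k (s • x)

/-- The circulation `φ(x, y) = ∫_{[y, x]} A` of `A` along the segment from `y` to `x`. -/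
def circulation (𝓑 : RegularMagneticField d) (x y : Pos d) : ℝ :=
  ∫ t in (0 : ℝ)..1, ∑ k, 𝓑.potential k (y + t • (x - y)) * (x k - y k)

theorem hasTemperateGrowth_B (𝓑 : RegularMagneticField d) (j k : Fin d) :
    (𝓑.B j k).HasTemperateGrowth :=
  ⟨𝓑.smooth j k, fun n => by
    obtain ⟨C, hC⟩ := 𝓑.bounded j k n
    exact ⟨0, C, fun x => by simpa using hC x⟩⟩

theorem hasTemperateGrowth_coord (j : Fin d) : (fun x : Pos d => x j).HasTemperateGrowth :=
  (EuclideanSpace.proj (𝕜 := ℝ) j : Pos d →L[ℝ] ℝ).hasTemperateGrowth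

theorem hasTemperateGrowth_potential (𝓑 : RegularMagneticField d) (k : Fin d) :
    (𝓑.potential k).HasTemperateGrowth := by
  have h (j : Fin d) : (fun p : ℝ × Pos d => p.1 * p.2 j * 𝓑.B j k (p.1 • p.2)).HasTemperateGrowth := by
    have h1 : (fun p : ℝ × Pos d => p.1).HasTemperateGrowth :=
      (ContinuousLinearMap.fst ℝ ℝ (Pos d)).hasTemperateGrowth
    have h2 : (fun p : ℝ × Pos d => p.2).HasTemperateGrowth :=
      (ContinuousLinearMap.snd ℝ ℝ (Pos d)).hasTemperateGrowth
    exact (h1.mul ((hasTemperateGrowth_coord j).comp h2)).mul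
      ((𝓑.hasTemperateGrowth_B j k).comp (h1.smul h2))
  exact Function.HasTemperateGrowth.sum (s := Finset.univ)
    (f := fun j x => ∫ s in (0 : ℝ)..1, s * x j * 𝓑.B j k (s • x))
    fun j _ => hasTemperateGrowth_paramIntegral (h j)

theorem hasTemperateGrowth_circulation (𝓑 : RegularMagneticField d) :
    (fun p : Pos2 d => 𝓑.circulation p.1 p.2).HasTemperateGrowth := by
  have h : (fun q : ℝ × Pos2 d => ∑ k, 𝓑.potential k (q.2.2 + q.1 • (q.2.1 - q.2.2)) *
      (q.2.1 k - q.2.2 k)).HasTemperateGrowth := by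
    have h1 : (fun q : ℝ × Pos2 d => q.1).HasTemperateGrowth :=
      (ContinuousLinearMap.fst ℝ ℝ (Pos2 d)).hasTemperateGrowth
    have h2 : (fun q : ℝ × Pos2 d => q.2.1).HasTemperateGrowth :=
      ((ContinuousLinearMap.fst ℝ (Pos d) (Pos d)).comp
        (ContinuousLinearMap.snd ℝ ℝ (Pos2 d))).hasTemperateGrowth
    have h3 : (fun q : ℝ × Pos2 d => q.2.2).HasTemperateGrowth :=
      ((ContinuousLinearMap.snd ℝ (Pos d) (Pos d)).comp
        (ContinuousLinearMap.snd ℝ ℝ (Pos2 d))).hasTemperateGrowth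
    exact Function.HasTemperateGrowth.sum (s := Finset.univ) (f := fun k (q : ℝ × Pos2 d) =>
      𝓑.potential k (q.2.2 + q.1 • (q.2.1 - q.2.2)) * (q.2.1 k - q.2.2 k)) fun k _ =>
      ((𝓑.hasTemperateGrowth_potential k).comp (h3.add (h1.smul (h2.sub h3)))).mul
        (((hasTemperateGrowth_coord k).comp h2).sub ((hasTemperateGrowth_coord k).comp h3))
  exact hasTemperateGrowth_paramIntegral h

end RegularMagneticField

open RegularMagneticField

/-- `e^{i(φ(x_L, y_L) - φ(x_R, y_R))}` at the point `((x_L, x_R), (y_L, y_R))`. -/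
def superPhase (𝓑 : RegularMagneticField d) (p : Pos4 d) : ℂ :=
  Complex.exp (Complex.I * ((𝓑.circulation p.1.1 p.2.1 - 𝓑.circulation p.1.2 p.2.2 : ℝ) : ℂ))

theorem hasTemperateGrowth_superPhase (𝓑 : RegularMagneticField d) :
    (superPhase 𝓑).HasTemperateGrowth := by
  let L1 : Pos4 d →L[ℝ] Pos2 d := (ContinuousLinearMap.fst ℝ (Pos d) (Pos d)).prodMap
    (ContinuousLinearMap.fst ℝ (Pos d) (Pos d))
  let L2 : Pos4 d →L[ℝ] Pos2 d := (ContinuousLinearMap.snd ℝ (Pos d) (Pos d)).prodMap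
    (ContinuousLinearMap.snd ℝ (Pos d) (Pos d))
  have h3 : (fun p : Pos4 d => 𝓑.circulation p.1.1 p.2.1).HasTemperateGrowth :=
    Function.HasTemperateGrowth.comp (g := fun p : Pos2 d => 𝓑.circulation p.1 p.2) (f := ⇑L1)
      𝓑.hasTemperateGrowth_circulation L1.hasTemperateGrowth
  have h4 : (fun p : Pos4 d => 𝓑.circulation p.1.2 p.2.2).HasTemperateGrowth :=
    Function.HasTemperateGrowth.comp (g := fun p : Pos2 d => 𝓑.circulation p.1 p.2) (f := ⇑L2)
      𝓑.hasTemperateGrowth_circulation L2.hasTemperateGrowth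
  have h5 : (fun p : Pos4 d =>
      𝓑.circulation p.1.1 p.2.1 - 𝓑.circulation p.1.2 p.2.2).HasTemperateGrowth := h3.sub h4
  exact hasTemperateGrowth_expI.comp h5

variable (d) in
/-- `(p, (x, y)) ↦ ((p, x), y)`. -/
def assocEquiv : Pos4 d ≃L[ℝ] (Pos2 d × Pos d) × Pos d :=
  (ContinuousLinearEquiv.prodAssoc ℝ (Pos2 d) (Pos d) (Pos d)).symm

/-- The partial Fourier transform in the last of the four variables. -/
def fourierRight (s : ℝ) (hs : s ≠ 0) : 𝓢(Pos4 d, ℂ) →L[ℂ] 𝓢(Pos4 d, ℂ) :=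
  compCLMOfContinuousLinearEquiv ℂ (assocEquiv d) ∘L
    partialFourier (Pos2 d × Pos d) (Pos d) s hs ∘L
    compCLMOfContinuousLinearEquiv ℂ (assocEquiv d).symm

/-- Interchange of the two factors `ℝ^{2d}`. -/
def swapCLM : 𝓢(Pos4 d, ℂ) →L[ℂ] 𝓢(Pos4 d, ℂ) :=
  compCLMOfContinuousLinearEquiv ℂ (ContinuousLinearEquiv.prodComm ℝ (Pos2 d) (Pos2 d))

/-- The partial Fourier transform in the second of the four variables. -/
def fourierLeft (s : ℝ) (hs : s ≠ 0) : 𝓢(Pos4 d, ℂ) →L[ℂ] 𝓢(Pos4 d, ℂ) :=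
  swapCLM ∘L fourierRight s hs ∘L swapCLM

/-- `((u_L, v_L), (u_R, v_R)) ↦ ((u_L + v_L/2, u_R + v_R/2), (u_L - v_L/2, u_R - v_R/2))`. -/
def midpointEquiv : Pos4 d ≃L[ℝ] Pos4 d :=
  LinearEquiv.toContinuousLinearEquiv
  { toFun := fun p => ((p.1.1 + (1 / 2 : ℝ) • p.1.2, p.2.1 + (1 / 2 : ℝ) • p.2.2),
      (p.1.1 - (1 / 2 : ℝ) • p.1.2, p.2.1 - (1 / 2 : ℝ) • p.2.2))
    invFun := fun q => (((1 / 2 : ℝ) • (q.1.1 + q.2.1), q.1.1 - q.2.1),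
      ((1 / 2 : ℝ) • (q.1.2 + q.2.2), q.1.2 - q.2.2))
    map_add' := fun p q => by
      ext <;> simp <;> ring
    map_smul' := fun c p => by
      ext <;> simp <;> ring
    left_inv := fun p => by
      ext <;> simp <;> ring
    right_inv := fun p => by
      ext <;> simp <;> ring }

/-- The transpose, on Schwartz functions, of the magnetic super Weyl transform
`(K^A Φ)((x_L, x_R), (y_L, y_R)) = (2π)^{-2d} ∫∫ e^{i[ξ_L·(x_L - y_L) - ξ_R·(x_R - y_R)]}
  e^{i[φ(x_L, y_L) - φ(x_R, y_R)]} Φ((x_L + y_L)/2, ξ_L, (x_R + y_R)/2, ξ_R) dξ_L dξ_R`.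
Substituting `x = u + v/2`, `y = u - v/2` (of Jacobian one) in `∫ (K^A Φ) F` gives `∫ Φ · (transpose F)`,
where the transpose of `F` is the integral in `superWeylTranspose_apply` below. -/
def superWeylTranspose (𝓑 : RegularMagneticField d) : 𝓢(Pos4 d, ℂ) →L[ℂ] 𝓢(Pos4 d, ℂ) :=
  ((2 * Real.pi : ℝ) ^ (2 * d) : ℂ)⁻¹ • (fourierLeft 1 one_ne_zero ∘L
    fourierRight (-1) (by norm_num) ∘L compCLMOfContinuousLinearEquiv ℂ midpointEquiv ∘L
    smulLeftCLM ℂ (superPhase 𝓑))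

theorem superWeylTranspose_apply (𝓑 : RegularMagneticField d) (F : 𝓢(Pos4 d, ℂ)) (uL ξL uR ξR : Pos d) :
    superWeylTranspose 𝓑 F ((uL, ξL), (uR, ξR)) = ((2 * Real.pi : ℝ) ^ (2 * d) : ℂ)⁻¹ *
      ∫ vL : Pos d, Complex.exp (Complex.I * ((inner ℝ ξL vL : ℝ) : ℂ)) *
        ∫ vR : Pos d, Complex.exp (-Complex.I * ((inner ℝ ξR vR : ℝ) : ℂ)) *
          (superPhase 𝓑 ((uL + (1 / 2 : ℝ) • vL, uR + (1 / 2 : ℝ) • vR),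
              (uL - (1 / 2 : ℝ) • vL, uR - (1 / 2 : ℝ) • vR)) *
            F ((uL + (1 / 2 : ℝ) • vL, uR + (1 / 2 : ℝ) • vR),
              (uL - (1 / 2 : ℝ) • vL, uR - (1 / 2 : ℝ) • vR))) := by
  have h := smulLeftCLM_apply_apply (F := ℂ) (hasTemperateGrowth_superPhase 𝓑) F
  simp only [superWeylTranspose, fourierLeft, fourierRight, swapCLM]
  rw [smul_apply, smul_apply, smul_eq_mul]
  congr 1
  have ha (a b c e : Pos d) : assocEquiv d ((a, b), (c, e)) = (((a, b), c), e) := rfl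
  have ha' (a b c e : Pos d) : (assocEquiv d).symm (((a, b), c), e) = ((a, b), (c, e)) := rfl
  have hc (a b : Pos2 d) : ContinuousLinearEquiv.prodComm ℝ (Pos2 d) (Pos2 d) (a, b) = (b, a) := rfl
  have hm (a b c e : Pos d) : midpointEquiv ((a, b), (c, e)) =
      ((a + (1 / 2 : ℝ) • b, c + (1 / 2 : ℝ) • e), (a - (1 / 2 : ℝ) • b, c - (1 / 2 : ℝ) • e)) := rfl
  simp only [ContinuousLinearMap.comp_apply, compCLMOfContinuousLinearEquiv_apply,
    Function.comp_apply, partialFourier_apply, ha, ha', hc, hm, h, smul_eq_mul, one_mul, neg_mul,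
    Complex.ofReal_neg, mul_neg]

/-! ### Tensor products, distributional kernels, and the embedding of functions into distributions -/

section Kernels

variable {X Y : Type} [NormedAddCommGroup X] [NormedSpace ℝ X]
  [NormedAddCommGroup Y] [NormedSpace ℝ Y]

/-- `‖∂ⁿ(f ∘ L)(z)‖ ≤ ‖∂ⁿ f (L z)‖` for a linear map `L` of norm at most one. -/
theorem norm_iteratedFDeriv_comp_le {Z : Type} [NormedAddCommGroup Z] [NormedSpace ℝ Z]
    (f : 𝓢(X, ℂ)) (L : Z →L[ℝ] X) (hL : ‖L‖ ≤ 1) (n : ℕ) (z : Z) :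
    ‖iteratedFDeriv ℝ n (fun z => f (L z)) z‖ ≤ ‖iteratedFDeriv ℝ n f (L z)‖ := by
  have h := L.iteratedFDeriv_comp_right (f := ⇑f) (f.smooth ⊤) z (i := n) (by exact_mod_cast le_top)
  change iteratedFDeriv ℝ n (fun z => f (L z)) z = _ at h
  rw [h]
  refine (ContinuousMultilinearMap.norm_compContinuousLinearMap_le _ _).trans ?_
  refine mul_le_of_le_one_right (norm_nonneg _) ?_
  exact Finset.prod_le_one (fun _ _ => norm_nonneg _) (fun _ _ => hL)

theorem exists_tensor_bound (k n : ℕ) : ∃ (p : Seminorm ℂ 𝓢(X, ℂ)) (q : Seminorm ℂ 𝓢(Y, ℂ)),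
    Continuous p ∧ Continuous q ∧ ∀ (g : 𝓢(X, ℂ)) (f : 𝓢(Y, ℂ)) (z : X × Y),
      ‖z‖ ^ k * ‖iteratedFDeriv ℝ n (fun z : X × Y => g z.1 * f z.2) z‖ ≤ p g * q f := by
  let p : Seminorm ℂ 𝓢(X, ℂ) := (Finset.Iic (k, n)).sup (schwartzSeminormFamily ℂ X ℂ)
  let q : Seminorm ℂ 𝓢(Y, ℂ) := (Finset.Iic (k, n)).sup (schwartzSeminormFamily ℂ Y ℂ)
  have hp : Continuous p := Seminorm.continuous_finsetSup
    (fun _ _ => (schwartz_withSeminorms ℂ X ℂ).continuous_seminorm _)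
  have hq : Continuous q := Seminorm.continuous_finsetSup
    (fun _ _ => (schwartz_withSeminorms ℂ Y ℂ).continuous_seminorm _)
  have hp1 (i : ℕ × ℕ) (hi : i ≤ (k, n)) (g : 𝓢(X, ℂ)) (x : X) :
      ‖x‖ ^ i.1 * ‖iteratedFDeriv ℝ i.2 g x‖ ≤ p g :=
    (le_seminorm ℂ i.1 i.2 g x).trans
      (Seminorm.le_def.1 (Finset.le_sup (f := schwartzSeminormFamily ℂ X ℂ)
        (Finset.mem_Iic.2 hi)) g)
  have hq1 (i : ℕ × ℕ) (hi : i ≤ (k, n)) (g : 𝓢(Y, ℂ)) (x : Y) :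
      ‖x‖ ^ i.1 * ‖iteratedFDeriv ℝ i.2 g x‖ ≤ q g :=
    (le_seminorm ℂ i.1 i.2 g x).trans
      (Seminorm.le_def.1 (Finset.le_sup (f := schwartzSeminormFamily ℂ Y ℂ)
        (Finset.mem_Iic.2 hi)) g)
  let c : NNReal := 2 * 2 ^ n
  refine ⟨c • p, q, hp.const_smul c, hq, fun g f z => ?_⟩
  have hG : ContDiff ℝ ∞ (fun z : X × Y => g z.1) := (g.smooth ⊤).comp contDiff_fst
  have hF : ContDiff ℝ ∞ (fun z : X × Y => f z.2) := (f.smooth ⊤).comp contDiff_snd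
  have hz : ‖z‖ ^ k ≤ ‖z.1‖ ^ k + ‖z.2‖ ^ k := by
    rw [Prod.norm_def]
    rcases max_cases ‖z.1‖ ‖z.2‖ with h | h <;> rw [h.1] <;>
      linarith [pow_nonneg (norm_nonneg z.1) k, pow_nonneg (norm_nonneg z.2) k]
  have h1 := norm_iteratedFDeriv_mul_le (n := n) hG hF z (by exact_mod_cast le_top)
  have h2 : ‖z‖ ^ k * ‖iteratedFDeriv ℝ n (fun z : X × Y => g z.1 * f z.2) z‖ ≤
      ∑ i ∈ Finset.range (n + 1), (n.choose i : ℝ) * (2 * (p g * q f)) := by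
    refine (mul_le_mul_of_nonneg_left h1 (by positivity)).trans ?_
    rw [Finset.mul_sum]
    refine Finset.sum_le_sum fun i hi => ?_
    have hi : i ≤ n := Nat.lt_succ_iff.1 (Finset.mem_range.1 hi)
    have ha : ‖iteratedFDeriv ℝ i (fun z : X × Y => g z.1) z‖ ≤ ‖iteratedFDeriv ℝ i g z.1‖ :=
      norm_iteratedFDeriv_comp_le g (ContinuousLinearMap.fst ℝ X Y)
        (ContinuousLinearMap.norm_fst_le ..) i z
    have hb : ‖iteratedFDeriv ℝ (n - i) (fun z : X × Y => f z.2) z‖ ≤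
        ‖iteratedFDeriv ℝ (n - i) f z.2‖ :=
      norm_iteratedFDeriv_comp_le f (ContinuousLinearMap.snd ℝ X Y)
        (ContinuousLinearMap.norm_snd_le ..) (n - i) z
    have e1 := hp1 (k, i) ⟨le_rfl, hi⟩ g z.1
    have e2 := hp1 (0, i) ⟨Nat.zero_le _, hi⟩ g z.1
    have e3 := hq1 (k, n - i) ⟨le_rfl, Nat.sub_le _ _⟩ f z.2
    have e4 := hq1 (0, n - i) ⟨Nat.zero_le _, Nat.sub_le _ _⟩ f z.2
    simp only [pow_zero, one_mul] at e1 e2 e3 e4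
    set a := ‖iteratedFDeriv ℝ i (fun z : X × Y => g z.1) z‖
    set b := ‖iteratedFDeriv ℝ (n - i) (fun z : X × Y => f z.2) z‖
    set a' := ‖iteratedFDeriv ℝ i g z.1‖
    set b' := ‖iteratedFDeriv ℝ (n - i) f z.2‖
    have ha0 : 0 ≤ a := norm_nonneg _
    have hb0 : 0 ≤ b := norm_nonneg _
    have ha0' : 0 ≤ a' := norm_nonneg _
    have hb0' : 0 ≤ b' := norm_nonneg _
    have hpg : 0 ≤ p g := apply_nonneg p g
    have hqf : 0 ≤ q f := apply_nonneg q f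
    calc ‖z‖ ^ k * ((n.choose i : ℝ) * a * b) = (n.choose i : ℝ) * (‖z‖ ^ k * (a * b)) := by ring
      _ ≤ (n.choose i : ℝ) * ((‖z.1‖ ^ k + ‖z.2‖ ^ k) * (a' * b')) := by gcongr
      _ = (n.choose i : ℝ) * ((‖z.1‖ ^ k * a') * b' + a' * (‖z.2‖ ^ k * b')) := by ring
      _ ≤ (n.choose i : ℝ) * (p g * q f + p g * q f) := by gcongr
      _ = _ := by ring
  refine h2.trans (le_of_eq ?_)
  rw [← Finset.sum_mul, ← Nat.cast_sum, Nat.sum_range_choose]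
  change _ = ((c : ℝ) * p g) * q f
  simp only [c]
  push_cast
  ring

/-- The tensor product `(g ⊗ f)(x, y) = g(x) f(y)` of Schwartz functions. -/
def tensor (g : 𝓢(X, ℂ)) (f : 𝓢(Y, ℂ)) : 𝓢(X × Y, ℂ) where
  toFun := fun z => g z.1 * f z.2
  smooth' := ((g.smooth ⊤).comp contDiff_fst).mul ((f.smooth ⊤).comp contDiff_snd)
  decay' := fun k n => by
    obtain ⟨p, q, -, -, h⟩ := exists_tensor_bound (X := X) (Y := Y) k n
    exact ⟨p g * q f, fun z => h g f z⟩

theorem tensor_apply (g : 𝓢(X, ℂ)) (f : 𝓢(Y, ℂ)) (z : X × Y) : tensor g f z = g z.1 * f z.2 := rfl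

variable (X) in
/-- Tempered distributions on `X`: the strong dual of the Schwartz space (Mathlib equips spaces of
continuous linear maps with the topology of uniform convergence on bounded sets). -/
abbrev Dist : Type := 𝓢(X, ℂ) →L[ℂ] ℂ

theorem exists_dist_tensor_bound (κ : Dist (X × Y)) :
    ∃ (p : Seminorm ℂ 𝓢(X, ℂ)) (q : Seminorm ℂ 𝓢(Y, ℂ)),
    Continuous p ∧ Continuous q ∧ ∀ (f : 𝓢(Y, ℂ)) (g : 𝓢(X, ℂ)), ‖κ (tensor g f)‖ ≤ q f * p g := by
  have hc : Continuous ((normSeminorm ℂ ℂ).comp κ.toLinearMap) := continuous_norm.comp κ.continuous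
  obtain ⟨s, C, -, hC⟩ :=
    Seminorm.bound_of_continuous (schwartz_withSeminorms ℂ (X × Y) ℂ) _ hc
  choose p q hp hq h using fun i : ℕ × ℕ => exists_tensor_bound (X := X) (Y := Y) i.1 i.2
  refine ⟨∑ i ∈ s, p i, C • ∑ i ∈ s, q i, Seminorm.continuous_finsetSum fun i _ => hp i,
    (Seminorm.continuous_finsetSum fun i _ => hq i).const_smul C, fun f g => ?_⟩
  have h1 := hC (tensor g f)
  have hp' (i : ℕ × ℕ) (hi : i ∈ s) : p i g ≤ (∑ i ∈ s, p i) g := by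
    rw [sum_apply]
    exact Finset.single_le_sum (f := fun i => p i g) (fun i _ => apply_nonneg _ _) hi
  have hq' (i : ℕ × ℕ) (hi : i ∈ s) : q i f ≤ (∑ i ∈ s, q i) f := by
    rw [sum_apply]
    exact Finset.single_le_sum (f := fun i => q i f) (fun i _ => apply_nonneg _ _) hi
  have h2 : (s.sup (schwartzSeminormFamily ℂ (X × Y) ℂ)) (tensor g f) ≤
      (∑ i ∈ s, p i) g * (∑ i ∈ s, q i) f := by
    refine Seminorm.finset_sup_apply_le (mul_nonneg (apply_nonneg _ _) (apply_nonneg _ _))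
      fun i hi => ?_
    refine seminorm_le_bound ℂ i.1 i.2 _ (mul_nonneg (apply_nonneg _ _) (apply_nonneg _ _))
      fun z => (h i g f z).trans ?_
    exact mul_le_mul (hp' i hi) (hq' i hi) (apply_nonneg _ _) (apply_nonneg _ _)
  calc ‖κ (tensor g f)‖ ≤ C * (s.sup (schwartzSeminormFamily ℂ (X × Y) ℂ)) (tensor g f) := h1
    _ ≤ C * ((∑ i ∈ s, p i) g * (∑ i ∈ s, q i) f) := by gcongr
    _ = (C * (∑ i ∈ s, q i) f) * (∑ i ∈ s, p i) g := by ring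

theorem continuous_of_bilin_bound (L : 𝓢(X, ℂ) →ₗ[ℂ] ℂ) (p : Seminorm ℂ 𝓢(X, ℂ)) (hp : Continuous p)
    (C : ℝ) (h : ∀ g, ‖L g‖ ≤ C * p g) : Continuous L := by
  refine continuous_of_continuousAt_zero L.toAddMonoidHom ?_
  rw [ContinuousAt, map_zero]
  have h0 : Filter.Tendsto (fun g => C * p g) (𝓝 0) (𝓝 0) := by
    have := (hp.const_mul C).tendsto 0
    simpa using this
  exact squeeze_zero_norm h h0

/-- A bilinear form on Schwartz spaces that is bounded by a product of continuous seminorms is a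
continuous map into the strong dual. -/
def mkBilin (b : 𝓢(Y, ℂ) →ₗ[ℂ] 𝓢(X, ℂ) →ₗ[ℂ] ℂ)
    (hb : ∃ (p : Seminorm ℂ 𝓢(X, ℂ)) (q : Seminorm ℂ 𝓢(Y, ℂ)),
      Continuous p ∧ Continuous q ∧ ∀ f g, ‖b f g‖ ≤ q f * p g) : 𝓢(Y, ℂ) →L[ℂ] Dist X :=
  let L : 𝓢(Y, ℂ) →ₗ[ℂ] Dist X :=
    { toFun := fun f => ⟨b f, by
        obtain ⟨p, q, hp, -, h⟩ := hb
        exact continuous_of_bilin_bound (b f) p hp (q f) (h f)⟩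
      map_add' := fun f f' => by ext g; simp
      map_smul' := fun c f => by ext g; simp }
  ⟨L, by
    obtain ⟨p, q, hp, hq, h⟩ := hb
    refine continuous_of_continuousAt_zero L.toAddMonoidHom ?_
    rw [ContinuousAt, map_zero,
      (ContinuousLinearMap.hasBasis_nhds_zero_of_basis (𝕜₁ := ℂ) (σ := RingHom.id ℂ)
        (E := 𝓢(X, ℂ)) (F := ℂ) Metric.nhds_basis_ball).tendsto_right_iff]
    rintro ⟨S, ε⟩ ⟨hS, hε⟩
    obtain ⟨t, C, -, hC⟩ := Seminorm.bound_of_continuous (schwartz_withSeminorms ℂ X ℂ) p hp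
    obtain ⟨r, hr0, hr⟩ :=
      ((schwartz_withSeminorms ℂ X ℂ).isVonNBounded_iff_finset_seminorm_bounded).1 hS t
    have h0 : Filter.Tendsto (fun f => q f * (C * r)) (𝓝 0) (𝓝 0) := by
      have := (hq.mul_const ((C : ℝ) * r)).tendsto 0
      simpa using this
    filter_upwards [h0.eventually (gt_mem_nhds hε)] with f hf g hg
    rw [mem_ball_zero_iff]
    refine lt_of_le_of_lt ((h f g).trans ?_) hf
    refine mul_le_mul_of_nonneg_left ((hC g).trans ?_) (apply_nonneg _ _)
    exact mul_le_mul_of_nonneg_left (hr g hg).le C.2⟩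

/-- The operator with distributional kernel `κ`: `⟨int(κ) f, g⟩ = ⟨κ, g ⊗ f⟩`. -/
def int (κ : Dist (X × Y)) : 𝓢(Y, ℂ) →L[ℂ] Dist X :=
  mkBilin
    (LinearMap.mk₂ ℂ (fun f g => κ (tensor g f))
      (fun f f' g => by
        rw [← map_add]; congr 1; ext z; simp [tensor_apply, mul_add])
      (fun c f g => by
        rw [← map_smul]; congr 1; ext z; simp [tensor_apply, mul_left_comm])
      (fun f g g' => by
        rw [← map_add]; congr 1; ext z; simp [tensor_apply, add_mul])
      (fun c f g => by
        rw [← map_smul]; congr 1; ext z; simp [tensor_apply, mul_assoc]))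
    (exists_dist_tensor_bound κ)

theorem int_apply (κ : Dist (X × Y)) (f : 𝓢(Y, ℂ)) (g : 𝓢(X, ℂ)) : int κ f g = κ (tensor g f) := rfl

end Kernels

section Embedding

variable {X : Type} [NormedAddCommGroup X] [NormedSpace ℝ X] [FiniteDimensional ℝ X]
  [MeasureSpace X] [BorelSpace X] [(volume : Measure X).IsAddHaarMeasure]

/-- The tempered distribution `F ↦ ∫ Φ F` of a function `Φ` of temperate growth, such as a Schwartz function
or a smooth function whose derivatives are all bounded by a multiple of one tempered weight. -/
def ofFun (Φ : X → ℂ) : Dist X := integralCLM ℂ volume ∘L smulLeftCLM ℂ Φ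

theorem ofFun_apply {Φ : X → ℂ} (hΦ : Φ.HasTemperateGrowth) (F : 𝓢(X, ℂ)) :
    ofFun Φ F = ∫ x, Φ x * F x := by
  simp [ofFun, integralCLM_apply, smulLeftCLM_apply_apply hΦ]

theorem integrable_mul (f g : 𝓢(X, ℂ)) : Integrable (fun x => f x * g x) := by
  obtain ⟨q, -, hq⟩ := exists_seminorm_bound 0 ℂ (E := X)
  refine g.integrable.bdd_mul (c := q f) f.continuous.aestronglyMeasurable
    (Filter.Eventually.of_forall fun x => ?_)
  simpa using hq f x

theorem exists_embed_bound : ∃ (p : Seminorm ℂ 𝓢(X, ℂ)) (q : Seminorm ℂ 𝓢(X, ℂ)),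
    Continuous p ∧ Continuous q ∧ ∀ f g : 𝓢(X, ℂ), ‖∫ x, f x * g x‖ ≤ q f * p g := by
  obtain ⟨q, hqc, hq⟩ := exists_seminorm_bound 0 ℂ (E := X)
  obtain ⟨p, hpc, hp⟩ := exists_seminorm_bound (Module.finrank ℝ X + 1) ℂ (E := X)
  let c : NNReal := ⟨∫ v : X, (1 + ‖v‖) ^ (-((Module.finrank ℝ X + 1 : ℕ) : ℝ)),
    integral_nonneg fun v => by positivity⟩
  have hi : Integrable (fun v : X => (1 + ‖v‖) ^ (-((Module.finrank ℝ X + 1 : ℕ) : ℝ))) :=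
    integrable_one_add_norm (by push_cast; linarith)
  refine ⟨c • p, q, hpc.const_smul c, hqc, fun f g => ?_⟩
  calc ‖∫ x, f x * g x‖ ≤ ∫ x, q f * p g * (1 + ‖x‖) ^ (-((Module.finrank ℝ X + 1 : ℕ) : ℝ)) := by
        refine norm_integral_le_of_norm_le (hi.const_mul _)
          (Filter.Eventually.of_forall fun x => ?_)
        rw [norm_mul, mul_assoc]
        refine mul_le_mul (by simpa using hq f x) ?_ (norm_nonneg _) (apply_nonneg _ _)
        rw [Real.rpow_neg (by positivity), Real.rpow_natCast, ← div_eq_mul_inv,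
          le_div_iff₀ (by positivity), mul_comm]
        exact hp g x
    _ = q f * (c * p g) := by rw [integral_const_mul]; change q f * p g * (c : ℝ) = _; ring
    _ = q f * (c • p) g := rfl

/-- The embedding `𝓢 ⊆ 𝓢'`, `⟨f, g⟩ = ∫ f g`. -/
def embed : 𝓢(X, ℂ) →L[ℂ] Dist X :=
  mkBilin
    (LinearMap.mk₂ ℂ (fun f g => ∫ x, f x * g x)
      (fun f f' g => by
        simp only [add_apply, add_mul]
        exact integral_add (integrable_mul f g) (integrable_mul f' g))
      (fun c f g => by
        simp only [smul_apply, smul_eq_mul, mul_assoc]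
        exact integral_const_mul _ _)
      (fun f g g' => by
        simp only [add_apply, mul_add]
        exact integral_add (integrable_mul f g) (integrable_mul f g'))
      (fun c f g => by
        simp only [smul_apply, smul_eq_mul, mul_left_comm]
        exact integral_const_mul _ _))
    exists_embed_bound

/-- On Schwartz functions the two ways to see a function as a distribution agree. -/
theorem ofFun_schwartz (f : 𝓢(X, ℂ)) : ofFun (f : X → ℂ) = embed f := by
  ext g
  exact ofFun_apply f.hasTemperateGrowth g

theorem embed_apply (f g : 𝓢(X, ℂ)) : embed f g = ∫ x, f x * g x := rfl

end Embedding

/-! ### Operator spaces, super operators and the magnetic super Weyl quantization -/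

variable (d) in
/-- `𝓑(𝓢(ℝ^d), 𝓢'(ℝ^d))`. -/
abbrev OpDist : Type := 𝓢(Pos d, ℂ) →L[ℂ] Dist (Pos d)

variable (d) in
/-- The smoothing operators `𝓑(𝓢'(ℝ^d), 𝓢(ℝ^d))`. -/
abbrev OpSmooth : Type := Dist (Pos d) →L[ℂ] 𝓢(Pos d, ℂ)

variable (d) in
/-- Maps from smoothing operators to `𝓑(𝓢, 𝓢')`. -/
abbrev SuperOperator : Type := OpSmooth d → OpDist d

/-- The inclusion `𝓑(𝓢', 𝓢) ⊆ 𝓑(𝓢, 𝓢')`. -/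
def incl (T : OpSmooth d) : OpDist d := embed ∘L T ∘L embed

/-- The distributional kernel `int⁻¹(R)` of `R ∈ 𝓑(𝓢, 𝓢')`; it exists and is unique by the Schwartz
kernel theorem, so that `invFun` is the genuine inverse of `int`. -/
def kernelDist (R : OpDist d) : Dist (Pos2 d) := Function.invFun int R

/-- The kernel `int⁻¹(T) ∈ 𝓢(ℝ^{2d})` of a smoothing operator; it exists and is unique by the Schwartz
kernel theorem. -/
def kernelSchwartz (T : OpSmooth d) : 𝓢(Pos2 d, ℂ) :=
  Function.invFun (fun k : 𝓢(Pos2 d, ℂ) => int (embed k)) (incl T)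

/-- The duality bracket `⟨R, T⟩ = ⟨int⁻¹(R), int⁻¹(T)⟩` of `𝓑(𝓢, 𝓢')` and `𝓑(𝓢', 𝓢)`. -/
def bracket (R : OpDist d) (T : OpSmooth d) : ℂ := kernelDist R (kernelSchwartz T)

/-- The magnetic super Weyl transform `K^A` on tempered distributions, `⟨K^A Φ, F⟩ = ⟨Φ, (K^A)ᵗ F⟩`: the
continuous extension of the integral transform on Schwartz functions. -/
def superWeylTransform (𝓑 : RegularMagneticField d) (Φ : Dist (Pos4 d)) : Dist (Pos4 d) :=
  Φ ∘L superWeylTranspose 𝓑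

/-- The magnetic super Weyl quantization `Op^A(Φ) = int ∘ Int(K^A Φ) ∘ int⁻¹` of a tempered distribution
`Φ`. The outer `int` makes operators from kernels on `ℝ^d × ℝ^d`; the inner one is `Int`, which makes
operators `𝓢(ℝ^{2d}) → 𝓢'(ℝ^{2d})` from kernels on `ℝ^{2d} × ℝ^{2d}`. -/
def superOp (𝓑 : RegularMagneticField d) (Φ : Dist (Pos4 d)) : SuperOperator d :=
  fun T => int (int (X := Pos2 d) (Y := Pos2 d) (superWeylTransform 𝓑 Φ) (kernelSchwartz T))

/-- `(Op^A)⁻¹` on super operators whose super symbol is a Schwartz function: the Schwartz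
function `Φ` with `Op^A(Φ) = 𝔗`. -/
def superOpInv (𝓑 : RegularMagneticField d) (𝔗 : SuperOperator d) : 𝓢(Pos4 d, ℂ) :=
  Function.invFun (fun Φ : 𝓢(Pos4 d, ℂ) => superOp 𝓑 (embed Φ)) 𝔗

/-- The operator `u ↦ u(h) f` with kernel `f ⊗ h`. -/
def rankOne (f h : 𝓢(Pos d, ℂ)) : OpSmooth d :=
  ContinuousLinearMap.smulRight (M₁ := Dist (Pos d)) (M₂ := 𝓢(Pos d, ℂ)) (S := ℂ)
    { toFun := fun u => u h
      map_add' := fun _ _ => rfl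
      map_smul' := fun _ _ => rfl
      cont := continuous_eval_const h } f

theorem rankOne_apply (f h : 𝓢(Pos d, ℂ)) (u : Dist (Pos d)) : rankOne f h u = u h • f := rfl

theorem incl_rankOne (f h : 𝓢(Pos d, ℂ)) : incl (rankOne f h) = int (embed (tensor f h)) := by
  ext φ g
  have e : incl (rankOne f h) φ g = embed (embed φ h • f) g := rfl
  rw [e, int_apply, embed_apply, embed_apply, embed_apply]
  simp only [tensor_apply, smul_apply, smul_eq_mul]
  simp only [mul_assoc]
  rw [integral_const_mul, mul_comm, ← integral_prod_mul (fun x => f x * g x) (fun x => φ x * h x)]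
  refine integral_congr_ae (Filter.Eventually.of_forall fun z => ?_)
  ring

/-! ### The frame -/

/-- The integer vector `α ∈ ℤ^d` as a point of `ℝ^d`. -/
def intVec (α : Fin d → ℤ) : Pos d := WithLp.toLp 2 fun i => (α i : ℝ)

variable (d) in
/-- The windows `𝔤 ∈ C_c^∞(ℝ^d; ℝ)` with support in the open cube `(-1, 1)^d` and
`∑_{α ∈ ℤ^d} 𝔤(x - α)² = 1` for all `x`. -/
structure Window where
  g : Pos d → ℝ
  smooth : ContDiff ℝ ∞ g
  support_subset : tsupport g ⊆ {x | ∀ i, x i ∈ Set.Ioo (-1 : ℝ) 1}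
  sum_sq : ∀ x, HasSum (fun α : Fin d → ℤ => g (x - intVec α) ^ 2) 1

variable (d) in
/-- Indices `α̃ = (α, α') ∈ ℤ^{2d}`. -/
abbrev Idx : Type := (Fin d → ℤ) × (Fin d → ℤ)

variable (d) in
/-- Indices `(α̃, β̃) ∈ ℤ^{4d}`. -/
abbrev SuperIdx : Type := Idx d × Idx d

/-- `𝒢_α̃(x) = (2π)^{-d/2} e^{iφ(x, α)} 𝔤(x - α) e^{iα'·(x - α)}` for `α̃ = (α, α')`. -/
def frameFun (𝓑 : RegularMagneticField d) (w : Window d) (α : Idx d) (x : Pos d) : ℂ :=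
  (((2 * Real.pi) ^ (-(d : ℝ) / 2) : ℝ) : ℂ) *
    Complex.exp (Complex.I * (𝓑.circulation x (intVec α.1) : ℂ)) * (w.g (x - intVec α.1) : ℂ) *
    Complex.exp (Complex.I * ((inner ℝ (intVec α.2) (x - intVec α.1) : ℝ) : ℂ))

theorem Window.hasCompactSupport (w : Window d) : HasCompactSupport w.g := by
  refine Metric.isCompact_of_isClosed_isBounded (isClosed_tsupport _) ?_
  refine (Metric.isBounded_closedBall (x := (0 : Pos d)) (r := √d)).subset fun x hx => ?_
  rw [mem_closedBall_zero_iff, EuclideanSpace.norm_eq]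
  refine Real.sqrt_le_sqrt ?_
  calc ∑ i, ‖x i‖ ^ 2 ≤ ∑ _i : Fin d, (1 : ℝ) := Finset.sum_le_sum fun i _ => by
        have h := w.support_subset hx i
        rw [Real.norm_eq_abs, sq_abs]
        nlinarith [h.1, h.2]
    _ = d := by simp

theorem hasCompactSupport_frameFun (𝓑 : RegularMagneticField d) (w : Window d) (α : Idx d) :
    HasCompactSupport (frameFun 𝓑 w α) := by
  have h : HasCompactSupport (fun x => w.g (x - intVec α.1)) :=
    w.hasCompactSupport.comp_homeomorph (Homeomorph.subRight (intVec α.1))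
  refine h.mono fun x hx hg => hx ?_
  simp only at hg
  simp [frameFun, hg]

theorem contDiff_frameFun (𝓑 : RegularMagneticField d) (w : Window d) (α : Idx d) :
    ContDiff ℝ ∞ (frameFun 𝓑 w α) := by
  have h1 : ContDiff ℝ ∞ fun x => 𝓑.circulation x (intVec α.1) :=
    ContDiff.comp (g := fun p : Pos2 d => 𝓑.circulation p.1 p.2) (f := fun x => (x, intVec α.1))
      𝓑.hasTemperateGrowth_circulation.1 (contDiff_id.prodMk contDiff_const)
  have h2 : ContDiff ℝ ∞ fun x => w.g (x - intVec α.1) :=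
    w.smooth.comp (contDiff_id.sub contDiff_const)
  have h3 : ContDiff ℝ ∞ fun x : Pos d => inner ℝ (intVec α.2) (x - intVec α.1) :=
    contDiff_const.inner ℝ (contDiff_id.sub contDiff_const)
  have k0 : ContDiff ℝ ∞ fun _ : Pos d => (((2 * Real.pi) ^ (-(d : ℝ) / 2) : ℝ) : ℂ) :=
    contDiff_const
  have k1 : ContDiff ℝ ∞ fun x =>
      Complex.exp (Complex.I * (𝓑.circulation x (intVec α.1) : ℂ)) :=
    hasTemperateGrowth_expI.1.comp h1
  have k2 : ContDiff ℝ ∞ fun x => (w.g (x - intVec α.1) : ℂ) :=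
    ContDiff.comp (g := fun t : ℝ => (t : ℂ)) Complex.ofRealCLM.contDiff h2
  have k3 : ContDiff ℝ ∞ fun x : Pos d =>
      Complex.exp (Complex.I * ((inner ℝ (intVec α.2) (x - intVec α.1) : ℝ) : ℂ)) :=
    hasTemperateGrowth_expI.1.comp h3
  exact ((k0.mul k1).mul k2).mul k3

/-- `𝒢_α̃` as a Schwartz function. -/
def frameVec (𝓑 : RegularMagneticField d) (w : Window d) (α : Idx d) : 𝓢(Pos d, ℂ) :=
  (hasCompactSupport_frameFun 𝓑 w α).toSchwartzMap (contDiff_frameFun 𝓑 w α)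

theorem frameVec_apply (𝓑 : RegularMagneticField d) (w : Window d) (α : Idx d) (x : Pos d) :
    frameVec 𝓑 w α x = frameFun 𝓑 w α x := rfl

/-- Pointwise complex conjugation of a Schwartz function. -/
def conjSchwartz (f : 𝓢(Pos d, ℂ)) : 𝓢(Pos d, ℂ) :=
  postcompCLM (𝕜 := ℝ) (Complex.conjCLE : ℂ →L[ℝ] ℂ) f

theorem conjSchwartz_apply (f : 𝓢(Pos d, ℂ)) (x : Pos d) :
    conjSchwartz f x = (starRingEnd ℂ) (f x) := rfl

/-- The frame operators `𝒯_{α̃, β̃} = int(𝒢_α̃ ⊗ conj 𝒢_β̃)`. -/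
def frameOp (𝓑 : RegularMagneticField d) (w : Window d) (i : SuperIdx d) : OpSmooth d :=
  rankOne (frameVec 𝓑 w i.1) (conjSchwartz (frameVec 𝓑 w i.2))

/-- The operators `conj 𝒯_{α̃, β̃}`, whose kernel `conj 𝒢_α̃ ⊗ 𝒢_β̃` is the complex conjugate of that of
`𝒯_{α̃, β̃}`. -/
def frameOpConj (𝓑 : RegularMagneticField d) (w : Window d) (i : SuperIdx d) : OpSmooth d :=
  rankOne (conjSchwartz (frameVec 𝓑 w i.1)) (frameVec 𝓑 w i.2)

/-- The matrix entry `⟨𝔗 𝒯_j, conj 𝒯_i⟩` of a super operator, with `i = (α̃, β̃)` and `j = (γ̃, δ̃)`. -/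
def matrixEntry (𝓑 : RegularMagneticField d) (w : Window d) (𝔗 : SuperOperator d)
    (i j : SuperIdx d) : ℂ :=
  bracket (𝔗 (frameOp 𝓑 w j)) (frameOpConj 𝓑 w i)

/-- The map `S ↦ ⟨S, T⟩ R` from `𝓑(𝓢, 𝓢')` to `𝓑(𝓢', 𝓢)`. -/
def bowtie (R T : OpSmooth d) (S : OpDist d) : OpSmooth d := bracket S T • R

/-- `bowtie` as a map from smoothing operators to `𝓑(𝓢, 𝓢')`, through `𝓑(𝓢', 𝓢) ⊆ 𝓑(𝓢, 𝓢')` on both sides. -/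
def bowtieSuper (R T : OpSmooth d) : SuperOperator d := fun S => incl (bowtie R T (incl S))

/-! ### Symbol classes -/

/-- `⟨X⟩ = √(1 + |X|²)` with the Euclidean norm of `ℝ^{4d}`. -/
def japanese (X : Pos4 d) : ℝ :=
  √(1 + (‖X.1.1‖ ^ 2 + ‖X.1.2‖ ^ 2 + ‖X.2.1‖ ^ 2 + ‖X.2.2‖ ^ 2))

/-- `M` is a tempered weight on `ℝ^{4d}`. -/
structure TemperedWeight (M : Pos4 d → ℝ) : Prop where
  pos : ∀ X, 0 < M X
  tempered : ∃ a C : ℝ, 0 < a ∧ 0 < C ∧ ∀ X Y, M (X + Y) ≤ C * M X * japanese Y ^ a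

variable (d) in
/-- The `4d` coordinates: left position, left momentum, right position, right momentum. -/
abbrev Coord : Type := (Fin d ⊕ Fin d) ⊕ (Fin d ⊕ Fin d)

/-- The unit vector of a coordinate. -/
def coordVec : Coord d → Pos4 d
  | .inl (.inl i) => ((EuclideanSpace.single i 1, 0), (0, 0))
  | .inl (.inr i) => ((0, EuclideanSpace.single i 1), (0, 0))
  | .inr (.inl i) => ((0, 0), (EuclideanSpace.single i 1, 0))
  | .inr (.inr i) => ((0, 0), (0, EuclideanSpace.single i 1))

/-- The list in which each coordinate `i` occurs `γ i` times. -/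
def multiList (γ : Coord d → ℕ) : List (Coord d) :=
  Finset.univ.toList.flatMap fun i => List.replicate (γ i) i

/-- The partial derivative `∂^γ Φ (X)`. -/
def partialDeriv (γ : Coord d → ℕ) (Φ : Pos4 d → ℂ) (X : Pos4 d) : ℂ :=
  iteratedFDeriv ℝ (multiList γ).length Φ X fun k => coordVec ((multiList γ).get k)

/-- The super symbol class `S_0(M)`. -/
def symbolClass (M : Pos4 d → ℝ) : Set (Pos4 d → ℂ) :=
  {Φ | ContDiff ℝ ∞ Φ ∧ ∀ γ : Coord d → ℕ,
    BddAbove (Set.range fun X => (M X)⁻¹ * ‖partialDeriv γ Φ X‖)}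

/-- `‖Φ‖_{S_0(M), k} = ∑_{|γ| ≤ k} sup_X M(X)⁻¹ |∂^γ Φ(X)|`. -/
def symbolSeminorm (M : Pos4 d → ℝ) (k : ℕ) (Φ : Pos4 d → ℂ) : ℝ :=
  ∑ n ∈ Finset.range (k + 1), ∑ γ ∈ Finset.piAntidiag (Finset.univ : Finset (Coord d)) n,
    ⨆ X, (M X)⁻¹ * ‖partialDeriv γ Φ X‖

/-- The index `(α̃, β̃) = ((α, α'), (β, β'))` as the point of `ℝ^{4d}` with left part `α̃` and right part
`β̃`. -/
def latticePoint (i : SuperIdx d) : Pos4 d :=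
  ((intVec i.1.1, intVec i.1.2), (intVec i.2.1, intVec i.2.2))

/-- `⟨i - j⟩^n M((i + j)/2)⁻¹ |N_{i,j}|` for `p = (i, j)`. -/
def decayTerm (M : Pos4 d → ℝ) (n : ℕ) (N : SuperIdx d → SuperIdx d → ℂ)
    (p : SuperIdx d × SuperIdx d) : ℝ :=
  japanese (latticePoint p.1 - latticePoint p.2) ^ n *
    (M ((1 / 2 : ℝ) • (latticePoint p.1 + latticePoint p.2)))⁻¹ * ‖N p.1 p.2‖

/-- The term `N_{i,j} (Op^A)⁻¹(𝒯_i ⋈ conj 𝒯_j)(X)` of the dequantization series, for `p = (i, j)`. -/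
def dequantTerm (𝓑 : RegularMagneticField d) (w : Window d) (N : SuperIdx d → SuperIdx d → ℂ)
    (p : SuperIdx d × SuperIdx d) (X : Pos4 d) : ℂ :=
  N p.1 p.2 * superOpInv 𝓑 (bowtieSuper (frameOp 𝓑 w p.1) (frameOpConj 𝓑 w p.2)) X

/-- The dequantization series converges to `Φ` uniformly on compact sets, unconditionally, i.e. as the net
of its finite partial sums. -/
def DequantConvergesTo (𝓑 : RegularMagneticField d) (w : Window d)
    (N : SuperIdx d → SuperIdx d → ℂ) (Φ : Pos4 d → ℂ) : Prop :=
  ∀ K : Set (Pos4 d), IsCompact K →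
    TendstoUniformlyOn (fun (s : Finset (SuperIdx d × SuperIdx d)) X =>
      ∑ p ∈ s, dequantTerm 𝓑 w N p X) Φ Filter.atTop K

end MagneticWeyl

end

open MagneticWeyl

/-!
The argument rests on one explicit family of functions. Every kernel that occurs is a tensor product of
frame vectors `𝒢_α̃`, so both the matrix of a quantized symbol and the inverse quantization of
`𝒯_i ⋈ conj 𝒯_j` come out in terms of the *frame packets*
`framePacket i j = W(𝒢_{i_L}, 𝒢_{j_L}) ⊗ conj W(𝒢_{i_R}, 𝒢_{j_R})`, where `W` is the magnetic
cross-Wigner transform: up to a constant the matrix entry of `Op^A(Φ)` is `∫ Φ · framePacket i j`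
(`matrixEntry_superOp_ofFun`), and the inverse quantization of `𝒯_i ⋈ conj 𝒯_j` is the conjugate of
`framePacket i j` (`superOpInv_frame_apply`). The second formula also gives part (ii)
(`superOp_superOpInv_frame`); it uses Fourier inversion, the injectivity of `Op^A` on Schwartz functions
and the Schwartz kernel theorem for smoothing operators (`int_embed_smoothKernel`), in which the kernel is
built as `(S δ_y)(x)`.

Stokes' theorem, in the form of a formula for the gradient of the circulation
(`hasFDerivAt_circulation`), shows that the phase
`φ(x, y) - φ(x, α) + φ(y, γ)` of the Wigner transform of `𝒢_α̃` and `𝒢_γ̃` has derivatives which, near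
`α` and `γ`, are bounded by powers of `1 + |α - γ|` alone (`uniformGrowth_fluxPhase`). Hence
`framePacket i j` is a unimodular linear exponential with frequency given by `i - j`, times a Schwartz
profile centred at the midpoint `(i + j) / 2` whose seminorms grow polynomially in `|i - j|`
(`exists_framePacket_eq`, `exists_framePacket_bound`).

For part (i), integration by parts against the linear exponential gives decay in `i - j`. The growth of
the profile must not eat up the gain: derivatives in the momentum directions fall on the Fourier
exponential and not on the phase, so their growth exponent does not depend on how many there are
(`exists_profile_momentum_bound`), and decay in the separation of the positions comes without loss. It
then pays for the losses in the derivatives that produce decay in the separation of the momenta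
(`exists_integral_framePacket_bound`).

For the dequantization series, the localization of the packets at `(i + j) / 2`, the decay of `N` in
`i - j` and the temperateness of `M` bound each derivative of a term at `X` by
`M(X) ⟨X - i⟩^{-s} ⟨i - j⟩^{-s}` (`exists_dequantTerm_bound`); the sum of these bounds over the lattice is
finite, uniformly in `X` (`exists_tsum_lattice_pair_le`), which yields convergence, membership in
`S_0(M)` and the seminorm estimates together.
-/

noncomputable section

namespace MagneticWeyl

open MeasureTheory SchwartzMap
open scoped ContDiff Topology Pointwise

set_option linter.unusedSectionVars false

/-! ### The kernel of a smoothing operator -/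

section SmoothingKernel

variable {X Y : Type} [NormedAddCommGroup X] [NormedSpace ℝ X] [FiniteDimensional ℝ X]
  [NormedAddCommGroup Y] [NormedSpace ℝ Y] [FiniteDimensional ℝ Y]

/-- A continuous seminorm on the strong dual of the Schwartz space is dominated by the supremum over a
bounded set of Schwartz functions. -/
theorem exists_bounded_of_continuous_seminorm (q : Seminorm ℂ (Dist Y)) (hq : Continuous q) :
    ∃ S : Set 𝓢(Y, ℂ), Bornology.IsVonNBounded ℂ S ∧
      ∀ (u : Dist Y) (r : ℝ), 0 ≤ r → (∀ f ∈ S, ‖u f‖ ≤ r) → q u ≤ r := by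
  have h0 : {u : Dist Y | q u < 1} ∈ 𝓝 (0 : Dist Y) :=
    (isOpen_lt hq continuous_const).mem_nhds (by simp)
  obtain ⟨⟨S, ε⟩, ⟨hS, hε⟩, hsub⟩ :=
    (ContinuousLinearMap.hasBasis_nhds_zero_of_basis (𝕜₁ := ℂ) (σ := RingHom.id ℂ)
        (E := 𝓢(Y, ℂ)) (F := ℂ) Metric.nhds_basis_ball).mem_iff.1 h0
  simp only at hS hε
  have hε' : (ε : ℂ) ≠ 0 := by exact_mod_cast hε.ne'
  refine ⟨(2 / ε : ℂ) • S, ?_, fun u r hr hu => ?_⟩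
  · exact hS.image ((2 / ε : ℂ) • ContinuousLinearMap.id ℂ 𝓢(Y, ℂ))
  refine le_of_forall_gt_imp_ge_of_dense fun t ht => ?_
  have ht0 : 0 < t := hr.trans_lt ht
  have ht' : (t : ℂ) ≠ 0 := by exact_mod_cast ht0.ne'
  have hmem : (t⁻¹ : ℂ) • u ∈ {u : Dist Y | q u < 1} := by
    refine hsub fun f hf => ?_
    have h1 := hu _ (Set.smul_mem_smul_set (a := (2 / ε : ℂ)) hf)
    rw [map_smul, norm_smul, norm_div, Complex.norm_real, Real.norm_of_nonneg hε.le,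
      Complex.norm_two] at h1
    rw [mem_ball_zero_iff, smul_apply, norm_smul, norm_inv, Complex.norm_real,
      Real.norm_of_nonneg ht0.le]
    have h2 : ‖u f‖ ≤ r * ε / 2 := by
      rw [div_mul_eq_mul_div, div_le_iff₀ hε] at h1
      linarith
    rw [inv_mul_lt_iff₀ ht0]
    nlinarith
  rw [Set.mem_ofPred_eq, map_smul_eq_mul, norm_inv, Complex.norm_real,
      Real.norm_of_nonneg ht0.le, inv_mul_lt_iff₀ ht0, mul_one] at hmem
  exact hmem.le

theorem exists_bound_of_isVonNBounded {S : Set 𝓢(Y, ℂ)} (hS : Bornology.IsVonNBounded ℂ S) (k n : ℕ) :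
    ∃ C : ℝ, 0 ≤ C ∧ ∀ f ∈ S, ∀ y, ‖y‖ ^ k * ‖iteratedFDeriv ℝ n f y‖ ≤ C := by
  obtain ⟨r, hr, h⟩ := (schwartz_withSeminorms ℂ Y ℂ).isVonNBounded_iff_seminorm_bounded.1 hS (k, n)
  exact ⟨r, hr.le, fun f hf y => (le_seminorm ℂ k n f y).trans (h f hf).le⟩

/-- The point evaluation at `y`, as a tempered distribution. -/
def evalDist (y : Y) : Dist Y :=
  (BoundedContinuousFunction.evalCLM ℂ y).comp (toBoundedContinuousFunctionCLM ℂ Y ℂ)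

theorem evalDist_apply (y : Y) (f : 𝓢(Y, ℂ)) : evalDist y f = f y := rfl

/-- The function `(x, y) ↦ (S δ_y)(x)`, which is the kernel of the operator `S`. -/
def kernelFun (S : Dist Y →L[ℂ] 𝓢(X, ℂ)) (z : X × Y) : ℂ := S (evalDist z.2) z.1

/-- The transpose of a directional derivative. -/
def transposeDeriv (h : Y) : Dist Y →L[ℂ] Dist Y :=
  ContinuousLinearMap.precomp ℂ (LineDeriv.lineDerivOpCLM ℂ 𝓢(Y, ℂ) h)

theorem transposeDeriv_apply (h : Y) (u : Dist Y) (f : 𝓢(Y, ℂ)) :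
    transposeDeriv h u f = u (LineDeriv.lineDerivOp h f) := rfl

theorem continuous_seminorm_comp (S : Dist Y →L[ℂ] 𝓢(X, ℂ)) (k n : ℕ) :
    Continuous ((SchwartzMap.seminorm ℂ k n).comp S.toLinearMap : Seminorm ℂ (Dist Y)) :=
  ((schwartz_withSeminorms ℂ X ℂ).continuous_seminorm (k, n)).comp S.continuous

/-- Boundedness of an operator from distributions to functions, tested on a bounded set. -/
theorem exists_bounded_operator (S : Dist Y →L[ℂ] 𝓢(X, ℂ)) (k : ℕ) :
    ∃ B : Set 𝓢(Y, ℂ), Bornology.IsVonNBounded ℂ B ∧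
      ∀ (u : Dist Y) (r : ℝ), 0 ≤ r → (∀ f ∈ B, ‖u f‖ ≤ r) → ∀ x, ‖x‖ ^ k * ‖S u x‖ ≤ r := by
  obtain ⟨B, hB, h⟩ := exists_bounded_of_continuous_seminorm _ (continuous_seminorm_comp S k 0)
  refine ⟨B, hB, fun u r hr hu x => ?_⟩
  have h1 := le_seminorm ℂ k 0 (S u) x
  rw [norm_iteratedFDeriv_zero] at h1
  exact h1.trans (h u r hr hu)

theorem exists_kernelFun_bound (S : Dist Y →L[ℂ] 𝓢(X, ℂ)) (k : ℕ) :
    ∃ C : ℝ, ∀ z, ‖z‖ ^ k * ‖kernelFun S z‖ ≤ C := by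
  obtain ⟨B, hB, h⟩ := exists_bounded_operator S k
  obtain ⟨C, hC0, hC⟩ := exists_bound_of_isVonNBounded hB 0 0
  obtain ⟨B', hB', h'⟩ := exists_bounded_operator S 0
  obtain ⟨C', hC0', hC'⟩ := exists_bound_of_isVonNBounded hB' k 0
  simp only [norm_iteratedFDeriv_zero, pow_zero, one_mul] at hC hC' h'
  refine ⟨max C C', fun z => ?_⟩
  rw [Prod.norm_def]
  rcases max_cases ‖z.1‖ ‖z.2‖ with hz | hz <;> rw [hz.1]
  · exact (h _ C hC0 (fun f hf => hC f hf _) z.1).trans (le_max_left _ _)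
  · refine le_trans ?_ (le_max_right _ _)
    have := h' (((‖z.2‖ ^ k : ℝ) : ℂ) • evalDist z.2) C' hC0' (fun f hf => ?_) z.1
    · rw [map_smul, smul_apply, norm_smul, Complex.norm_real, norm_pow, norm_norm] at this
      exact this
    · rw [smul_apply, norm_smul, Complex.norm_real, norm_pow, norm_norm]
      exact hC' f hf _

/-- A uniform Taylor bound for functions with bounded second derivative. -/
theorem norm_taylor_le (f : 𝓢(Y, ℂ)) (C : ℝ) (hC : ∀ y, ‖iteratedFDeriv ℝ 2 f y‖ ≤ C) (y y' : Y) :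
    ‖f y' - f y - fderiv ℝ f y (y' - y)‖ ≤ C * ‖y' - y‖ ^ 2 := by
  have hC0 : 0 ≤ C := (norm_nonneg _).trans (hC 0)
  have hd : Differentiable ℝ (fderiv ℝ f) :=
    ((f.smooth ⊤).fderiv_right (m := 1) (by norm_cast)).differentiable (by simp)
  have h2 (z : Y) : ‖fderiv ℝ (fderiv ℝ f) z‖ ≤ C := by
    refine le_trans (le_of_eq ?_) (hC z)
    rw [← norm_iteratedFDeriv_fderiv, ← norm_iteratedFDeriv_fderiv, norm_iteratedFDeriv_zero]
  have hL (z : Y) : ‖fderiv ℝ f z - fderiv ℝ f y‖ ≤ C * ‖z - y‖ :=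
    convex_univ.norm_image_sub_le_of_norm_fderiv_le (𝕜 := ℝ) (fun z _ => hd z) (fun z _ => h2 z)
      (Set.mem_univ _) (Set.mem_univ _)
  have := (convex_closedBall y ‖y' - y‖).norm_image_sub_le_of_norm_hasFDerivWithin_le'
    (f := f) (f' := fderiv ℝ f) (φ := fderiv ℝ f y) (C := C * ‖y' - y‖) (x := y) (y := y')
    (fun z _ => f.differentiableAt.hasFDerivAt.hasFDerivWithinAt)
    (fun z hz => (hL z).trans ?_) (by simp) (by simp [dist_eq_norm])
  · refine this.trans (le_of_eq (by ring))
  · rw [mem_closedBall_iff_norm] at hz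
    gcongr

/-- The operators whose kernels are the partial derivatives of the kernel of `S`. -/
def derivOperator (S : Dist Y →L[ℂ] 𝓢(X, ℂ)) :
    Fin (Module.finrank ℝ X) ⊕ Fin (Module.finrank ℝ Y) → (Dist Y →L[ℂ] 𝓢(X, ℂ)) :=
  Sum.elim (fun i => LineDeriv.lineDerivOpCLM ℂ 𝓢(X, ℂ) (Module.finBasis ℝ X i) ∘L S)
    (fun i => S ∘L transposeDeriv (Module.finBasis ℝ Y i))

variable (X Y) in
/-- The coordinate functionals of `X × Y`. -/
def coordFunctional : Fin (Module.finrank ℝ X) ⊕ Fin (Module.finrank ℝ Y) → (X × Y →L[ℝ] ℝ) :=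
  Sum.elim (fun i => ((Module.finBasis ℝ X).coord i).toContinuousLinearMap ∘L
      ContinuousLinearMap.fst ℝ X Y)
    (fun i => ((Module.finBasis ℝ Y).coord i).toContinuousLinearMap ∘L
      ContinuousLinearMap.snd ℝ X Y)

variable (X Y) in
/-- The real linear map `c ↦ c · (coordinate functional)`. -/
def coordSMul (i : Fin (Module.finrank ℝ X) ⊕ Fin (Module.finrank ℝ Y)) :
    ℂ →L[ℝ] (X × Y →L[ℝ] ℂ) :=
  ContinuousLinearMap.smulRightL ℝ (X × Y) ℂ (coordFunctional X Y i)

/-- The partial derivatives of the kernel of `S` are the kernels of the operators `derivOperator S i`,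
so that smoothness and decay of kernels follow by induction on the order of the derivative. -/
theorem hasFDerivAt_kernelFun (S : Dist Y →L[ℂ] 𝓢(X, ℂ)) (z : X × Y) :
    HasFDerivAt (kernelFun S) (∑ i, coordSMul X Y i (kernelFun (derivOperator S i) z)) z := by
  obtain ⟨x, y⟩ := z
  let T (i : Fin (Module.finrank ℝ Y)) : 𝓢(X, ℂ) :=
    S (transposeDeriv (Module.finBasis ℝ Y i) (evalDist y))
  let cY (i : Fin (Module.finrank ℝ Y)) : X × Y →L[ℝ] ℝ := coordFunctional X Y (Sum.inr i)
  let G : X × Y → ℂ := fun z => S (evalDist y) z.1 + ∑ i, cY i (z - (x, y)) • T i z.1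
  -- the first-order expansion in `y`, with remainder of second order
  have hrem : HasFDerivAt (fun z => kernelFun S z - G z) (0 : X × Y →L[ℝ] ℂ) (x, y) := by
    obtain ⟨B, hB, h⟩ := exists_bounded_operator S 0
    obtain ⟨C, hC0, hC⟩ := exists_bound_of_isVonNBounded hB 0 2
    simp only [pow_zero, one_mul] at h hC
    refine Asymptotics.IsBigO.hasFDerivAt (n := 2) ?_ one_lt_two
    refine Asymptotics.IsBigO.of_bound C (Filter.Eventually.of_forall fun z => ?_)
    have hR : kernelFun S z - G z = S (evalDist z.2 - evalDist y -
        ∑ i, (((Module.finBasis ℝ Y).coord i (z.2 - y) : ℝ) : ℂ) •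
          transposeDeriv (Module.finBasis ℝ Y i) (evalDist y)) z.1 := by
      rw [map_sub, map_sub, map_sum]
      simp only [map_smul, sub_apply, sum_apply, smul_apply, kernelFun, G, T]
      rw [sub_sub]
      rfl
    rw [hR]
    refine (h _ (C * ‖z.2 - y‖ ^ 2) (by positivity) (fun f hf => ?_) z.1).trans ?_
    · refine le_trans (le_of_eq ?_) (norm_taylor_le f C (hC f hf) y z.2)
      simp only [sub_apply, sum_apply, smul_apply, evalDist_apply, transposeDeriv_apply,
        lineDerivOp_apply_eq_fderiv]
      congr 2
      conv_rhs => rw [← (Module.finBasis ℝ Y).sum_repr (z.2 - y)]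
      rw [map_sum]
      refine Finset.sum_congr rfl fun i _ => ?_
      rw [map_smul]
      rfl
    · rw [norm_pow, norm_norm]
      gcongr
      exact norm_snd_le (z - (x, y))
  have hG : HasFDerivAt G (∑ i, coordSMul X Y i (kernelFun (derivOperator S i) (x, y))) (x, y) := by
    have h1 : HasFDerivAt (fun z : X × Y => S (evalDist y) z.1)
        ((fderiv ℝ (S (evalDist y)) x).comp (ContinuousLinearMap.fst ℝ X Y)) (x, y) :=
      HasFDerivAt.comp (g := S (evalDist y)) (f := Prod.fst) (x, y)
        (S (evalDist y)).differentiableAt.hasFDerivAt hasFDerivAt_fst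
    have h2 (i : Fin (Module.finrank ℝ Y)) : HasFDerivAt
        (fun z : X × Y => cY i (z - (x, y)) • T i z.1) ((cY i).smulRight (T i x)) (x, y) := by
      have ha : HasFDerivAt (fun z : X × Y => cY i (z - (x, y))) (cY i) (x, y) :=
        (cY i).hasFDerivAt.comp (x, y) ((hasFDerivAt_id _).sub_const _)
      have hb : HasFDerivAt (fun z : X × Y => T i z.1)
          ((fderiv ℝ (T i) x).comp (ContinuousLinearMap.fst ℝ X Y)) (x, y) :=
        HasFDerivAt.comp (g := T i) (f := Prod.fst) (x, y)
          (T i).differentiableAt.hasFDerivAt hasFDerivAt_fst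
      refine (ha.smul hb).congr_fderiv ?_
      ext v <;> simp
    refine (h1.add (HasFDerivAt.fun_sum fun i _ => h2 i)).congr_fderiv ?_
    rw [Fintype.sum_sum_type]
    congr 1
    ext v
    · have hv : (fderiv ℝ (S (evalDist y)) x) v =
          ∑ i, (Module.finBasis ℝ X).repr v i •
            fderiv ℝ (S (evalDist y)) x (Module.finBasis ℝ X i) := by
        conv_lhs => rw [← (Module.finBasis ℝ X).sum_repr v]
        rw [map_sum]
        simp only [map_smul]
      simp only [ContinuousLinearMap.comp_apply, ContinuousLinearMap.inl_apply,
        ContinuousLinearMap.coe_fst', hv, sum_apply]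
      refine Finset.sum_congr rfl fun i _ => ?_
      simp [coordSMul, coordFunctional, kernelFun, derivOperator, lineDerivOp_apply_eq_fderiv]
    · simp [coordSMul, coordFunctional]
  exact ((hrem.fun_add hG).congr_fderiv (zero_add _)).congr_of_eventuallyEq
    (Filter.Eventually.of_forall fun z => by simp)

theorem fderiv_kernelFun (S : Dist Y →L[ℂ] 𝓢(X, ℂ)) :
    fderiv ℝ (kernelFun S) = fun z => ∑ i, coordSMul X Y i (kernelFun (derivOperator S i) z) :=
  funext fun z => (hasFDerivAt_kernelFun S z).fderiv

theorem contDiff_kernelFun (n : ℕ) : ∀ S : Dist Y →L[ℂ] 𝓢(X, ℂ), ContDiff ℝ n (kernelFun S) := by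
  induction n with
  | zero =>
    exact fun S => contDiff_zero.2
      (continuous_iff_continuousAt.2 fun z => (hasFDerivAt_kernelFun S z).continuousAt)
  | succ n ih =>
    intro S
    rw [Nat.cast_succ, contDiff_succ_iff_fderiv]
    refine ⟨fun z => (hasFDerivAt_kernelFun S z).differentiableAt, by simp, ?_⟩
    rw [fderiv_kernelFun]
    exact ContDiff.sum fun i _ => (coordSMul X Y i).contDiff.comp (ih _)

theorem norm_iteratedFDeriv_sum_comp_le {ι E V W : Type} [Fintype ι] [NormedAddCommGroup E]
    [NormedSpace ℝ E] [NormedAddCommGroup V] [NormedSpace ℝ V] [NormedAddCommGroup W] [NormedSpace ℝ W]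
    (L : ι → V →L[ℝ] W) (g : ι → E → V) (n : ℕ) (hg : ∀ i, ContDiff ℝ n (g i)) (z : E) :
    ‖iteratedFDeriv ℝ n (fun z => ∑ i, L i (g i z)) z‖ ≤ ∑ i, ‖L i‖ * ‖iteratedFDeriv ℝ n (g i) z‖ := by
  rw [iteratedFDeriv_sum (f := fun i z => L i (g i z)) fun i _ => (L i).contDiff.comp (hg i),
    Finset.sum_apply]
  refine (norm_sum_le _ _).trans (Finset.sum_le_sum fun i _ => ?_)
  exact (L i).norm_iteratedFDeriv_comp_left (hg i).contDiffAt le_rfl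

theorem exists_kernelFun_deriv_bound (k n : ℕ) : ∀ S : Dist Y →L[ℂ] 𝓢(X, ℂ),
    ∃ C : ℝ, ∀ z, ‖z‖ ^ k * ‖iteratedFDeriv ℝ n (kernelFun S) z‖ ≤ C := by
  induction n with
  | zero =>
    intro S
    simpa only [norm_iteratedFDeriv_zero] using exists_kernelFun_bound S k
  | succ n ih =>
    intro S
    choose C hC using fun i => ih (derivOperator S i)
    refine ⟨∑ i, ‖coordSMul X Y i‖ * C i, fun z => ?_⟩
    rw [← norm_iteratedFDeriv_fderiv, fderiv_kernelFun]
    calc _ ≤ ‖z‖ ^ k * ∑ i, ‖coordSMul X Y i‖ *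
          ‖iteratedFDeriv ℝ n (kernelFun (derivOperator S i)) z‖ := by
          gcongr
          exact norm_iteratedFDeriv_sum_comp_le _ _ n (fun i => contDiff_kernelFun n _) z
      _ = ∑ i, ‖coordSMul X Y i‖ *
          (‖z‖ ^ k * ‖iteratedFDeriv ℝ n (kernelFun (derivOperator S i)) z‖) := by
          rw [Finset.mul_sum]
          exact Finset.sum_congr rfl fun i _ => by ring
      _ ≤ _ := by
          gcongr with i _
          exact hC i z

/-- The kernel of a continuous operator from distributions to functions is a Schwartz function. -/
def smoothKernel (S : Dist Y →L[ℂ] 𝓢(X, ℂ)) : 𝓢(X × Y, ℂ) where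
  toFun := kernelFun S
  smooth' := contDiff_infty.2 fun n => contDiff_kernelFun n S
  decay' := fun k n => exists_kernelFun_deriv_bound k n S

end SmoothingKernel

/-! ### Functionals on distributions and the Schwartz kernel theorem -/

section EvalIntegral

variable {Y : Type} [NormedAddCommGroup Y] [NormedSpace ℝ Y] [FiniteDimensional ℝ Y]
  [MeasureSpace Y] [BorelSpace Y] [(volume : Measure Y).IsAddHaarMeasure]

/-- Restriction of distributions to a bounded set of Schwartz functions, as bounded functions. -/
def restrictBounded {B : Set 𝓢(Y, ℂ)} (hB : Bornology.IsVonNBounded ℂ B) :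
    Dist Y →ₗ[ℂ] BoundedContinuousFunction B ℂ where
  toFun := fun u => BoundedContinuousFunction.ofNormedAddCommGroup (fun f : B => u f)
    (u.continuous.comp continuous_subtype_val)
    (Classical.choose ((NormedSpace.isVonNBounded_iff' ℂ).1 (hB.image u)))
    (fun f => Classical.choose_spec ((NormedSpace.isVonNBounded_iff' ℂ).1 (hB.image u)) _
      ⟨f, f.2, rfl⟩)
  map_add' := fun _ _ => by ext; rfl
  map_smul' := fun _ _ => by ext; rfl

/-- A continuous linear functional on distributions depends only on the restriction to a bounded set
of Schwartz functions, and continuously so. -/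
theorem exists_functional_factor (l : Dist Y →L[ℂ] ℂ) :
    ∃ (B : Set 𝓢(Y, ℂ)) (hB : Bornology.IsVonNBounded ℂ B)
      (m : BoundedContinuousFunction B ℂ →L[ℂ] ℂ), ∀ u, l u = m (restrictBounded hB u) := by
  obtain ⟨B, hB, h⟩ := exists_bounded_of_continuous_seminorm
    ((normSeminorm ℂ ℂ).comp l.toLinearMap) (continuous_norm.comp l.continuous)
  have hb (u : Dist Y) : ‖l u‖ ≤ ‖restrictBounded hB u‖ :=
    h u _ (norm_nonneg _) fun f hf => (restrictBounded hB u).norm_coe_le_norm ⟨f, hf⟩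
  have hker : (restrictBounded hB).ker ≤ l.toLinearMap.ker := fun u hu => by
    have h1 := hb u
    rw [LinearMap.mem_ker.1 hu, norm_zero] at h1
    exact norm_le_zero_iff.1 h1
  let e := (restrictBounded hB).quotKerEquivRange
  let m₀ : (restrictBounded hB).range →ₗ[ℂ] ℂ :=
    (Submodule.liftQ _ l.toLinearMap hker) ∘ₗ e.symm.toLinearMap
  have hm₀ (u : Dist Y) : m₀ ⟨restrictBounded hB u, u, rfl⟩ = l u := by
    have : e.symm ⟨restrictBounded hB u, u, rfl⟩ = Submodule.Quotient.mk u := by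
      rw [LinearEquiv.symm_apply_eq]
      rfl
    simp only [m₀, LinearMap.comp_apply, LinearEquiv.coe_coe, this]
    rfl
  let m₁ : StrongDual ℂ (restrictBounded hB).range := m₀.mkContinuous 1 (by
    rintro ⟨_, u, rfl⟩
    rw [one_mul, hm₀]
    exact hb u)
  obtain ⟨m, hm, -⟩ := exists_extension_norm_eq _ m₁
  exact ⟨B, hB, m, fun u => ((hm ⟨restrictBounded hB u, u, rfl⟩).trans (hm₀ u)).symm⟩

/-- Since `f = ∫ f(y) δ_y dy` in the strong dual, `⟨l, f⟩ = ∫ f(y) ⟨l, δ_y⟩ dy`. -/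
theorem functional_embed (l : Dist Y →L[ℂ] ℂ) (f : 𝓢(Y, ℂ)) :
    l (embed f) = ∫ y, f y * l (evalDist y) := by
  obtain ⟨B, hB, m, hm⟩ := exists_functional_factor l
  obtain ⟨C, hC0, hC⟩ := exists_bound_of_isVonNBounded hB 0 0
  obtain ⟨C', hC0', hC'⟩ := exists_bound_of_isVonNBounded hB 0 1
  simp only [pow_zero, one_mul, norm_iteratedFDeriv_zero] at hC hC'
  let J : Y → BoundedContinuousFunction B ℂ := fun y => restrictBounded hB (evalDist y)
  have hJ : Continuous J := by
    refine (LipschitzWith.of_dist_le_mul (K := ⟨C', hC0'⟩) fun y y' => ?_).continuous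
    rw [BoundedContinuousFunction.dist_le (by positivity)]
    rintro ⟨g, hg⟩
    rw [dist_eq_norm, dist_eq_norm]
    exact convex_univ.norm_image_sub_le_of_norm_fderiv_le (𝕜 := ℝ) (f := g)
      (fun z _ => g.differentiableAt)
      (fun z _ => by
        refine le_trans (le_of_eq ?_) (hC' g hg z)
        rw [← norm_iteratedFDeriv_fderiv, norm_iteratedFDeriv_zero])
      (Set.mem_univ _) (Set.mem_univ _)
  have hJb (y : Y) : ‖J y‖ ≤ C := by
    rw [BoundedContinuousFunction.norm_le hC0]
    exact fun g => hC g g.2 y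
  have hint : Integrable (fun y => f y • J y) := by
    refine (f.integrable.norm.mul_const C).mono' (f.continuous.smul hJ).aestronglyMeasurable
      (Filter.Eventually.of_forall fun y => ?_)
    rw [norm_smul]
    gcongr
    exact hJb y
  have hE : restrictBounded hB (embed f) = ∫ y, f y • J y := by
    ext g
    have := (BoundedContinuousFunction.evalCLM ℂ g).integral_comp_comm hint
    refine Eq.trans ?_ this
    rfl
  rw [hm, hE, ← m.integral_comp_comm hint]
  refine integral_congr_ae (Filter.Eventually.of_forall fun y => ?_)
  simp only [map_smul, smul_eq_mul, hm, J]

end EvalIntegral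

section KernelTheorem

variable {X Y : Type} [NormedAddCommGroup X] [NormedSpace ℝ X] [FiniteDimensional ℝ X]
  [MeasureSpace X] [BorelSpace X] [(volume : Measure X).IsAddHaarMeasure]
  [NormedAddCommGroup Y] [NormedSpace ℝ Y] [FiniteDimensional ℝ Y]
  [MeasureSpace Y] [BorelSpace Y] [(volume : Measure Y).IsAddHaarMeasure]
  [(volume : Measure (X × Y)).IsAddHaarMeasure]

/-- Schwartz kernel theorem for smoothing operators. -/
theorem int_embed_smoothKernel (S : Dist Y →L[ℂ] 𝓢(X, ℂ)) :
    int (embed (smoothKernel S)) = embed ∘L S ∘L embed := by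
  ext f g
  rw [int_apply, embed_apply, ContinuousLinearMap.comp_apply, ContinuousLinearMap.comp_apply,
    embed_apply]
  refine (integral_prod (μ := (volume : Measure X)) (ν := (volume : Measure Y)) _
    (integrable_mul (smoothKernel S) (tensor g f))).trans ?_
  refine integral_congr_ae (Filter.Eventually.of_forall fun x => ?_)
  let l : Dist Y →L[ℂ] ℂ := evalDist x ∘L S
  have h := functional_embed l f
  have e1 : l (embed f) = S (embed f) x := rfl
  have e2 (y : Y) : l (evalDist y) = smoothKernel S (x, y) := rfl
  simp only [e1, e2] at h
  simp only [h, tensor_apply]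
  rw [← integral_mul_const]
  refine integral_congr_ae (Filter.Eventually.of_forall fun y => ?_)
  simp only
  ring

end KernelTheorem

/-! ### Tensor products separate points -/

section Separation

variable {X Y : Type} [NormedAddCommGroup X] [NormedSpace ℝ X] [NormedAddCommGroup Y] [NormedSpace ℝ Y]

/-- `τ` is real, nonnegative, supported in the ball of radius `ε` about `z`, and positive at `z`. -/
def IsBumpAt (τ : 𝓢(X, ℂ)) (z : X) (ε : ℝ) : Prop :=
  ∃ ρ : X → ℝ, (∀ x, τ x = ρ x) ∧ (∀ x, 0 ≤ ρ x) ∧ (∀ x, ρ x ≠ 0 → x ∈ Metric.ball z ε) ∧ 0 < ρ z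

theorem IsBumpAt.tensor {τ : 𝓢(X, ℂ)} {σ : 𝓢(Y, ℂ)} {x : X} {y : Y} {ε : ℝ} (hτ : IsBumpAt τ x ε)
    (hσ : IsBumpAt σ y ε) : IsBumpAt (tensor τ σ) (x, y) ε := by
  obtain ⟨ρ, h1, h2, h3, h4⟩ := hτ
  obtain ⟨ρ', h1', h2', h3', h4'⟩ := hσ
  refine ⟨fun z => ρ z.1 * ρ' z.2, fun z => ?_, fun z => mul_nonneg (h2 _) (h2' _), fun z hz => ?_,
    mul_pos h4 h4'⟩
  · rw [tensor_apply, h1, h1', Complex.ofReal_mul]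
  · rw [← ball_prod_same]
    exact ⟨h3 _ (left_ne_zero_of_mul hz), h3' _ (right_ne_zero_of_mul hz)⟩

theorem exists_isBumpAt [HasContDiffBump X] [FiniteDimensional ℝ X] (z : X) {ε : ℝ} (hε : 0 < ε) :
    ∃ τ : 𝓢(X, ℂ), IsBumpAt τ z ε := by
  let b : ContDiffBump z := ⟨ε / 2, ε, by positivity, by linarith⟩
  have hc : HasCompactSupport (fun x => (b x : ℂ)) :=
    b.hasCompactSupport.comp_left (g := fun t : ℝ => (t : ℂ)) Complex.ofReal_zero
  have hs : ContDiff ℝ ∞ (fun x => (b x : ℂ)) := Complex.ofRealCLM.contDiff.comp b.contDiff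
  refine ⟨hc.toSchwartzMap hs, b, fun x => rfl, fun x => b.nonneg, fun x hx => ?_, ?_⟩
  · have : x ∈ Function.support b := hx
    rwa [b.support_eq] at this
  · rw [b.one_of_mem_closedBall (Metric.mem_closedBall_self b.rIn_pos.le)]
    exact one_pos

/-- A Schwartz function vanishes at a point if it is orthogonal to arbitrarily narrow bumps there. -/
theorem eq_zero_of_integral_bump [FiniteDimensional ℝ X] [MeasureSpace X] [BorelSpace X]
    [(volume : Measure X).IsAddHaarMeasure] (F : 𝓢(X, ℂ)) (z : X)
    (h : ∀ ε > 0, ∃ τ : 𝓢(X, ℂ), IsBumpAt τ z ε ∧ ∫ x, F x * τ x = 0) : F z = 0 := by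
  by_contra hF
  have hF' : 0 < ‖F z‖ := norm_pos_iff.2 hF
  obtain ⟨ε, hε, hball⟩ := Metric.continuousAt_iff.1 F.continuous.continuousAt (‖F z‖ / 2) (by positivity)
  obtain ⟨τ, ⟨ρ, h1, h2, h3, h4⟩, h0⟩ := h ε hε
  have hρ : Integrable ρ := by
    refine τ.integrable.re.congr (Filter.Eventually.of_forall fun x => ?_)
    simp only [h1]
    exact Complex.ofReal_re _
  have hρc : Continuous ρ := by
    have : ρ = fun x => (τ x).re := funext fun x => by rw [h1, Complex.ofReal_re]
    rw [this]
    exact Complex.continuous_re.comp τ.continuous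
  have hpos : 0 < ∫ x, ρ x :=
    integral_pos_of_integrable_nonneg_nonzero (x := z) hρc hρ h2 h4.ne'
  have e1 : ∫ x, (F z - F x) * τ x = F z * ((∫ x, ρ x : ℝ) : ℂ) := by
    simp only [sub_mul]
    rw [integral_sub (τ.integrable.const_mul _) (integrable_mul F τ), h0, sub_zero,
      integral_const_mul, ← integral_complex_ofReal]
    simp only [h1]
  have e2 : ‖∫ x, (F z - F x) * τ x‖ ≤ ∫ x, ‖F z‖ / 2 * ρ x := by
    refine norm_integral_le_of_norm_le (hρ.const_mul _) (Filter.Eventually.of_forall fun x => ?_)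
    rw [norm_mul, h1, Complex.norm_real, Real.norm_of_nonneg (h2 x)]
    by_cases hx : ρ x = 0
    · simp [hx]
    · have := hball (h3 x hx)
      rw [dist_comm, dist_eq_norm] at this
      gcongr
      exact h2 x
  rw [e1, norm_mul, Complex.norm_real, Real.norm_of_nonneg hpos.le, integral_const_mul] at e2
  nlinarith [mul_pos hF' hpos]

end Separation

variable {d : ℕ}

/-- A Schwartz kernel is determined by its operator: the uniqueness half of the kernel theorem. -/
theorem int_embed_injective :
    Function.Injective (fun k : 𝓢(Pos2 d, ℂ) => int (embed k)) := by
  intro k k' hk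
  rw [← sub_eq_zero]
  ext ⟨x, y⟩
  refine eq_zero_of_integral_bump _ _ fun ε hε => ?_
  obtain ⟨τ, hτ⟩ := exists_isBumpAt x hε
  obtain ⟨σ, hσ⟩ := exists_isBumpAt y hε
  refine ⟨tensor τ σ, hτ.tensor hσ, ?_⟩
  have h : int (embed k) σ τ = int (embed k') σ τ := by
    simp only at hk
    rw [hk]
  rw [int_apply, int_apply, embed_apply, embed_apply] at h
  simp only [sub_apply, sub_mul]
  rw [integral_sub (integrable_mul k _) (integrable_mul k' _), h, sub_self]

theorem eq_of_integral_tensor_tensor {F F' : 𝓢(Pos4 d, ℂ)}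
    (h : ∀ a b f g : 𝓢(Pos d, ℂ), ∫ x, F x * tensor (tensor a b) (tensor f g) x =
      ∫ x, F' x * tensor (tensor a b) (tensor f g) x) : F = F' := by
  rw [← sub_eq_zero]
  ext ⟨⟨x, y⟩, ⟨x', y'⟩⟩
  refine eq_zero_of_integral_bump _ _ fun ε hε => ?_
  obtain ⟨τ, hτ⟩ := exists_isBumpAt x hε
  obtain ⟨σ, hσ⟩ := exists_isBumpAt y hε
  obtain ⟨τ', hτ'⟩ := exists_isBumpAt x' hε
  obtain ⟨σ', hσ'⟩ := exists_isBumpAt y' hε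
  refine ⟨_, (hτ.tensor hσ).tensor (hτ'.tensor hσ'), ?_⟩
  simp only [sub_apply, sub_mul]
  rw [integral_sub (integrable_mul F _) (integrable_mul F' _), h, sub_self]

/-! ### Kernels of smoothing operators and the duality bracket -/

theorem int_embed_kernelSchwartz (T : OpSmooth d) : int (embed (kernelSchwartz T)) = incl T :=
  Function.invFun_eq (f := fun k : 𝓢(Pos2 d, ℂ) => int (embed k))
    ⟨smoothKernel T, int_embed_smoothKernel T⟩

theorem kernelSchwartz_eq {T : OpSmooth d} {k : 𝓢(Pos2 d, ℂ)} (h : incl T = int (embed k)) :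
    kernelSchwartz T = k :=
  int_embed_injective ((int_embed_kernelSchwartz T).trans h)

theorem kernelSchwartz_rankOne (f h : 𝓢(Pos d, ℂ)) : kernelSchwartz (rankOne f h) = tensor f h :=
  kernelSchwartz_eq (incl_rankOne f h)

theorem bracket_int_rankOne (κ : Dist (Pos2 d)) (f h : 𝓢(Pos d, ℂ)) :
    bracket (int κ) (rankOne f h) = κ (tensor f h) := by
  have h1 : int (kernelDist (int κ)) = int κ := Function.invFun_eq (f := int) ⟨κ, rfl⟩
  rw [bracket, kernelSchwartz_rankOne, ← int_apply, h1, int_apply]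

theorem int_smul (c : ℂ) (κ : Dist (Pos2 d)) : int (c • κ) = c • int κ := by
  ext f g
  rfl

/-! ### Inversion and symmetry of the partial Fourier transform -/

section PartialFourierInversion

variable {U V : Type} [NormedAddCommGroup U] [NormedSpace ℝ U]
  [NormedAddCommGroup V] [InnerProductSpace ℝ V] [FiniteDimensional ℝ V] [MeasurableSpace V]
  [BorelSpace V]

theorem partialFourier_eq_fourier (s : ℝ) (hs : s ≠ 0) (F : 𝓢(U × V, ℂ)) (u : U) (ξ : V) :
    partialFourier U V s hs F (u, ξ) =
      FourierTransform.fourier (fun v => F (u, v)) ((-s / (2 * Real.pi)) • ξ) := by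
  rw [partialFourier_apply, Real.fourier_eq']
  refine integral_congr_ae (Filter.Eventually.of_forall fun v => ?_)
  simp only [smul_eq_mul]
  congr 2
  rw [inner_smul_right, real_inner_comm]
  push_cast
  have : (Real.pi : ℂ) ≠ 0 := by exact_mod_cast Real.pi_ne_zero
  field_simp

/-- Fourier inversion in the second variable; `s` and `t` are the opposite signs `±1` of the exponents. -/
theorem partialFourier_partialFourier (s t : ℝ) (hs : s ≠ 0) (ht : t ≠ 0) (hst : t = -s)
    (h1 : s ^ 2 = 1) (F : 𝓢(U × V, ℂ)) :
    partialFourier U V t ht (partialFourier U V s hs F) =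
      ((2 * Real.pi : ℝ) ^ (Module.finrank ℝ V) : ℂ) • F := by
  subst hst
  ext ⟨u, y⟩
  have hpi := Real.pi_pos
  have habs : |s| = 1 := by
    rw [← Real.sqrt_sq_eq_abs, h1, Real.sqrt_one]
  set f : V → ℂ := fun v => F (u, v)
  have hf : Continuous f := F.continuous.comp (by fun_prop)
  have hfi : Integrable f := integrable_slice F u
  have hFf : Integrable (FourierTransform.fourier f) := by
    have h2 := (integrable_slice (partialFourier U V s hs F) u).comp_smul
      (R := -(2 * Real.pi * s)) (by simp [hs, hpi.ne'])
    refine h2.congr (Filter.Eventually.of_forall fun η => ?_)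
    simp only
    rw [partialFourier_eq_fourier, smul_smul]
    have : -s / (2 * Real.pi) * -(2 * Real.pi * s) = 1 := by
      field_simp
      linarith
    rw [this, one_smul]
  have hinv := congrFun (hf.fourierInv_fourier_eq hfi hFf) y
  rw [Real.fourierInv_eq'] at hinv
  rw [partialFourier_apply, smul_apply, smul_eq_mul]
  change _ = _ * f y
  rw [← hinv]
  have hsub := Measure.integral_comp_smul (volume : Measure V)
    (fun η => Complex.exp (((2 * Real.pi * inner ℝ η y : ℝ) : ℂ) * Complex.I) •
      FourierTransform.fourier f η) (-s / (2 * Real.pi))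
  have hc : |((-s / (2 * Real.pi)) ^ Module.finrank ℝ V)⁻¹| = (2 * Real.pi) ^ Module.finrank ℝ V := by
    rw [abs_inv, abs_pow, abs_div, abs_neg, habs, abs_of_pos (by positivity : 0 < 2 * Real.pi),
      one_div, inv_pow, inv_inv]
  rw [hc, Complex.real_smul, Complex.ofReal_pow] at hsub
  rw [← hsub]
  refine integral_congr_ae (Filter.Eventually.of_forall fun ξ => ?_)
  simp only
  rw [partialFourier_eq_fourier, smul_eq_mul]
  congr 2
  rw [inner_smul_left, real_inner_comm]
  have : (Real.pi : ℂ) ≠ 0 := by exact_mod_cast Real.pi_ne_zero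
  simp only [conj_trivial]
  push_cast
  field_simp

variable [FiniteDimensional ℝ U] [MeasureSpace U] [BorelSpace U] [SFinite (volume : Measure U)]
  [hH : (Measure.prod (volume : Measure U) (volume : Measure V)).IsAddHaarMeasure]

/-- The partial Fourier transform is symmetric for the bilinear pairing. -/
theorem integral_partialFourier_mul (s : ℝ) (hs : s ≠ 0) (F G : 𝓢(U × V, ℂ)) :
    ∫ p, partialFourier U V s hs F p * G p ∂(Measure.prod (volume : Measure U) (volume : Measure V)) =
      ∫ p, F p * partialFourier U V s hs G p ∂(Measure.prod (volume : Measure U) (volume : Measure V)) := by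
  let _ : MeasureSpace (U × V) := ⟨Measure.prod (volume : Measure U) (volume : Measure V)⟩
  have : (volume : Measure (U × V)).IsAddHaarMeasure := hH
  rw [integral_prod _ (integrable_mul (partialFourier U V s hs F) G),
    integral_prod _ (integrable_mul F (partialFourier U V s hs G))]
  refine integral_congr_ae (Filter.Eventually.of_forall fun u => ?_)
  simp only [partialFourier_apply]
  simp only [← integral_const_mul, ← integral_mul_const]
  rw [integral_integral_swap]
  · refine integral_congr_ae (Filter.Eventually.of_forall fun v => ?_)
    refine integral_congr_ae (Filter.Eventually.of_forall fun ξ => ?_)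
    simp only
    rw [real_inner_comm]
    ring
  · have h := (integrable_slice G u).mul_prod (integrable_slice F u)
    refine h.norm.mono' ?_ (Filter.Eventually.of_forall fun p => ?_)
    · have := F.continuous
      have := G.continuous
      refine Continuous.aestronglyMeasurable ?_
      simp only [Function.uncurry_def]
      fun_prop
    · simp only [Function.uncurry_def]
      rw [norm_mul, norm_mul, norm_expI, one_mul, norm_mul, mul_comm]

end PartialFourierInversion

/-! ### The magnetic super Weyl transform on Schwartz functions and its inverse -/

variable {d : ℕ}

instance : (Measure.prod (volume : Measure (Pos2 d × Pos d)) (volume : Measure (Pos d))).IsAddHaarMeasure :=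
  haveI : (volume : Measure (Pos2 d × Pos d)).IsAddHaarMeasure :=
    Measure.prod.instIsAddHaarMeasure (volume : Measure (Pos2 d)) (volume : Measure (Pos d))
  Measure.prod.instIsAddHaarMeasure (volume : Measure (Pos2 d × Pos d)) (volume : Measure (Pos d))

theorem measurePreserving_assocEquiv : MeasurePreserving (assocEquiv d)
    (volume : Measure (Pos4 d))
    (Measure.prod (volume : Measure (Pos2 d × Pos d)) (volume : Measure (Pos d))) :=
  (measurePreserving_prodAssoc (volume : Measure (Pos2 d)) (volume : Measure (Pos d))
    (volume : Measure (Pos d))).symm MeasurableEquiv.prodAssoc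

theorem integral_comp_assocEquiv (f : (Pos2 d × Pos d) × Pos d → ℂ) :
    ∫ x, f (assocEquiv d x) =
      ∫ y, f y ∂(Measure.prod (volume : Measure (Pos2 d × Pos d)) (volume : Measure (Pos d))) :=
  measurePreserving_assocEquiv.integral_comp
    (assocEquiv d).toHomeomorph.measurableEmbedding f

theorem integral_comp_prodComm (f : Pos4 d → ℂ) : ∫ x : Pos4 d, f x.swap = ∫ x, f x :=
  (Measure.measurePreserving_swap (μ := (volume : Measure (Pos2 d)))
    (ν := (volume : Measure (Pos2 d)))).integral_comp
    MeasurableEquiv.prodComm.measurableEmbedding f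

theorem integral_fourierRight_mul (s : ℝ) (hs : s ≠ 0) (F G : 𝓢(Pos4 d, ℂ)) :
    ∫ x, fourierRight s hs F x * G x = ∫ x, F x * fourierRight s hs G x := by
  have h := integral_partialFourier_mul s hs
    (compCLMOfContinuousLinearEquiv ℂ (assocEquiv d).symm F)
    (compCLMOfContinuousLinearEquiv ℂ (assocEquiv d).symm G)
  rw [← integral_comp_assocEquiv, ← integral_comp_assocEquiv] at h
  simpa [fourierRight] using h

theorem swapCLM_swapCLM (F : 𝓢(Pos4 d, ℂ)) : swapCLM (swapCLM F) = F := rfl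

theorem integral_swapCLM_mul (F G : 𝓢(Pos4 d, ℂ)) :
    ∫ x, swapCLM F x * G x = ∫ x, F x * swapCLM G x := by
  rw [← integral_comp_prodComm]
  rfl

theorem integral_fourierLeft_mul (s : ℝ) (hs : s ≠ 0) (F G : 𝓢(Pos4 d, ℂ)) :
    ∫ x, fourierLeft s hs F x * G x = ∫ x, F x * fourierLeft s hs G x := by
  simp only [fourierLeft, ContinuousLinearMap.comp_apply]
  rw [integral_swapCLM_mul, integral_fourierRight_mul, ← integral_swapCLM_mul]

theorem fourierRight_fourierRight (s t : ℝ) (hs : s ≠ 0) (ht : t ≠ 0) (hst : t = -s)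
    (h1 : s ^ 2 = 1) (F : 𝓢(Pos4 d, ℂ)) :
    fourierRight t ht (fourierRight s hs F) = ((2 * Real.pi : ℝ) ^ d : ℂ) • F := by
  have h := partialFourier_partialFourier s t hs ht hst h1
    (compCLMOfContinuousLinearEquiv ℂ (assocEquiv d).symm F)
  rw [finrank_euclideanSpace_fin] at h
  ext x
  have h2 := congrArg (fun G : 𝓢((Pos2 d × Pos d) × Pos d, ℂ) => G (assocEquiv d x)) h
  exact h2

theorem fourierLeft_fourierLeft (s t : ℝ) (hs : s ≠ 0) (ht : t ≠ 0) (hst : t = -s)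
    (h1 : s ^ 2 = 1) (F : 𝓢(Pos4 d, ℂ)) :
    fourierLeft t ht (fourierLeft s hs F) = ((2 * Real.pi : ℝ) ^ d : ℂ) • F := by
  simp only [fourierLeft, ContinuousLinearMap.comp_apply]
  rw [swapCLM_swapCLM, fourierRight_fourierRight s t hs ht hst h1, map_smul, swapCLM_swapCLM]

/-- The midpoint coordinates have Jacobian one. -/
theorem integral_comp_midpointEquiv (f : 𝓢(Pos4 d, ℂ)) :
    ∫ x, f (midpointEquiv x) = ∫ x, f x := by
  let v4 : Measure (Pos4 d) := volume
  -- the shear `(U, V) ↦ (U - V/2, V)`, then `(Y, V) ↦ (Y + V, Y)`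
  have hperm : MeasurePreserving (fun p : Pos4 d => ((p.1.1, p.2.1), (p.1.2, p.2.2)) : Pos4 d → Pos4 d)
      volume volume := by
    have e1 := measurePreserving_prodAssoc (volume : Measure (Pos d)) (volume : Measure (Pos d))
      (volume : Measure (Pos2 d))
    have e2 : MeasurePreserving (fun q : Pos d × Pos d × Pos d => (q.2.1, (q.1, q.2.2)))
        (volume.prod (volume.prod volume)) (volume.prod (volume.prod volume)) := by
      have a1 := (measurePreserving_prodAssoc (volume : Measure (Pos d)) (volume : Measure (Pos d))
        (volume : Measure (Pos d))).symm MeasurableEquiv.prodAssoc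
      have a2 := (Measure.measurePreserving_swap (μ := (volume : Measure (Pos d)))
        (ν := (volume : Measure (Pos d)))).prod (MeasurePreserving.id (volume : Measure (Pos d)))
      exact (measurePreserving_prodAssoc (volume : Measure (Pos d)) (volume : Measure (Pos d))
        (volume : Measure (Pos d))).comp (a2.comp a1)
    have e3 := (MeasurePreserving.id (volume : Measure (Pos d))).prod e2
    exact (e1.symm MeasurableEquiv.prodAssoc).comp (e3.comp e1)
  have hshear : MeasurePreserving (fun p : Pos4 d => (p.1 - (1 / 2 : ℝ) • p.2, p.2) : Pos4 d → Pos4 d)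
      volume volume := by
    have h1 : MeasurePreserving (fun q : Pos2 d × Pos2 d => (q.1, q.2 - (1 / 2 : ℝ) • q.1))
        (volume.prod volume) (volume.prod volume) :=
      (MeasurePreserving.id (volume : Measure (Pos2 d))).skew_product
        (g := fun v u => u - (1 / 2 : ℝ) • v) (by fun_prop)
        (Filter.Eventually.of_forall fun v =>
          (measurePreserving_sub_right (volume : Measure (Pos2 d)) ((1 / 2 : ℝ) • v)).map_eq)
    exact Measure.measurePreserving_swap.comp (h1.comp Measure.measurePreserving_swap)
  have hshear' : MeasurePreserving (fun p : Pos4 d => (p.2 + p.1, p.1) : Pos4 d → Pos4 d)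
      volume volume := by
    have h1 : MeasurePreserving (fun q : Pos2 d × Pos2 d => (q.1, q.2 + q.1))
        (volume.prod volume) (volume.prod volume) :=
      (MeasurePreserving.id (volume : Measure (Pos2 d))).skew_product
        (g := fun v u => u + v) (by fun_prop)
        (Filter.Eventually.of_forall fun v =>
          (measurePreserving_add_right (volume : Measure (Pos2 d)) v).map_eq)
    exact Measure.measurePreserving_swap.comp h1
  have h := hshear'.comp (hshear.comp hperm)
  have he : ((fun p : Pos4 d => (p.2 + p.1, p.1)) ∘
      ((fun p : Pos4 d => (p.1 - (1 / 2 : ℝ) • p.2, p.2)) ∘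
        (fun p : Pos4 d => ((p.1.1, p.2.1), (p.1.2, p.2.2))))) = midpointEquiv := by
    funext p
    change ((p.1.2, p.2.2) + ((p.1.1, p.2.1) - (1 / 2 : ℝ) • (p.1.2, p.2.2)),
      (p.1.1, p.2.1) - (1 / 2 : ℝ) • (p.1.2, p.2.2)) =
      ((p.1.1 + (1 / 2 : ℝ) • p.1.2, p.2.1 + (1 / 2 : ℝ) • p.2.2),
      (p.1.1 - (1 / 2 : ℝ) • p.1.2, p.2.1 - (1 / 2 : ℝ) • p.2.2))
    ext <;> simp <;> ring
  rw [he] at h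
  exact h.integral_comp midpointEquiv.toHomeomorph.measurableEmbedding f

section

variable {d : ℕ}

theorem conj_superPhase_mul (𝓑 : RegularMagneticField d) (p : Pos4 d) :
    (starRingEnd ℂ) (superPhase 𝓑 p) * superPhase 𝓑 p = 1 := by
  rw [mul_comm, Complex.mul_conj, Complex.normSq_eq_norm_sq, superPhase, norm_expI]
  simp

theorem hasTemperateGrowth_conj_superPhase (𝓑 : RegularMagneticField d) :
    (fun p => (starRingEnd ℂ) (superPhase 𝓑 p)).HasTemperateGrowth :=
  Function.HasTemperateGrowth.comp (g := fun z : ℂ => (starRingEnd ℂ) z) (f := superPhase 𝓑)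
    (Complex.conjCLE : ℂ →L[ℝ] ℂ).hasTemperateGrowth (hasTemperateGrowth_superPhase 𝓑)

/-- The magnetic super Weyl transform `K^A` on Schwartz functions. -/
def superWeyl (𝓑 : RegularMagneticField d) : 𝓢(Pos4 d, ℂ) →L[ℂ] 𝓢(Pos4 d, ℂ) :=
  ((2 * Real.pi : ℝ) ^ (2 * d) : ℂ)⁻¹ • (smulLeftCLM ℂ (superPhase 𝓑) ∘L
    compCLMOfContinuousLinearEquiv ℂ midpointEquiv.symm ∘L
    fourierRight (-1) (by norm_num) ∘L fourierLeft 1 one_ne_zero)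

/-- The inverse of the magnetic super Weyl transform on Schwartz functions. -/
def superWeylInv (𝓑 : RegularMagneticField d) : 𝓢(Pos4 d, ℂ) →L[ℂ] 𝓢(Pos4 d, ℂ) :=
  fourierLeft (-1) (by norm_num) ∘L fourierRight 1 one_ne_zero ∘L
    compCLMOfContinuousLinearEquiv ℂ midpointEquiv ∘L
    smulLeftCLM ℂ (fun p => (starRingEnd ℂ) (superPhase 𝓑 p))

theorem two_pi_pow_mul (d : ℕ) : ((2 * Real.pi : ℝ) ^ (2 * d) : ℂ)⁻¹ *
    (((2 * Real.pi : ℝ) ^ d : ℂ) * ((2 * Real.pi : ℝ) ^ d : ℂ)) = 1 := by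
  have : ((2 * Real.pi : ℝ) : ℂ) ≠ 0 := by exact_mod_cast (by positivity : 2 * Real.pi ≠ 0)
  rw [← pow_add, ← two_mul d]
  exact inv_mul_cancel₀ (pow_ne_zero _ this)

theorem superWeyl_superWeylInv (𝓑 : RegularMagneticField d) (F : 𝓢(Pos4 d, ℂ)) :
    superWeyl 𝓑 (superWeylInv 𝓑 F) = F := by
  have h1 := smulLeftCLM_apply_apply (F := ℂ) (hasTemperateGrowth_superPhase 𝓑)
  have h2 := smulLeftCLM_apply_apply (F := ℂ) (hasTemperateGrowth_conj_superPhase 𝓑)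
  simp only [superWeyl, superWeylInv, smul_apply, ContinuousLinearMap.comp_apply]
  rw [fourierLeft_fourierLeft (-1) 1 _ _ (by norm_num) (by norm_num), map_smul,
    fourierRight_fourierRight 1 (-1) _ _ (by norm_num) (by norm_num)]
  simp only [map_smul, smul_smul]
  rw [two_pi_pow_mul, one_smul]
  ext x
  rw [h1, compCLMOfContinuousLinearEquiv_apply, Function.comp_apply,
    compCLMOfContinuousLinearEquiv_apply, Function.comp_apply, midpointEquiv.apply_symm_apply, h2,
    smul_eq_mul, smul_eq_mul, ← mul_assoc, mul_comm (superPhase 𝓑 x), conj_superPhase_mul, one_mul]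

theorem superWeylInv_superWeyl (𝓑 : RegularMagneticField d) (Φ : 𝓢(Pos4 d, ℂ)) :
    superWeylInv 𝓑 (superWeyl 𝓑 Φ) = Φ := by
  have h1 := smulLeftCLM_apply_apply (F := ℂ) (hasTemperateGrowth_superPhase 𝓑)
  have h2 := smulLeftCLM_apply_apply (F := ℂ) (hasTemperateGrowth_conj_superPhase 𝓑)
  simp only [superWeyl, superWeylInv, smul_apply, ContinuousLinearMap.comp_apply, map_smul]
  set G := fourierRight (-1) (by norm_num) (fourierLeft 1 one_ne_zero Φ) with hG
  have h3 : compCLMOfContinuousLinearEquiv ℂ (midpointEquiv (d := d))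
      (smulLeftCLM ℂ (fun p => (starRingEnd ℂ) (superPhase 𝓑 p))
        (smulLeftCLM ℂ (superPhase 𝓑) (compCLMOfContinuousLinearEquiv ℂ midpointEquiv.symm G))) = G := by
    ext x
    rw [compCLMOfContinuousLinearEquiv_apply, Function.comp_apply, h2, h1,
      compCLMOfContinuousLinearEquiv_apply, Function.comp_apply, midpointEquiv.symm_apply_apply,
      smul_eq_mul, smul_eq_mul, ← mul_assoc, conj_superPhase_mul, one_mul]
  rw [h3, hG, fourierRight_fourierRight (-1) 1 _ _ (by norm_num) (by norm_num), map_smul,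
    fourierLeft_fourierLeft 1 (-1) _ _ (by norm_num) (by norm_num), smul_smul, smul_smul,
    mul_assoc, two_pi_pow_mul, one_smul]

theorem integral_mul_superWeylTranspose (𝓑 : RegularMagneticField d) (Φ F : 𝓢(Pos4 d, ℂ)) :
    ∫ x, Φ x * superWeylTranspose 𝓑 F x = ∫ x, superWeyl 𝓑 Φ x * F x := by
  have h1 := smulLeftCLM_apply_apply (F := ℂ) (hasTemperateGrowth_superPhase 𝓑)
  simp only [superWeyl, superWeylTranspose, smul_apply, ContinuousLinearMap.comp_apply, smul_eq_mul,
    mul_assoc, mul_left_comm _ (((2 * Real.pi : ℝ) ^ (2 * d) : ℂ)⁻¹) _]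
  rw [integral_const_mul, integral_const_mul]
  congr 1
  rw [← integral_fourierLeft_mul, ← integral_fourierRight_mul]
  set G := fourierRight (-1) (by norm_num) (fourierLeft 1 one_ne_zero Φ)
  have h2 := smulLeftCLM_apply_apply (F := ℂ)
    (compCLMOfContinuousLinearEquiv ℂ midpointEquiv.symm G).hasTemperateGrowth
    (smulLeftCLM ℂ (superPhase 𝓑) F)
  have h3 := integral_comp_midpointEquiv (smulLeftCLM ℂ (compCLMOfContinuousLinearEquiv ℂ
    midpointEquiv.symm G : Pos4 d → ℂ) (smulLeftCLM ℂ (superPhase 𝓑) F))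
  simp only [h2] at h3
  simp only [compCLMOfContinuousLinearEquiv_apply, Function.comp_apply,
    midpointEquiv.symm_apply_apply, h1, smul_eq_mul] at h3 ⊢
  rw [h3]
  refine integral_congr_ae (Filter.Eventually.of_forall fun x => ?_)
  simp only
  ring

theorem superWeylTransform_embed (𝓑 : RegularMagneticField d) (Φ : 𝓢(Pos4 d, ℂ)) :
    superWeylTransform 𝓑 (embed Φ) = embed (superWeyl 𝓑 Φ) := by
  ext F
  exact integral_mul_superWeylTranspose 𝓑 Φ F

/-! ### Dequantization of rank-one super operators -/

theorem superOp_embed_injective (𝓑 : RegularMagneticField d) :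
    Function.Injective (fun Φ : 𝓢(Pos4 d, ℂ) => superOp 𝓑 (embed Φ)) := by
  intro Φ Φ' h
  suffices superWeyl 𝓑 Φ = superWeyl 𝓑 Φ' by
    rw [← superWeylInv_superWeyl 𝓑 Φ, this, superWeylInv_superWeyl]
  refine eq_of_integral_tensor_tensor fun a b f g => ?_
  have h1 := congrFun h (rankOne f g)
  simp only [superOp, kernelSchwartz_rankOne, superWeylTransform_embed] at h1
  have h2 := congrArg (fun R : OpDist d => R b a) h1
  simpa only [int_apply, embed_apply] using h2

theorem int_embed_tensor {X Y : Type} [NormedAddCommGroup X] [NormedSpace ℝ X] [FiniteDimensional ℝ X]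
    [MeasureSpace X] [BorelSpace X] [(volume : Measure X).IsAddHaarMeasure]
    [NormedAddCommGroup Y] [NormedSpace ℝ Y] [FiniteDimensional ℝ Y]
    [MeasureSpace Y] [BorelSpace Y] [(volume : Measure Y).IsAddHaarMeasure]
    [(volume : Measure (X × Y)).IsAddHaarMeasure] (a : 𝓢(X, ℂ)) (b f : 𝓢(Y, ℂ)) :
    int (embed (tensor a b)) f = embed f b • embed a := by
  ext g
  rw [int_apply, smul_apply, embed_apply, embed_apply, embed_apply, smul_eq_mul]
  refine Eq.trans ?_ ((integral_prod_mul (μ := (volume : Measure X)) (ν := (volume : Measure Y))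
    (fun x => a x * g x) (fun y => f y * b y)).trans (mul_comm _ _))
  refine integral_congr_ae (Filter.Eventually.of_forall fun z => ?_)
  simp only [tensor_apply]
  ring

/-- Rank-one super operators have Schwartz symbols, given by the inverse of the super Weyl transform. -/
theorem superOp_embed_superWeylInv (𝓑 : RegularMagneticField d) (f h f' h' : 𝓢(Pos d, ℂ)) :
    superOp 𝓑 (embed (superWeylInv 𝓑 (tensor (tensor f h) (tensor f' h')))) =
      bowtieSuper (rankOne f h) (rankOne f' h') := by
  funext S
  have h2 : incl (bracket (incl S) (rankOne f' h') • rankOne f h) =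
      bracket (incl S) (rankOne f' h') • incl (rankOne f h) := by
    ext φ g
    simp [incl]
  rw [superOp, superWeylTransform_embed, superWeyl_superWeylInv, bowtieSuper, bowtie, h2, incl_rankOne,
    ← int_embed_kernelSchwartz S, bracket_int_rankOne, int_embed_tensor, int_smul]

theorem superOpInv_bowtieSuper (𝓑 : RegularMagneticField d) (f h f' h' : 𝓢(Pos d, ℂ)) :
    superOpInv 𝓑 (bowtieSuper (rankOne f h) (rankOne f' h')) =
      superWeylInv 𝓑 (tensor (tensor f h) (tensor f' h')) :=
  superOp_embed_injective 𝓑 ((Function.invFun_eq (f := fun Φ : 𝓢(Pos4 d, ℂ) => superOp 𝓑 (embed Φ))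
    ⟨_, superOp_embed_superWeylInv 𝓑 f h f' h'⟩).trans
      (superOp_embed_superWeylInv 𝓑 f h f' h').symm)

theorem bracket_superOp (𝓑 : RegularMagneticField d) (Φ : Dist (Pos4 d)) (f h f' h' : 𝓢(Pos d, ℂ)) :
    bracket (superOp 𝓑 Φ (rankOne f' h')) (rankOne f h) =
      Φ (superWeylTranspose 𝓑 (tensor (tensor f h) (tensor f' h'))) := by
  rw [superOp, bracket_int_rankOne, kernelSchwartz_rankOne, int_apply]
  rfl

/-! ### The magnetic Wigner transform -/

/-- The magnetic cross-Wigner transform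
`(u, ξ) ↦ ∫ e^{iξ·v} e^{iφ(u + v/2, u - v/2)} conj f(u + v/2) g(u - v/2) dv`. -/
def wigner (𝓑 : RegularMagneticField d) (f g : Pos d → ℂ) (p : Pos2 d) : ℂ :=
  ∫ v : Pos d, Complex.exp (Complex.I * ((inner ℝ p.2 v : ℝ) : ℂ)) *
    (Complex.exp (Complex.I *
        (𝓑.circulation (p.1 + (1 / 2 : ℝ) • v) (p.1 - (1 / 2 : ℝ) • v) : ℂ)) *
      ((starRingEnd ℂ) (f (p.1 + (1 / 2 : ℝ) • v)) * g (p.1 - (1 / 2 : ℝ) • v)))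

theorem conj_expI (t : ℝ) : (starRingEnd ℂ) (Complex.exp (Complex.I * (t : ℂ))) =
    Complex.exp (-Complex.I * (t : ℂ)) := by
  rw [← Complex.exp_conj, map_mul, Complex.conj_I, Complex.conj_ofReal]

theorem superPhase_eq (𝓑 : RegularMagneticField d) (xL xR yL yR : Pos d) :
    superPhase 𝓑 ((xL, xR), (yL, yR)) = Complex.exp (Complex.I * (𝓑.circulation xL yL : ℂ)) *
      Complex.exp (-Complex.I * (𝓑.circulation xR yR : ℂ)) := by
  rw [superPhase, ← Complex.exp_add]
  congr 1
  push_cast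
  ring

theorem superWeylTranspose_tensor (𝓑 : RegularMagneticField d) (f f' g g' : 𝓢(Pos d, ℂ))
    (X : Pos4 d) :
    superWeylTranspose 𝓑 (tensor (tensor (conjSchwartz f) f') (tensor g (conjSchwartz g'))) X =
      ((2 * Real.pi : ℝ) ^ (2 * d) : ℂ)⁻¹ *
        (wigner 𝓑 f g X.1 * (starRingEnd ℂ) (wigner 𝓑 f' g' X.2)) := by
  obtain ⟨⟨uL, ξL⟩, ⟨uR, ξR⟩⟩ := X
  rw [superWeylTranspose_apply]
  congr 1
  simp only [wigner, ← integral_conj, ← integral_mul_const]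
  simp only [← integral_const_mul]
  refine integral_congr_ae (Filter.Eventually.of_forall fun vL => ?_)
  refine integral_congr_ae (Filter.Eventually.of_forall fun vR => ?_)
  simp only [superPhase_eq, tensor_apply, conjSchwartz_apply, map_mul, conj_expI, Complex.conj_conj]
  ring

theorem superWeylInv_apply (𝓑 : RegularMagneticField d) (F : 𝓢(Pos4 d, ℂ)) (uL ξL uR ξR : Pos d) :
    superWeylInv 𝓑 F ((uL, ξL), (uR, ξR)) =
      ∫ vL : Pos d, Complex.exp (-Complex.I * ((inner ℝ ξL vL : ℝ) : ℂ)) *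
        ∫ vR : Pos d, Complex.exp (Complex.I * ((inner ℝ ξR vR : ℝ) : ℂ)) *
          ((starRingEnd ℂ) (superPhase 𝓑 ((uL + (1 / 2 : ℝ) • vL, uR + (1 / 2 : ℝ) • vR),
              (uL - (1 / 2 : ℝ) • vL, uR - (1 / 2 : ℝ) • vR))) *
            F ((uL + (1 / 2 : ℝ) • vL, uR + (1 / 2 : ℝ) • vR),
              (uL - (1 / 2 : ℝ) • vL, uR - (1 / 2 : ℝ) • vR))) := by
  have h := smulLeftCLM_apply_apply (F := ℂ) (hasTemperateGrowth_conj_superPhase 𝓑) F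
  simp only [superWeylInv, fourierLeft, fourierRight, swapCLM]
  have ha (a b c e : Pos d) : assocEquiv d ((a, b), (c, e)) = (((a, b), c), e) := rfl
  have ha' (a b c e : Pos d) : (assocEquiv d).symm (((a, b), c), e) = ((a, b), (c, e)) := rfl
  have hc (a b : Pos2 d) : ContinuousLinearEquiv.prodComm ℝ (Pos2 d) (Pos2 d) (a, b) = (b, a) := rfl
  have hm (a b c e : Pos d) : midpointEquiv ((a, b), (c, e)) =
      ((a + (1 / 2 : ℝ) • b, c + (1 / 2 : ℝ) • e), (a - (1 / 2 : ℝ) • b, c - (1 / 2 : ℝ) • e)) := rfl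
  simp only [ContinuousLinearMap.comp_apply, compCLMOfContinuousLinearEquiv_apply,
    Function.comp_apply, partialFourier_apply, ha, ha', hc, hm, h, smul_eq_mul, one_mul, neg_mul,
    Complex.ofReal_neg, mul_neg]

theorem superWeylInv_tensor (𝓑 : RegularMagneticField d) (f f' g g' : 𝓢(Pos d, ℂ)) (X : Pos4 d) :
    superWeylInv 𝓑 (tensor (tensor f (conjSchwartz f')) (tensor (conjSchwartz g) g')) X =
      (starRingEnd ℂ) (wigner 𝓑 f g X.1) * wigner 𝓑 f' g' X.2 := by
  obtain ⟨⟨uL, ξL⟩, ⟨uR, ξR⟩⟩ := X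
  rw [superWeylInv_apply]
  simp only [wigner, ← integral_conj, ← integral_mul_const]
  simp only [← integral_const_mul]
  refine integral_congr_ae (Filter.Eventually.of_forall fun vL => ?_)
  refine integral_congr_ae (Filter.Eventually.of_forall fun vR => ?_)
  simp only [superPhase_eq, tensor_apply, conjSchwartz_apply, map_mul, Complex.conj_conj,
    ← Complex.exp_conj, map_neg, Complex.conj_I, Complex.conj_ofReal, neg_neg]
  ring

/-- The product `w_L conj w_R` of the magnetic Wigner transforms of the frame vectors of `i` and `j`. -/
def framePacket (𝓑 : RegularMagneticField d) (w : Window d) (i j : SuperIdx d) (X : Pos4 d) : ℂ :=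
  wigner 𝓑 (frameFun 𝓑 w i.1) (frameFun 𝓑 w j.1) X.1 *
    (starRingEnd ℂ) (wigner 𝓑 (frameFun 𝓑 w i.2) (frameFun 𝓑 w j.2) X.2)

theorem matrixEntry_superOp_ofFun (𝓑 : RegularMagneticField d) (w : Window d) {Φ : Pos4 d → ℂ}
    (hΦ : Φ.HasTemperateGrowth) (i j : SuperIdx d) :
    matrixEntry 𝓑 w (superOp 𝓑 (ofFun Φ)) i j =
      ((2 * Real.pi : ℝ) ^ (2 * d) : ℂ)⁻¹ * ∫ X, Φ X * framePacket 𝓑 w i j X := by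
  rw [matrixEntry, frameOp, frameOpConj, bracket_superOp, ofFun_apply hΦ, ← integral_const_mul]
  refine integral_congr_ae (Filter.Eventually.of_forall fun X => ?_)
  simp only
  rw [superWeylTranspose_tensor, mul_left_comm]
  rfl

theorem superOpInv_frame_apply (𝓑 : RegularMagneticField d) (w : Window d) (i j : SuperIdx d)
    (X : Pos4 d) :
    superOpInv 𝓑 (bowtieSuper (frameOp 𝓑 w i) (frameOpConj 𝓑 w j)) X =
      (starRingEnd ℂ) (framePacket 𝓑 w i j X) := by
  rw [frameOp, frameOpConj, superOpInv_bowtieSuper, superWeylInv_tensor, framePacket, map_mul,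
    Complex.conj_conj]
  rfl

theorem superOp_superOpInv_frame (𝓑 : RegularMagneticField d) (w : Window d) (i j : SuperIdx d) :
    superOp 𝓑 (embed (superOpInv 𝓑 (bowtieSuper (frameOp 𝓑 w i) (frameOpConj 𝓑 w j)))) =
      bowtieSuper (frameOp 𝓑 w i) (frameOpConj 𝓑 w j) := by
  rw [frameOp, frameOpConj, superOpInv_bowtieSuper, superOp_embed_superWeylInv]

end

/-! ### The gradient of the circulation -/

section

variable {E F : Type} [NormedAddCommGroup E] [NormedSpace ℝ E] [FiniteDimensional ℝ E]
  [NormedAddCommGroup F] [NormedSpace ℝ F] [CompleteSpace F]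

theorem fderiv_paramIntegral_apply (h : ℝ × E → F) (hh : ContDiff ℝ ∞ h) (x v : E) :
    fderiv ℝ (fun x => ∫ t in (0 : ℝ)..1, h (t, x)) x v =
      ∫ t in (0 : ℝ)..1, fderiv ℝ (fun x => h (t, x)) x v := by
  have hc : Continuous (fun p : ℝ × E => (fderiv ℝ h p).comp (ContinuousLinearMap.inr ℝ ℝ E)) :=
    ((ContinuousLinearMap.compL ℝ E (ℝ × E) F).flip
      (ContinuousLinearMap.inr ℝ ℝ E)).continuous.comp (hh.continuous_fderiv (by simp))
  rw [(hasFDerivAt_paramIntegral h hh x).fderiv, ContinuousLinearMap.intervalIntegral_apply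
    (Continuous.intervalIntegrable (hc.comp' (by fun_prop : Continuous fun t : ℝ => (t, x))) _ _)]
  refine intervalIntegral.integral_congr fun t _ => ?_
  have h1 : HasFDerivAt (fun x => h (t, x))
      ((fderiv ℝ h (t, x)).comp (ContinuousLinearMap.inr ℝ ℝ E)) x :=
    HasFDerivAt.comp (f := fun x => (t, x)) x (hh.differentiable (by simp) (t, x)).hasFDerivAt
      (hasFDerivAt_prodMk_right t x)
  simp only [h1.fderiv]

end

theorem intervalIntegrable_sum {ι : Type} [Fintype ι] {f : ι → ℝ → ℝ} {a b : ℝ}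
    (h : ∀ i, IntervalIntegrable (f i) volume a b) :
    IntervalIntegrable (fun t => ∑ i, f i t) volume a b := by
  rw [← Finset.sum_fn]
  exact IntervalIntegrable.sum _ fun i _ => h i

variable {d : ℕ}

theorem sum_coord_smul (v : Pos d) : ∑ j, v j • EuclideanSpace.single j (1 : ℝ) = v := by
  ext i
  simp [Finset.sum_apply, Pi.single_apply]

namespace RegularMagneticField

variable (𝓑 : RegularMagneticField d)

/-- The potential in the transversal gauge centred at `c`, `∑_j ∫₀¹ s (x - c)_j B_{jk}(c + s (x - c)) ds`. -/
def gaugedPotential (c x : Pos d) (k : Fin d) : ℝ :=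
  ∑ j, ∫ s in (0 : ℝ)..1, s * (x j - c j) * 𝓑.B j k (c + s • (x - c))

theorem hasFDerivAt_B_smul (j k : Fin d) (s : ℝ) (x : Pos d) :
    HasFDerivAt (fun x => s * x j * 𝓑.B j k (s • x))
      ((s * x j) • (s • fderiv ℝ (𝓑.B j k) (s • x)) +
        𝓑.B j k (s • x) • (s • (EuclideanSpace.proj (𝕜 := ℝ) j : Pos d →L[ℝ] ℝ))) x := by
  have h1 : HasFDerivAt (fun x : Pos d => s * x j)
      (s • (EuclideanSpace.proj (𝕜 := ℝ) j : Pos d →L[ℝ] ℝ)) x :=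
    (s • (EuclideanSpace.proj (𝕜 := ℝ) j : Pos d →L[ℝ] ℝ)).hasFDerivAt
  have h2 : HasFDerivAt (fun x : Pos d => 𝓑.B j k (s • x)) (s • fderiv ℝ (𝓑.B j k) (s • x)) x := by
    have := (((𝓑.smooth j k).differentiable (by simp)) (s • x)).hasFDerivAt.comp x
      ((hasFDerivAt_id x).const_smul s)
    refine this.congr_fderiv ?_
    ext v
    simp
  exact h1.fun_mul h2

theorem fderiv_potential (k : Fin d) (x v : Pos d) :
    fderiv ℝ (𝓑.potential k) x v = ∑ j, ∫ s in (0 : ℝ)..1,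
      (s * x j * (s * fderiv ℝ (𝓑.B j k) (s • x) v) + 𝓑.B j k (s • x) * (s * v j)) := by
  have hs (j : Fin d) : ContDiff ℝ ∞ (fun p : ℝ × Pos d => p.1 * p.2 j * 𝓑.B j k (p.1 • p.2)) :=
    (contDiff_fst.mul ((EuclideanSpace.proj (𝕜 := ℝ) j : Pos d →L[ℝ] ℝ).contDiff.comp contDiff_snd)).mul
      ((𝓑.smooth j k).comp (contDiff_fst.smul contDiff_snd))
  have hd (j : Fin d) := (hasFDerivAt_paramIntegral _ (hs j) x).differentiableAt
  have e : 𝓑.potential k = fun x => ∑ j, ∫ s in (0 : ℝ)..1, s * x j * 𝓑.B j k (s • x) := rfl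
  rw [e, fderiv_fun_sum fun j _ => hd j, sum_apply]
  refine Finset.sum_congr rfl fun j _ => ?_
  refine (fderiv_paramIntegral_apply _ (hs j) x v).trans ?_
  refine intervalIntegral.integral_congr fun s _ => ?_
  simp only [(𝓑.hasFDerivAt_B_smul j k s x).fderiv]
  simp

theorem continuous_fderiv_B (j k : Fin d) : Continuous (fderiv ℝ (𝓑.B j k)) :=
  (𝓑.smooth j k).continuous_fderiv (by simp)

/-- The exterior derivative of the potential is the magnetic field. -/
theorem fderiv_potential_sub (k l : Fin d) (x : Pos d) :
    fderiv ℝ (𝓑.potential k) x (EuclideanSpace.single l 1) -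
      fderiv ℝ (𝓑.potential l) x (EuclideanSpace.single k 1) = 𝓑.B l k x := by
  have hcB (j k : Fin d) : Continuous fun s : ℝ => 𝓑.B j k (s • x) :=
    (𝓑.smooth j k).continuous.comp (by fun_prop)
  have hcD (j k : Fin d) (v : Pos d) : Continuous fun s : ℝ => fderiv ℝ (𝓑.B j k) (s • x) v :=
    ((𝓑.continuous_fderiv_B j k).comp (by fun_prop : Continuous fun s : ℝ => s • x)).clm_apply
      continuous_const
  have hint (k : Fin d) (v : Pos d) (j : Fin d) : IntervalIntegrable (fun s : ℝ =>
      (s * x j * (s * fderiv ℝ (𝓑.B j k) (s • x) v) + 𝓑.B j k (s • x) * (s * v j)))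
      volume 0 1 := by
    refine Continuous.intervalIntegrable ?_ _ _
    exact ((continuous_id.mul continuous_const).mul (continuous_id.mul (hcD j k v))).add
      ((hcB j k).mul (continuous_id.mul continuous_const))
  rw [fderiv_potential, fderiv_potential, ← intervalIntegral.integral_finsetSum fun j _ => hint k _ j,
    ← intervalIntegral.integral_finsetSum fun j _ => hint l _ j,
    ← intervalIntegral.integral_sub]
  · have hd (s : ℝ) : HasDerivAt (fun s : ℝ => s ^ 2 * 𝓑.B l k (s • x))
        (2 * s * 𝓑.B l k (s • x) + s ^ 2 * fderiv ℝ (𝓑.B l k) (s • x) x) s := by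
      have h1 : HasDerivAt (fun s : ℝ => 𝓑.B l k (s • x)) (fderiv ℝ (𝓑.B l k) (s • x) x) s := by
        have h0 : HasDerivAt (fun s : ℝ => s • x) x s := by
          simpa using (hasDerivAt_id s).smul_const x
        exact (((𝓑.smooth l k).differentiable (by simp)) (s • x)).hasFDerivAt.comp_hasDerivAt s h0
      simpa using (hasDerivAt_pow 2 s).fun_mul h1
    have hftc := intervalIntegral.integral_eq_sub_of_hasDerivAt (a := 0) (b := 1) (fun s _ => hd s)
      (Continuous.intervalIntegrable (((continuous_const.mul continuous_id).mul (hcB l k)).add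
        ((continuous_id.pow 2).mul (hcD l k x))) _ _)
    have h1 : 𝓑.B l k x = (1 : ℝ) ^ 2 * 𝓑.B l k ((1 : ℝ) • x) - (0 : ℝ) ^ 2 * 𝓑.B l k ((0 : ℝ) • x) := by
      simp
    rw [h1, ← hftc]
    refine intervalIntegral.integral_congr fun s _ => ?_
    simp only [Finset.sum_add_distrib]
    have e1 (k l : Fin d) : ∑ j, 𝓑.B j k (s • x) * (s * (EuclideanSpace.single l (1 : ℝ) : Pos d) j) =
        s * 𝓑.B l k (s • x) := by
      simp [mul_comm]
    have e2 : fderiv ℝ (𝓑.B l k) (s • x) x =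
        ∑ j, x j * fderiv ℝ (𝓑.B l k) (s • x) (EuclideanSpace.single j 1) := by
      conv_lhs => rw [← sum_coord_smul x, map_sum]
      simp only [map_smul, smul_eq_mul, sum_coord_smul]
    have e3 (j : Fin d) : fderiv ℝ (𝓑.B j k) (s • x) (EuclideanSpace.single l 1) -
        fderiv ℝ (𝓑.B j l) (s • x) (EuclideanSpace.single k 1) =
        fderiv ℝ (𝓑.B l k) (s • x) (EuclideanSpace.single j 1) := by
      have hc := 𝓑.closed l j k (s • x)
      have hanti (a b : Fin d) : fderiv ℝ (𝓑.B a b) (s • x) = -fderiv ℝ (𝓑.B b a) (s • x) := by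
        have : 𝓑.B a b = fun x => -𝓑.B b a x := funext fun x => 𝓑.antisymm a b x
        rw [this, fderiv_fun_neg]
      rw [hanti k l, hanti l j] at hc
      simp only [neg_apply] at hc
      linarith
    rw [e1, e1, e2, 𝓑.antisymm k l, Finset.mul_sum]
    have e4 : ∑ j, s * x j * (s * fderiv ℝ (𝓑.B j k) (s • x) (EuclideanSpace.single l 1)) -
        ∑ j, s * x j * (s * fderiv ℝ (𝓑.B j l) (s • x) (EuclideanSpace.single k 1)) =
        ∑ j, s ^ 2 * (x j * fderiv ℝ (𝓑.B l k) (s • x) (EuclideanSpace.single j 1)) := by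
      rw [← Finset.sum_sub_distrib]
      refine Finset.sum_congr rfl fun j _ => ?_
      rw [← e3]
      ring
    rw [← e4]
    ring
  · exact intervalIntegrable_sum fun j => hint k _ j
  · exact intervalIntegrable_sum fun j => hint l _ j

theorem differentiable_potential (k : Fin d) : Differentiable ℝ (𝓑.potential k) :=
  (𝓑.hasTemperateGrowth_potential k).1.differentiable (by simp)

theorem continuous_fderiv_potential (k : Fin d) : Continuous (fderiv ℝ (𝓑.potential k)) :=
  (𝓑.hasTemperateGrowth_potential k).1.continuous_fderiv (by simp)

/-- The gradient of the circulation in the end point is the difference between the potential and the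
potential in the transversal gauge centred at the starting point. -/
theorem fderiv_circulation_left (x y v : Pos d) :
    fderiv ℝ (fun x => 𝓑.circulation x y) x v =
      ∑ l, (𝓑.potential l x - 𝓑.gaugedPotential y x l) * v l := by
  have hs : ContDiff ℝ ∞ (fun p : ℝ × Pos d =>
      ∑ k, 𝓑.potential k (y + p.1 • (p.2 - y)) * (p.2 k - y k)) := by
    refine ContDiff.sum fun k _ => ContDiff.mul ?_ ?_
    · exact (𝓑.hasTemperateGrowth_potential k).1.comp
        (contDiff_const.add (contDiff_fst.smul (contDiff_snd.sub contDiff_const)))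
    · exact ((EuclideanSpace.proj (𝕜 := ℝ) k : Pos d →L[ℝ] ℝ).contDiff.comp contDiff_snd).sub
        contDiff_const
  have hw : ∀ t : ℝ, Continuous fun t : ℝ => y + t • (x - y) := fun t => by fun_prop
  have hcP (k : Fin d) : Continuous fun t : ℝ => 𝓑.potential k (y + t • (x - y)) :=
    (𝓑.differentiable_potential k).continuous.comp (hw 0)
  have hcD (k : Fin d) (v : Pos d) :
      Continuous fun t : ℝ => fderiv ℝ (𝓑.potential k) (y + t • (x - y)) v :=
    ((𝓑.continuous_fderiv_potential k).comp (hw 0)).clm_apply continuous_const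
  have hcB (j k : Fin d) : Continuous fun t : ℝ => 𝓑.B j k (y + t • (x - y)) :=
    (𝓑.smooth j k).continuous.comp (hw 0)
  refine (fderiv_paramIntegral_apply _ hs x v).trans ?_
  have hderiv (t : ℝ) : fderiv ℝ (fun x => ∑ k, 𝓑.potential k (y + t • (x - y)) * (x k - y k)) x v =
      ∑ k, (t * fderiv ℝ (𝓑.potential k) (y + t • (x - y)) v * (x k - y k) +
        𝓑.potential k (y + t • (x - y)) * v k) := by
    have h1 (k : Fin d) : HasFDerivAt (fun x => 𝓑.potential k (y + t • (x - y)))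
        (t • fderiv ℝ (𝓑.potential k) (y + t • (x - y))) x := by
      have h0 : HasFDerivAt (fun x : Pos d => y + t • (x - y)) (t • ContinuousLinearMap.id ℝ (Pos d)) x :=
        (((hasFDerivAt_id x).sub_const y).const_smul t).const_add y
      refine ((𝓑.differentiable_potential k _).hasFDerivAt.comp x h0).congr_fderiv ?_
      ext v
      simp
    have h2 (k : Fin d) : HasFDerivAt (fun x : Pos d => x k - y k)
        (EuclideanSpace.proj (𝕜 := ℝ) k : Pos d →L[ℝ] ℝ) x :=
      (EuclideanSpace.proj (𝕜 := ℝ) k : Pos d →L[ℝ] ℝ).hasFDerivAt.sub_const (y k)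
    rw [(HasFDerivAt.fun_sum fun k _ => (h1 k).fun_mul (h2 k)).fderiv, sum_apply]
    refine Finset.sum_congr rfl fun k _ => ?_
    simp
    ring
  have hcoord (k : Fin d) (z w : Pos d) : fderiv ℝ (𝓑.potential k) z w =
      ∑ l, w l * fderiv ℝ (𝓑.potential k) z (EuclideanSpace.single l 1) := by
    conv_lhs => rw [← sum_coord_smul w, map_sum]
    simp only [map_smul, smul_eq_mul]
  -- exchange the indices of the derivative of the potential, at the cost of the field
  have hexch (t : ℝ) :
      ∑ k, (t * fderiv ℝ (𝓑.potential k) (y + t • (x - y)) v * (x k - y k) +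
        𝓑.potential k (y + t • (x - y)) * v k) =
      ∑ l, ((𝓑.potential l (y + t • (x - y)) +
          t * fderiv ℝ (𝓑.potential l) (y + t • (x - y)) (x - y)) * v l -
        ∑ k, t * (x k - y k) * 𝓑.B k l (y + t • (x - y)) * v l) := by
    set z := y + t • (x - y)
    have hl (k : Fin d) : t * fderiv ℝ (𝓑.potential k) z v * (x k - y k) =
        ∑ l, t * v l * (x k - y k) * (fderiv ℝ (𝓑.potential l) z (EuclideanSpace.single k 1)
          - 𝓑.B k l z) := by
      rw [hcoord k z v, Finset.mul_sum, Finset.sum_mul]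
      refine Finset.sum_congr rfl fun l _ => ?_
      rw [← 𝓑.fderiv_potential_sub l k z]
      ring
    have hr (l : Fin d) : t * fderiv ℝ (𝓑.potential l) z (x - y) * v l =
        ∑ k, t * v l * (x k - y k) * fderiv ℝ (𝓑.potential l) z (EuclideanSpace.single k 1) := by
      rw [hcoord l z (x - y), Finset.mul_sum, Finset.sum_mul]
      refine Finset.sum_congr rfl fun k _ => ?_
      simp
      ring
    simp only [add_mul, hl, hr, Finset.sum_add_distrib, Finset.sum_sub_distrib]
    rw [Finset.sum_comm, add_comm, add_sub_assoc]
    congr 1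
    simp only [← Finset.sum_sub_distrib]
    refine Finset.sum_congr rfl fun l _ => Finset.sum_congr rfl fun k _ => ?_
    ring
  have e : ∀ t ∈ Set.uIcc (0 : ℝ) 1,
      fderiv ℝ (fun x => ∑ k, 𝓑.potential k (y + t • (x - y)) * (x k - y k)) x v =
      ∑ l, ((𝓑.potential l (y + t • (x - y)) +
          t * fderiv ℝ (𝓑.potential l) (y + t • (x - y)) (x - y)) * v l -
        ∑ k, t * (x k - y k) * 𝓑.B k l (y + t • (x - y)) * v l) :=
    fun t _ => (hderiv t).trans (hexch t)
  rw [intervalIntegral.integral_congr e]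
  have hi1 (l : Fin d) : IntervalIntegrable (fun t => (𝓑.potential l (y + t • (x - y)) +
      t * fderiv ℝ (𝓑.potential l) (y + t • (x - y)) (x - y)) * v l) volume 0 1 :=
    Continuous.intervalIntegrable (((hcP l).add (continuous_id.mul (hcD l _))).mul
      continuous_const) _ _
  have hi2 (l k : Fin d) : IntervalIntegrable (fun t => t * (x k - y k) *
      𝓑.B k l (y + t • (x - y)) * v l) volume 0 1 :=
    Continuous.intervalIntegrable (((continuous_id.mul continuous_const).mul (hcB k l)).mul
      continuous_const) _ _
  rw [intervalIntegral.integral_finsetSum fun l _ =>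
    (hi1 l).sub (intervalIntegrable_sum fun k => hi2 l k)]
  refine Finset.sum_congr rfl fun l _ => ?_
  rw [intervalIntegral.integral_sub (hi1 l) (intervalIntegrable_sum fun k => hi2 l k),
    intervalIntegral.integral_finsetSum fun k _ => hi2 l k, intervalIntegral.integral_mul_const,
    sub_mul, gaugedPotential, Finset.sum_mul]
  congr 1
  · have hd (t : ℝ) : HasDerivAt (fun t : ℝ => t * 𝓑.potential l (y + t • (x - y)))
        (𝓑.potential l (y + t • (x - y)) +
          t * fderiv ℝ (𝓑.potential l) (y + t • (x - y)) (x - y)) t := by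
      have h0 : HasDerivAt (fun t : ℝ => y + t • (x - y)) (x - y) t := by
        simpa using ((hasDerivAt_id t).smul_const (x - y)).const_add y
      have h1 := (𝓑.differentiable_potential l (y + t • (x - y))).hasFDerivAt.comp_hasDerivAt t h0
      simpa using (hasDerivAt_id' t).fun_mul h1
    rw [intervalIntegral.integral_eq_sub_of_hasDerivAt (fun t _ => hd t)
      (Continuous.intervalIntegrable ((hcP l).add (continuous_id.mul (hcD l _))) _ _)]
    simp
  · exact Finset.sum_congr rfl fun k _ => intervalIntegral.integral_mul_const _ _

theorem circulation_swap (x y : Pos d) : 𝓑.circulation x y = -𝓑.circulation y x := by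
  unfold circulation
  have h := intervalIntegral.integral_comp_sub_left (a := 0) (b := 1) (fun t : ℝ =>
    ∑ k, 𝓑.potential k (y + t • (x - y)) * (x k - y k)) 1
  simp only [sub_self, sub_zero] at h
  rw [← h, ← intervalIntegral.integral_neg]
  refine intervalIntegral.integral_congr fun t _ => ?_
  simp only [← Finset.sum_neg_distrib]
  refine Finset.sum_congr rfl fun k _ => ?_
  have : y + (1 - t) • (x - y) = x + t • (y - x) := by module
  rw [this]
  ring

theorem hasFDerivAt_circulation (p : Pos2 d) :
    HasFDerivAt (fun p : Pos2 d => 𝓑.circulation p.1 p.2)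
      ((∑ k, (𝓑.potential k p.1 - 𝓑.gaugedPotential p.2 p.1 k) •
          (EuclideanSpace.proj (𝕜 := ℝ) k : Pos d →L[ℝ] ℝ) ∘L ContinuousLinearMap.fst ℝ _ _) -
        ∑ k, (𝓑.potential k p.2 - 𝓑.gaugedPotential p.1 p.2 k) •
          (EuclideanSpace.proj (𝕜 := ℝ) k : Pos d →L[ℝ] ℝ) ∘L ContinuousLinearMap.snd ℝ _ _) p := by
  obtain ⟨x, y⟩ := p
  have hd : DifferentiableAt ℝ (fun p : Pos2 d => 𝓑.circulation p.1 p.2) (x, y) :=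
    𝓑.hasTemperateGrowth_circulation.1.differentiable (by simp) _
  have h1 : HasFDerivAt (fun x => 𝓑.circulation x y) _ x :=
    HasFDerivAt.comp (g := fun p : Pos2 d => 𝓑.circulation p.1 p.2) (f := fun x => (x, y)) x
      hd.hasFDerivAt (hasFDerivAt_prodMk_left x y)
  have h2 : HasFDerivAt (fun y => 𝓑.circulation x y) _ y :=
    HasFDerivAt.comp (g := fun p : Pos2 d => 𝓑.circulation p.1 p.2) (f := fun y => (x, y)) y
      hd.hasFDerivAt (hasFDerivAt_prodMk_right x y)
  have h3 : fderiv ℝ (fun y => 𝓑.circulation x y) y = -fderiv ℝ (fun y => 𝓑.circulation y x) y := by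
    rw [← fderiv_fun_neg]
    congr 1
    exact funext fun y => 𝓑.circulation_swap x y
  refine hd.hasFDerivAt.congr_fderiv ?_
  refine ContinuousLinearMap.ext fun q => ?_
  obtain ⟨v, w⟩ := q
  have hv := 𝓑.fderiv_circulation_left x y v
  have hw := 𝓑.fderiv_circulation_left y x w
  rw [h1.fderiv] at hv
  have hw' := congrArg (fun L : Pos d →L[ℝ] ℝ => L w) h3
  simp only [h2.fderiv, neg_apply] at hw'
  rw [hw] at hw'
  have : ((v, w) : Pos2 d) = (v, 0) + (0, w) := by simp
  rw [this, map_add]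
  simp only [ContinuousLinearMap.comp_apply, ContinuousLinearMap.inl_apply,
    ContinuousLinearMap.inr_apply] at hv hw'
  rw [hv, hw', sub_apply, sum_apply, sum_apply, sub_eq_add_neg]
  simp

end RegularMagneticField

/-! ### Families of functions of uniform temperate growth -/

section UniformGrowth

variable {ι E F G : Type} [NormedAddCommGroup E] [NormedSpace ℝ E]
  [NormedAddCommGroup F] [NormedSpace ℝ F] [NormedAddCommGroup G] [NormedSpace ℝ G]

/-- The functions `f i` are smooth, and each derivative of `f i` at `x` is bounded by a power of
`ρ i (1 + ‖x‖)`, uniformly in `i`. The sizes `ρ i` are at least one. -/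
structure UniformGrowth (ρ : ι → ℝ) (f : ι → E → F) : Prop where
  one_le : ∀ i, 1 ≤ ρ i
  contDiff : ∀ i, ContDiff ℝ ∞ (f i)
  bound : ∀ n : ℕ, ∃ (k : ℕ) (C : ℝ), ∀ i x, ‖iteratedFDeriv ℝ n (f i) x‖ ≤ C * (ρ i * (1 + ‖x‖)) ^ k

namespace UniformGrowth

variable {ρ : ι → ℝ} {f g : ι → E → F}

theorem one_le_mul (h1 : ∀ i, 1 ≤ ρ i) (i : ι) (x : E) : 1 ≤ ρ i * (1 + ‖x‖) := by
  nlinarith [h1 i, norm_nonneg x, mul_nonneg (zero_le_one.trans (h1 i)) (norm_nonneg x)]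

/-- The derivatives up to order `n` have a common bound. -/
theorem exists_bound_le (hf : UniformGrowth ρ f) (n : ℕ) : ∃ (k : ℕ) (C : ℝ), 1 ≤ C ∧ ∀ m ≤ n, ∀ i x,
    ‖iteratedFDeriv ℝ m (f i) x‖ ≤ C * (ρ i * (1 + ‖x‖)) ^ k := by
  choose k C hC using hf.bound
  refine ⟨∑ m ∈ Finset.range (n + 1), k m, 1 + ∑ m ∈ Finset.range (n + 1), |C m|,
    le_add_of_nonneg_right (Finset.sum_nonneg fun m _ => abs_nonneg _), fun m hm i x => ?_⟩
  have hmem : m ∈ Finset.range (n + 1) := Finset.mem_range.2 (Nat.lt_succ_of_le hm)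
  have h1 := one_le_mul hf.one_le i x
  refine (hC m i x).trans ?_
  refine mul_le_mul ?_ ?_ (by positivity) (by positivity)
  · refine (le_abs_self _).trans ?_
    have := Finset.single_le_sum (f := fun m => |C m|) (fun m _ => abs_nonneg _) hmem
    linarith
  · exact pow_le_pow_right₀ h1 (Finset.single_le_sum (fun m _ => Nat.zero_le _) hmem)

theorem of_hasTemperateGrowth (h1 : ∀ i, 1 ≤ ρ i) {f : E → F} (hf : f.HasTemperateGrowth) :
    UniformGrowth ρ (fun _ => f) where
  one_le := h1
  contDiff _ := hf.1
  bound n := by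
    obtain ⟨k, C, hC⟩ := hf.2 n
    have h0 : 0 ≤ C := by simpa using (norm_nonneg _).trans (hC 0)
    refine ⟨k, C, fun i x => (hC x).trans ?_⟩
    gcongr
    exact le_mul_of_one_le_left (by positivity) (h1 i)

theorem clm_apply (L : F →L[ℝ] G) (hf : UniformGrowth ρ f) : UniformGrowth ρ (fun i x => L (f i x)) where
  one_le := hf.one_le
  contDiff i := L.contDiff.comp (hf.contDiff i)
  bound n := by
    obtain ⟨k, C, hC⟩ := hf.bound n
    refine ⟨k, ‖L‖ * C, fun i x => ?_⟩
    refine (L.norm_iteratedFDeriv_comp_left ((hf.contDiff i).contDiffAt)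
      (by exact_mod_cast le_top)).trans ?_
    rw [mul_assoc]
    gcongr
    exact hC i x

theorem sum {κ : Type} [Fintype κ] {f : κ → ι → E → F} (h1 : ∀ i, 1 ≤ ρ i)
    (hf : ∀ j, UniformGrowth ρ (f j)) : UniformGrowth ρ (fun i x => ∑ j, f j i x) where
  one_le := h1
  contDiff i := ContDiff.sum fun j _ => (hf j).contDiff i
  bound n := by
    choose k C hC1 hC using fun j => (hf j).exists_bound_le n
    refine ⟨∑ j, k j, ∑ j, C j, fun i x => ?_⟩
    have h := one_le_mul h1 i x
    rw [iteratedFDeriv_sum (f := fun j x => f j i x) fun j _ =>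
      ((hf j).contDiff i).of_le (by exact_mod_cast le_top), Finset.sum_apply, Finset.sum_mul]
    refine (norm_sum_le _ _).trans (Finset.sum_le_sum fun j _ => (hC j n le_rfl i x).trans ?_)
    have h2 := hC1 j
    gcongr
    exact Finset.single_le_sum (fun j _ => Nat.zero_le (k j)) (Finset.mem_univ j)

theorem sub (hf : UniformGrowth ρ f) (hg : UniformGrowth ρ g) :
    UniformGrowth ρ (fun i x => f i x - g i x) := by
  have h := UniformGrowth.sum (κ := Bool) (f := fun b => bif b then f else fun i x => -g i x) hf.one_le
    (fun b => by
      cases b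
      · exact hg.clm_apply (-ContinuousLinearMap.id ℝ F)
      · exact hf)
  simpa [sub_eq_add_neg] using h

theorem smul {a : ι → E → ℝ} (ha : UniformGrowth ρ a) (hf : UniformGrowth ρ f) :
    UniformGrowth ρ (fun i x => a i x • f i x) where
  one_le := hf.one_le
  contDiff i := (ha.contDiff i).smul (hf.contDiff i)
  bound n := by
    obtain ⟨k, C, hC1, hC⟩ := ha.exists_bound_le n
    obtain ⟨k', C', hC1', hC'⟩ := hf.exists_bound_le n
    refine ⟨k + k', 2 ^ n * (C * C'), fun i x => ?_⟩
    refine (norm_iteratedFDeriv_smul_le (ha.contDiff i) (hf.contDiff i) x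
      (by exact_mod_cast le_top)).trans ?_
    have h0 : 0 ≤ ρ i := zero_le_one.trans (hf.one_le i)
    have e : (2 ^ n : ℝ) = ∑ j ∈ Finset.range (n + 1), (n.choose j : ℝ) := by
      exact_mod_cast (Nat.sum_range_choose n).symm
    rw [e, Finset.sum_mul, Finset.sum_mul]
    refine Finset.sum_le_sum fun j hj => ?_
    have hj : j ≤ n := Nat.lt_succ_iff.1 (Finset.mem_range.1 hj)
    have a1 := hC j hj i x
    have a2 := hC' (n - j) (Nat.sub_le _ _) i x
    calc _ ≤ (n.choose j : ℝ) * (C * (ρ i * (1 + ‖x‖)) ^ k) * (C' * (ρ i * (1 + ‖x‖)) ^ k') := by gcongr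
      _ = _ := by ring

/-- Composition of a family with uniformly bounded derivatives with one map of temperate growth. -/
theorem comp_of_bounded {b : ι → F → G} (h1 : ∀ i, 1 ≤ ρ i) (hb : ∀ i, ContDiff ℝ ∞ (b i))
    (hB : ∀ n : ℕ, ∃ C : ℝ, ∀ i x, ‖iteratedFDeriv ℝ n (b i) x‖ ≤ C) {p : E → F}
    (hp : p.HasTemperateGrowth) : UniformGrowth ρ (fun i x => b i (p x)) where
  one_le := h1
  contDiff i := (hb i).comp hp.1
  bound n := by
    choose C hC using hB
    obtain ⟨k, D, hD1, hD⟩ := (of_hasTemperateGrowth (ρ := fun _ : Unit => 1)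
      (fun _ => le_rfl) hp).exists_bound_le n
    refine ⟨k * n, n.factorial * (∑ m ∈ Finset.range (n + 1), |C m|) * D ^ n, fun i x => ?_⟩
    have hx : 1 ≤ D * (1 * (1 + ‖x‖)) ^ k := by
      refine one_le_mul_of_one_le_of_one_le hD1 (one_le_pow₀ ?_)
      linarith [norm_nonneg x]
    have h := _root_.norm_iteratedFDeriv_comp_le (n := n) (C := ∑ m ∈ Finset.range (n + 1), |C m|)
      (D := D * (1 * (1 + ‖x‖)) ^ k) (hb i) hp.1 (by exact_mod_cast le_top) x
      (fun m hm => ?_) (fun m hm hmn => ?_)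
    · refine h.trans ?_
      rw [mul_pow, ← pow_mul, mul_assoc (_ * _) (D ^ n)]
      have := h1 i
      gcongr
    · refine (hC m i _).trans ((le_abs_self _).trans ?_)
      exact Finset.single_le_sum (f := fun m => |C m|) (fun m _ => abs_nonneg _)
        (Finset.mem_range.2 (Nat.lt_succ_of_le hm))
    · exact (hD m hmn () x).trans (le_self_pow₀ hx (by omega))

theorem fderiv (hf : UniformGrowth ρ f) : UniformGrowth ρ (fun i => fderiv ℝ (f i)) where
  one_le := hf.one_le
  contDiff i := (hf.contDiff i).fderiv_right (m := ∞) (by simp)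
  bound n := by
    obtain ⟨k, C, hC⟩ := hf.bound (n + 1)
    exact ⟨k, C, fun i x => norm_iteratedFDeriv_fderiv.trans_le (hC i x)⟩

theorem paramIntegral_bound [FiniteDimensional ℝ E] (n : ℕ) : ∀ (F : Type) [NormedAddCommGroup F]
    [NormedSpace ℝ F] (h : ι → ℝ × E → F), UniformGrowth ρ h →
    ∃ (k : ℕ) (C : ℝ), ∀ i x, ‖iteratedFDeriv ℝ n (fun x => ∫ t in (0 : ℝ)..1, h i (t, x)) x‖ ≤
      C * (ρ i * (1 + ‖x‖)) ^ k := by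
  induction n with
  | zero =>
    intro F _ _ h hh
    obtain ⟨k, C, hC1, hC⟩ := hh.exists_bound_le 0
    refine ⟨k, C * 2 ^ k, fun i x => ?_⟩
    have h0 : 0 ≤ ρ i := zero_le_one.trans (hh.one_le i)
    rw [norm_iteratedFDeriv_zero]
    refine (intervalIntegral.norm_integral_le_of_norm_le_const
      (C := C * 2 ^ k * (ρ i * (1 + ‖x‖)) ^ k) fun t ht => ?_).trans (by simp)
    rw [Set.uIoc_of_le zero_le_one] at ht
    have h1 := hC 0 le_rfl i (t, x)
    rw [norm_iteratedFDeriv_zero] at h1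
    refine h1.trans ?_
    rw [mul_assoc, ← mul_pow]
    have : ‖(t, x)‖ ≤ 1 + ‖x‖ := by
      rw [Prod.norm_def]
      refine max_le ?_ (by simp)
      have : ‖t‖ ≤ 1 := by rw [Real.norm_of_nonneg ht.1.le]; exact ht.2
      linarith [norm_nonneg x]
    have h3 : ρ i * (1 + ‖(t, x)‖) ≤ 2 * (ρ i * (1 + ‖x‖)) := by
      nlinarith [norm_nonneg x, mul_nonneg h0 (norm_nonneg x)]
    gcongr
  | succ n ih =>
    intro F _ _ h hh
    have hd (i : ι) : _root_.fderiv ℝ (fun x => ∫ t in (0 : ℝ)..1, h i (t, x)) = fun x => ∫ t in (0 : ℝ)..1,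
        ((fun p : ℝ × E => (_root_.fderiv ℝ (h i) p).comp (ContinuousLinearMap.inr ℝ ℝ E)) (t, x)) :=
      funext fun x => (hasFDerivAt_paramIntegral (h i) (hh.contDiff i) x).fderiv
    obtain ⟨k, C, hC⟩ := ih _ _ (hh.fderiv.clm_apply ((ContinuousLinearMap.compL ℝ E (ℝ × E) F).flip
        (ContinuousLinearMap.inr ℝ ℝ E)))
    refine ⟨k, C, fun i x => ?_⟩
    rw [← norm_iteratedFDeriv_fderiv, hd]
    exact hC i x

theorem paramIntegral [FiniteDimensional ℝ E] {h : ι → ℝ × E → F} (hh : UniformGrowth ρ h) :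
    UniformGrowth ρ (fun i x => ∫ t in (0 : ℝ)..1, h i (t, x)) where
  one_le := hh.one_le
  contDiff i := by
    refine contDiff_infty.2 fun n => ?_
    -- smoothness only concerns one member of the family, and follows by differentiation
    have (n : ℕ) : ∀ (F : Type) [NormedAddCommGroup F] [NormedSpace ℝ F] (h : ℝ × E → F),
        ContDiff ℝ ∞ h → ContDiff ℝ n (fun x => ∫ t in (0 : ℝ)..1, h (t, x)) := by
      induction n with
      | zero =>
        intro F _ _ h hh
        exact contDiff_zero.2 (continuous_iff_continuousAt.2 fun x =>
          (hasFDerivAt_paramIntegral h hh x).continuousAt)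
      | succ n ih =>
        intro F _ _ h hh
        have hd : _root_.fderiv ℝ (fun x => ∫ t in (0 : ℝ)..1, h (t, x)) = fun x => ∫ t in (0 : ℝ)..1,
            ((fun p : ℝ × E => (_root_.fderiv ℝ h p).comp (ContinuousLinearMap.inr ℝ ℝ E)) (t, x)) :=
          funext fun x => (hasFDerivAt_paramIntegral h hh x).fderiv
        rw [Nat.cast_succ, contDiff_succ_iff_fderiv]
        refine ⟨fun x => (hasFDerivAt_paramIntegral h hh x).differentiableAt, by simp, ?_⟩
        rw [hd]
        exact ih _ _ (((ContinuousLinearMap.compL ℝ E (ℝ × E) F).flip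
          (ContinuousLinearMap.inr ℝ ℝ E)).contDiff.comp (hh.fderiv_right (m := ∞) (by simp)))
    exact this n F (h i) (hh.contDiff i)
  bound n := paramIntegral_bound n F h hh

/-- Freezing the first of two variables, whose size then enters the bounds. -/
theorem freeze {K : Type} [NormedAddCommGroup K] [NormedSpace ℝ K] {f : ι → K × E → F}
    (hf : UniformGrowth ρ f) :
    UniformGrowth (fun p : ι × K => ρ p.1 * (1 + ‖p.2‖)) (fun p x => f p.1 (p.2, x)) where
  one_le p := one_le_mul hf.one_le p.1 p.2
  contDiff p := (hf.contDiff p.1).comp (contDiff_const.prodMk contDiff_id)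
  bound n := by
    obtain ⟨k, C, hC1, hC⟩ := hf.exists_bound_le n
    refine ⟨k, C, fun p x => ?_⟩
    have h0 : 0 ≤ ρ p.1 := zero_le_one.trans (hf.one_le _)
    have e : (fun x => f p.1 (p.2, x)) =
        (fun z => f p.1 ((p.2, 0) + z)) ∘ (ContinuousLinearMap.inr ℝ K E) := by
      funext x
      simp
    have hs : ContDiff ℝ ∞ (fun z => f p.1 ((p.2, 0) + z)) :=
      (hf.contDiff p.1).comp (contDiff_const.add contDiff_id)
    rw [e, ContinuousLinearMap.iteratedFDeriv_comp_right _ hs x (by exact_mod_cast le_top)]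
    refine (ContinuousMultilinearMap.norm_compContinuousLinearMap_le _ _).trans ?_
    refine (mul_le_of_le_one_right (norm_nonneg _) (Finset.prod_le_one (fun _ _ => norm_nonneg _)
      (fun _ _ => ContinuousLinearMap.norm_inr_le_one ℝ K E))).trans ?_
    rw [iteratedFDeriv_comp_add_left]
    refine (hC n le_rfl p.1 _).trans ?_
    have : (p.2, (0 : E)) + ContinuousLinearMap.inr ℝ K E x = (p.2, x) := by simp
    rw [this, mul_assoc (ρ p.1)]
    have h3 : 1 + ‖(p.2, x)‖ ≤ (1 + ‖p.2‖) * (1 + ‖x‖) := by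
      rw [Prod.norm_def]
      rcases max_cases ‖p.2‖ ‖x‖ with h | h <;> simp only [h.1] <;>
        nlinarith [norm_nonneg p.2, norm_nonneg x, mul_nonneg (norm_nonneg p.2) (norm_nonneg x)]
    gcongr

/-- If the gradients of real phases have uniform temperate growth, so do their exponentials. -/
theorem expI {θ : ι → E → ℝ} (hs : ∀ i, ContDiff ℝ ∞ (θ i))
    (hθ : UniformGrowth ρ (fun i => _root_.fderiv ℝ (θ i))) :
    UniformGrowth ρ (fun i x => Complex.exp (Complex.I * (θ i x : ℂ))) where
  one_le := hθ.one_le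
  contDiff i := hasTemperateGrowth_expI.1.comp (hs i)
  bound n := by
    have hsm (i : ι) : ContDiff ℝ ∞ (fun x => Complex.exp (Complex.I * (θ i x : ℂ))) :=
      hasTemperateGrowth_expI.1.comp (hs i)
    have hG := hθ.clm_apply ((Complex.I • ContinuousLinearMap.compL ℝ E ℝ ℂ Complex.ofRealCLM :
      (E →L[ℝ] ℝ) →L[ℝ] (E →L[ℝ] ℂ)))
    have hd (i : ι) : _root_.fderiv ℝ (fun x => Complex.exp (Complex.I * (θ i x : ℂ))) =
        fun x => Complex.exp (Complex.I * (θ i x : ℂ)) •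
          (Complex.I • ContinuousLinearMap.compL ℝ E ℝ ℂ Complex.ofRealCLM :
            (E →L[ℝ] ℝ) →L[ℝ] (E →L[ℝ] ℂ)) (_root_.fderiv ℝ (θ i) x) := by
      funext x
      have h1 : HasFDerivAt (θ i) (_root_.fderiv ℝ (θ i) x) x :=
        ((hs i).differentiable (by simp) x).hasFDerivAt
      have h2 := ((Complex.ofRealCLM.hasFDerivAt.comp x h1).const_mul Complex.I).cexp
      exact h2.fderiv
    induction n using Nat.strong_induction_on with
    | _ n ih =>
      rcases n with _ | n
      · refine ⟨0, 1, fun i x => ?_⟩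
        rw [norm_iteratedFDeriv_zero, norm_expI]
        simp
      · choose k C hC using fun m : Fin (n + 1) => ih m m.2
        obtain ⟨k', C', hC1', hC'⟩ := hG.exists_bound_le n
        refine ⟨(∑ m, k m) + k', ∑ m : Fin (n + 1), (n.choose m : ℝ) * (|C m| * C'), fun i x => ?_⟩
        have h1 := one_le_mul hθ.one_le i x
        rw [← norm_iteratedFDeriv_fderiv, hd]
        refine (norm_iteratedFDeriv_smul_le (hsm i) (hG.contDiff i) x
          (by exact_mod_cast le_top)).trans ?_
        rw [← Fin.sum_univ_eq_sum_range (fun m => (n.choose m : ℝ) *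
          ‖iteratedFDeriv ℝ m (fun x => Complex.exp (Complex.I * (θ i x : ℂ))) x‖ *
          ‖iteratedFDeriv ℝ (n - m) (fun x => (Complex.I • ContinuousLinearMap.compL ℝ E ℝ ℂ
            Complex.ofRealCLM : (E →L[ℝ] ℝ) →L[ℝ] (E →L[ℝ] ℂ)) (_root_.fderiv ℝ (θ i) x)) x‖) (n + 1),
          Finset.sum_mul]
        refine Finset.sum_le_sum fun m _ => ?_
        have a1 : ‖iteratedFDeriv ℝ m (fun x => Complex.exp (Complex.I * (θ i x : ℂ))) x‖ ≤
            |C m| * (ρ i * (1 + ‖x‖)) ^ (∑ m, k m) := by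
          refine (hC m i x).trans (mul_le_mul (le_abs_self _) ?_ (by positivity) (abs_nonneg _))
          exact pow_le_pow_right₀ h1 (Finset.single_le_sum (fun m _ => Nat.zero_le (k m))
            (Finset.mem_univ m))
        have a2 := hC' (n - m) (Nat.sub_le _ _) i x
        calc _ ≤ (n.choose m : ℝ) * (|C m| * (ρ i * (1 + ‖x‖)) ^ (∑ m, k m)) *
                (C' * (ρ i * (1 + ‖x‖)) ^ k') := by gcongr
          _ = _ := by ring

/-- Composition with a fixed linear map. -/
theorem comp_clm {D : Type} [NormedAddCommGroup D] [NormedSpace ℝ D] (L : D →L[ℝ] E)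
    (hf : UniformGrowth ρ f) : UniformGrowth ρ (fun i x => f i (L x)) where
  one_le := hf.one_le
  contDiff i := (hf.contDiff i).comp L.contDiff
  bound n := by
    obtain ⟨k, C, hC1, hC⟩ := hf.exists_bound_le n
    refine ⟨k, ‖L‖ ^ n * C * (1 + ‖L‖) ^ k, fun i x => ?_⟩
    have h0 : 0 ≤ ρ i := zero_le_one.trans (hf.one_le i)
    have h := L.iteratedFDeriv_comp_right (hf.contDiff i) x (i := n) (by exact_mod_cast le_top)
    change iteratedFDeriv ℝ n (fun x => f i (L x)) x = _ at h
    rw [h]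
    refine (ContinuousMultilinearMap.norm_compContinuousLinearMap_le _ _).trans ?_
    rw [Finset.prod_const, Finset.card_univ, Fintype.card_fin, mul_comm, mul_assoc, mul_assoc,
      ← mul_pow]
    gcongr
    refine (hC n le_rfl i _).trans ?_
    have h3 : ρ i * (1 + ‖L x‖) ≤ (1 + ‖L‖) * (ρ i * (1 + ‖x‖)) := by
      have := L.le_opNorm x
      have e : (1 + ‖L‖) * (ρ i * (1 + ‖x‖)) = ρ i * (1 + ‖x‖ + ‖L‖ + ‖L‖ * ‖x‖) := by ring
      rw [e]
      gcongr
      linarith [norm_nonneg x, norm_nonneg L]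
    gcongr

theorem hasTemperateGrowth (hf : UniformGrowth ρ f) (i : ι) : (f i).HasTemperateGrowth :=
  ⟨hf.contDiff i, fun n => by
    obtain ⟨k, C, hC⟩ := hf.bound n
    refine ⟨k, C * ρ i ^ k, fun x => (hC i x).trans (le_of_eq ?_)⟩
    rw [mul_pow]
    ring⟩

/-- Multiplication by a family of uniform temperate growth costs, in each Schwartz seminorm, a power of
the size which does not depend on the Schwartz function. -/
theorem exists_seminorm_smul_bound {f : ι → E → ℂ} (hf : UniformGrowth ρ f) (k n : ℕ) :
    ∃ p : ℕ, ∀ χ : 𝓢(E, ℂ), ∃ C : ℝ, ∀ i,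
      SchwartzMap.seminorm ℂ k n (smulLeftCLM ℂ (f i) χ) ≤ C * ρ i ^ p := by
  obtain ⟨p, D, hD1, hD⟩ := hf.exists_bound_le n
  refine ⟨p, fun χ => ?_⟩
  have hχ (m : ℕ) : ∃ C : ℝ, ∀ x, (1 + ‖x‖) ^ (k + p) * ‖iteratedFDeriv ℝ m χ x‖ ≤ C := by
    have h := one_add_le_sup_seminorm_apply (𝕜 := ℂ) (m := (k + p, m)) (k := k + p) (n := m)
      le_rfl le_rfl χ
    exact ⟨_, h⟩
  choose C hC using hχ
  refine ⟨∑ j ∈ Finset.range (n + 1), (n.choose j : ℝ) * (D * C (n - j)), fun i => ?_⟩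
  have h0 : 0 ≤ ρ i := zero_le_one.trans (hf.one_le i)
  have hC0 (m : ℕ) : 0 ≤ C m := (by positivity : (0 : ℝ) ≤ (1 + ‖(0 : E)‖) ^ (k + p) * ‖iteratedFDeriv ℝ m χ 0‖).trans (hC m 0)
  refine seminorm_le_bound ℂ k n _ (mul_nonneg (Finset.sum_nonneg fun j _ => mul_nonneg
    (Nat.cast_nonneg _) (mul_nonneg (zero_le_one.trans hD1) (hC0 _))) (by positivity)) fun x => ?_
  have e : (smulLeftCLM ℂ (f i) χ : E → ℂ) = fun x => f i x • χ x :=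
    smulLeftCLM_apply (hf.hasTemperateGrowth i) χ
  rw [e]
  have h1 := norm_iteratedFDeriv_smul_le (n := n) (hf.contDiff i) (χ.smooth ⊤) x
    (by exact_mod_cast le_top)
  refine (mul_le_mul_of_nonneg_left h1 (by positivity)).trans ?_
  rw [Finset.mul_sum, Finset.sum_mul]
  refine Finset.sum_le_sum fun j hj => ?_
  have hj : j ≤ n := Nat.lt_succ_iff.1 (Finset.mem_range.1 hj)
  have a1 := hD j hj i x
  have a2 := hC (n - j) x
  have a3 : ‖x‖ ^ k ≤ (1 + ‖x‖) ^ k := by gcongr; linarith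
  calc ‖x‖ ^ k * (n.choose j * ‖iteratedFDeriv ℝ j (f i) x‖ * ‖iteratedFDeriv ℝ (n - j) χ x‖)
      ≤ (1 + ‖x‖) ^ k * (n.choose j * (D * (ρ i * (1 + ‖x‖)) ^ p) * ‖iteratedFDeriv ℝ (n - j) χ x‖) := by
        gcongr
    _ = n.choose j * D * ((1 + ‖x‖) ^ (k + p) * ‖iteratedFDeriv ℝ (n - j) χ x‖) * ρ i ^ p := by
        rw [mul_pow, pow_add]
        ring
    _ ≤ n.choose j * D * C (n - j) * ρ i ^ p := by gcongr
    _ = _ := by ring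

theorem exists_continuous_seminorm_smul_bound {f : ι → E → ℂ} (hf : UniformGrowth ρ f)
    (q : Seminorm ℂ 𝓢(E, ℂ)) (hq : Continuous q) :
    ∃ p : ℕ, ∀ χ : 𝓢(E, ℂ), ∃ C : ℝ, ∀ i, q (smulLeftCLM ℂ (f i) χ) ≤ C * ρ i ^ p := by
  obtain ⟨s, D, -, hD⟩ := Seminorm.bound_of_continuous (schwartz_withSeminorms ℂ E ℂ) q hq
  choose p hp using fun m : ℕ × ℕ => hf.exists_seminorm_smul_bound m.1 m.2
  refine ⟨∑ m ∈ s, p m, fun χ => ?_⟩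
  choose C hC using fun m => hp m χ
  refine ⟨D * ∑ m ∈ s, |C m|, fun i => (hD _).trans ?_⟩
  have h0 : 0 ≤ ρ i := zero_le_one.trans (hf.one_le i)
  change (D : ℝ) * _ ≤ _
  rw [mul_assoc]
  refine mul_le_mul_of_nonneg_left ?_ D.2
  refine Seminorm.finset_sup_apply_le (by positivity) fun m hm => (hC m i).trans ?_
  refine mul_le_mul ?_ (pow_le_pow_right₀ (hf.one_le i)
    (Finset.single_le_sum (fun m _ => Nat.zero_le (p m)) hm)) (by positivity) (by positivity)
  exact (le_abs_self _).trans (Finset.single_le_sum (f := fun m => |C m|) (fun m _ => abs_nonneg _) hm)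

end UniformGrowth

end UniformGrowth

/-! ### The gauge-invariant phase of a pair of frame vectors -/

section

variable {d : ℕ}

namespace RegularMagneticField

variable (𝓑 : RegularMagneticField d)

/-- With both the centre and the argument shifted by `γ`, the gauged potential and its derivatives are
polynomially bounded, uniformly in `γ`. -/
theorem uniformGrowth_gaugedPotential {E : Type} [NormedAddCommGroup E] [NormedSpace ℝ E]
    [FiniteDimensional ℝ E] (c z : E →L[ℝ] Pos d) (k : Fin d) :
    UniformGrowth (fun _ : Pos d => (1 : ℝ))
      (fun γ q => 𝓑.gaugedPotential (γ + c q) (γ + z q) k) := by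
  have h1 : ∀ γ : Pos d, (1 : ℝ) ≤ 1 := fun _ => le_rfl
  have e : (fun γ q => 𝓑.gaugedPotential (γ + c q) (γ + z q) k) = fun (γ : Pos d) (q : E) =>
      ∑ j, ∫ s in (0 : ℝ)..1, (s * (z q - c q) j) • 𝓑.B j k (γ + (c q + s • (z q - c q))) := by
    funext γ q
    simp only [gaugedPotential, smul_eq_mul, add_sub_add_left_eq_sub, add_assoc]
    simp
  rw [e]
  refine UniformGrowth.sum h1 fun j => ?_
  have hf : (fun p : ℝ × E => p.1).HasTemperateGrowth :=
    (ContinuousLinearMap.fst ℝ ℝ E).hasTemperateGrowth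
  have hc : (fun p : ℝ × E => c p.2).HasTemperateGrowth :=
    (c ∘L ContinuousLinearMap.snd ℝ ℝ E).hasTemperateGrowth
  have hzc : (fun p : ℝ × E => z p.2 - c p.2).HasTemperateGrowth :=
    ((z - c) ∘L ContinuousLinearMap.snd ℝ ℝ E).hasTemperateGrowth
  have ha : (fun p : ℝ × E => p.1 * (z p.2 - c p.2) j).HasTemperateGrowth :=
    hf.mul ((hasTemperateGrowth_coord j).comp hzc)
  have hb : UniformGrowth (fun _ : Pos d => (1 : ℝ))
      (fun γ (p : ℝ × E) => 𝓑.B j k (γ + (c p.2 + p.1 • (z p.2 - c p.2)))) :=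
    UniformGrowth.comp_of_bounded (b := fun γ x => 𝓑.B j k (γ + x))
      (p := fun p : ℝ × E => c p.2 + p.1 • (z p.2 - c p.2)) h1
      (fun γ => (𝓑.smooth j k).comp (contDiff_const.add contDiff_id))
      (fun n => by
        obtain ⟨C, hC⟩ := 𝓑.bounded j k n
        refine ⟨C, fun γ x => ?_⟩
        rw [iteratedFDeriv_comp_add_left]
        exact hC _)
      (hc.add (hf.smul hzc))
  exact ((UniformGrowth.of_hasTemperateGrowth h1 ha).smul hb).paramIntegral

/-- The phase `φ(x, y) - φ(x, α) + φ(y, γ)` at `x = α + a`, `y = γ + b`. Up to a constant it is the flux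
of the field through the quadrilateral with vertices `x, y, γ, α`. -/
def fluxPhase (α γ : Pos d) (p : Pos2 d) : ℝ :=
  𝓑.circulation (α + p.1) (γ + p.2) - 𝓑.circulation (α + p.1) α + 𝓑.circulation (γ + p.2) γ

theorem contDiff_circulation : ContDiff ℝ ∞ fun p : Pos2 d => 𝓑.circulation p.1 p.2 :=
  𝓑.hasTemperateGrowth_circulation.1

theorem contDiff_fluxPhase (α γ : Pos d) : ContDiff ℝ ∞ (𝓑.fluxPhase α γ) := by
  have h (f : Pos2 d → Pos2 d) (hf : ContDiff ℝ ∞ f) :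
      ContDiff ℝ ∞ fun p => 𝓑.circulation (f p).1 (f p).2 := 𝓑.contDiff_circulation.comp hf
  exact ((h (fun p => (α + p.1, γ + p.2)) (by fun_prop)).sub
    (h (fun p => (α + p.1, α)) (by fun_prop))).add (h (fun p => (γ + p.2, γ)) (by fun_prop))

/-- The gradient of the phase involves only gauged potentials, hence only the field. -/
theorem fderiv_fluxPhase (α γ : Pos d) (p : Pos2 d) :
    fderiv ℝ (𝓑.fluxPhase α γ) p =
      (∑ k, (𝓑.gaugedPotential α (α + p.1) k - 𝓑.gaugedPotential (γ + p.2) (α + p.1) k) •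
          (EuclideanSpace.proj (𝕜 := ℝ) k : Pos d →L[ℝ] ℝ) ∘L ContinuousLinearMap.fst ℝ _ _) -
        ∑ k, (𝓑.gaugedPotential γ (γ + p.2) k - 𝓑.gaugedPotential (α + p.1) (γ + p.2) k) •
          (EuclideanSpace.proj (𝕜 := ℝ) k : Pos d →L[ℝ] ℝ) ∘L ContinuousLinearMap.snd ℝ _ _ := by
  have f1 : HasFDerivAt (fun p : Pos2 d => (α + p.1, γ + p.2)) (ContinuousLinearMap.id ℝ (Pos2 d)) p :=
    (hasFDerivAt_id p).const_add (α, γ)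
  have f2 : HasFDerivAt (fun p : Pos2 d => (α + p.1, α))
      ((ContinuousLinearMap.fst ℝ (Pos d) (Pos d)).prod 0) p :=
    (hasFDerivAt_fst.const_add α).prodMk (hasFDerivAt_const α p)
  have f3 : HasFDerivAt (fun p : Pos2 d => (γ + p.2, γ))
      ((ContinuousLinearMap.snd ℝ (Pos d) (Pos d)).prod 0) p :=
    (hasFDerivAt_snd.const_add γ).prodMk (hasFDerivAt_const γ p)
  have h1 := HasFDerivAt.comp (g := fun p : Pos2 d => 𝓑.circulation p.1 p.2) p
    (𝓑.hasFDerivAt_circulation (α + p.1, γ + p.2)) f1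
  have h2 := HasFDerivAt.comp (g := fun p : Pos2 d => 𝓑.circulation p.1 p.2) p
    (𝓑.hasFDerivAt_circulation (α + p.1, α)) f2
  have h3 := HasFDerivAt.comp (g := fun p : Pos2 d => 𝓑.circulation p.1 p.2) p
    (𝓑.hasFDerivAt_circulation (γ + p.2, γ)) f3
  refine ((h1.sub h2).add h3).fderiv.trans ?_
  refine ContinuousLinearMap.ext fun v => ?_
  simp only [add_apply, sub_apply, sum_apply, smul_apply, ContinuousLinearMap.comp_apply,
    ContinuousLinearMap.id_apply, ContinuousLinearMap.prod_apply, ContinuousLinearMap.coe_fst',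
    ContinuousLinearMap.coe_snd', zero_apply, map_zero, smul_eq_mul, sub_mul,
    Finset.sum_sub_distrib]
  ring_nf

theorem uniformGrowth_fluxPhase :
    UniformGrowth (fun p : Pos d × Pos d => 1 * (1 + ‖p.2‖))
      (fun p q => Complex.exp (Complex.I * (𝓑.fluxPhase (p.1 + p.2) p.1 q : ℂ))) := by
  refine UniformGrowth.expI (fun p => 𝓑.contDiff_fluxPhase _ _) ?_
  -- the variables are the difference `κ = α - γ` and `(a, b)`
  let K : Pos d × Pos2 d →L[ℝ] Pos d := ContinuousLinearMap.fst ℝ _ _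
  let a : Pos d × Pos2 d →L[ℝ] Pos d :=
    ContinuousLinearMap.fst ℝ _ _ ∘L ContinuousLinearMap.snd ℝ _ _
  let b : Pos d × Pos2 d →L[ℝ] Pos d :=
    ContinuousLinearMap.snd ℝ _ _ ∘L ContinuousLinearMap.snd ℝ _ _
  let L (π : Pos2 d →L[ℝ] Pos d) (k : Fin d) : ℝ →L[ℝ] (Pos2 d →L[ℝ] ℝ) :=
    (ContinuousLinearMap.id ℝ ℝ).smulRight ((EuclideanSpace.proj (𝕜 := ℝ) k : Pos d →L[ℝ] ℝ) ∘L π)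
  have h1 : ∀ γ : Pos d, (1 : ℝ) ≤ 1 := fun _ => le_rfl
  have h := (UniformGrowth.sub
    (UniformGrowth.sum h1 fun k => ((𝓑.uniformGrowth_gaugedPotential K (K + a) k).sub
      (𝓑.uniformGrowth_gaugedPotential b (K + a) k)).clm_apply (L (ContinuousLinearMap.fst ℝ _ _) k))
    (UniformGrowth.sum h1 fun k => ((𝓑.uniformGrowth_gaugedPotential 0 b k).sub
      (𝓑.uniformGrowth_gaugedPotential (K + a) b k)).clm_apply
        (L (ContinuousLinearMap.snd ℝ _ _) k))).freeze
  convert h using 2 with p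
  funext q
  rw [fderiv_fluxPhase]
  simp [L, K, a, b, add_assoc]

end RegularMagneticField

end

/-! ### Factorization of the Wigner transforms of frame vectors -/

section

variable {d : ℕ}

variable (d) in
/-- `(u, v) ↦ (u + v/2, u - v/2)`. -/
def pairEquiv : Pos2 d ≃L[ℝ] Pos2 d :=
  LinearEquiv.toContinuousLinearEquiv
  { toFun := fun p => (p.1 + (1 / 2 : ℝ) • p.2, p.1 - (1 / 2 : ℝ) • p.2)
    invFun := fun q => ((1 / 2 : ℝ) • (q.1 + q.2), q.1 - q.2)
    map_add' := fun p q => by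
      ext <;> simp <;> ring
    map_smul' := fun c p => by
      ext <;> simp <;> ring
    left_inv := fun p => by
      ext <;> simp <;> ring
    right_inv := fun p => by
      ext <;> simp <;> ring }

theorem pairEquiv_apply (p : Pos2 d) :
    pairEquiv d p = (p.1 + (1 / 2 : ℝ) • p.2, p.1 - (1 / 2 : ℝ) • p.2) := rfl

/-- The window as a complex Schwartz function. -/
def Window.toSchwartz (w : Window d) : 𝓢(Pos d, ℂ) :=
  (w.hasCompactSupport.comp_left (g := fun t : ℝ => (t : ℂ)) Complex.ofReal_zero).toSchwartzMap
    (Complex.ofRealCLM.contDiff.comp w.smooth)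

/-- `(u, v) ↦ 𝔤(u + v/2) 𝔤(u - v/2)`. -/
def windowPair (w : Window d) : 𝓢(Pos2 d, ℂ) :=
  compCLMOfContinuousLinearEquiv ℂ (pairEquiv d) (tensor w.toSchwartz w.toSchwartz)

theorem windowPair_apply (w : Window d) (u v : Pos d) : windowPair w (u, v) =
    (w.g (u + (1 / 2 : ℝ) • v) : ℂ) * (w.g (u - (1 / 2 : ℝ) • v) : ℂ) := rfl

/-- The exponential of the gauge-invariant phase, in midpoint coordinates; the index is `(γ, α - γ)`. -/
def fluxExp (𝓑 : RegularMagneticField d) (p : Pos d × Pos d) (q : Pos2 d) : ℂ :=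
  Complex.exp (Complex.I * (𝓑.fluxPhase (p.1 + p.2) p.1 (pairEquiv d q) : ℂ))

theorem uniformGrowth_fluxExp (𝓑 : RegularMagneticField d) :
    UniformGrowth (fun p : Pos d × Pos d => 1 * (1 + ‖p.2‖)) (fluxExp 𝓑) :=
  𝓑.uniformGrowth_fluxPhase.comp_clm (pairEquiv d : Pos2 d →L[ℝ] Pos2 d)

/-- The envelope of the Wigner transform of two frame vectors: the partial Fourier transform of
`e^{i flux} 𝔤(u + v/2) 𝔤(u - v/2)`. The index is `(γ, α - γ)`. -/
def packetAmplitude (𝓑 : RegularMagneticField d) (w : Window d) (p : Pos d × Pos d) : 𝓢(Pos2 d, ℂ) :=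
  partialFourier (Pos d) (Pos d) 1 one_ne_zero (smulLeftCLM ℂ (fluxExp 𝓑 p) (windowPair w))

theorem packetAmplitude_apply (𝓑 : RegularMagneticField d) (w : Window d) (p : Pos d × Pos d)
    (u ξ : Pos d) : packetAmplitude 𝓑 w p (u, ξ) =
      ∫ v : Pos d, Complex.exp (Complex.I * ((inner ℝ ξ v : ℝ) : ℂ)) * (fluxExp 𝓑 p (u, v) *
        ((w.g (u + (1 / 2 : ℝ) • v) : ℂ) * (w.g (u - (1 / 2 : ℝ) • v) : ℂ))) := by
  rw [packetAmplitude, partialFourier_apply]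
  simp only [smulLeftCLM_apply_apply ((uniformGrowth_fluxExp 𝓑).hasTemperateGrowth p),
    windowPair_apply, one_mul, smul_eq_mul]

/-- The linear phase `(u, ξ) ↦ ξ·κ - κ'·u`. -/
def linearPhase (κ : Pos2 d) : Pos2 d →L[ℝ] ℝ :=
  innerSL ℝ κ.1 ∘L ContinuousLinearMap.snd ℝ _ _ - innerSL ℝ κ.2 ∘L ContinuousLinearMap.fst ℝ _ _

theorem linearPhase_apply (κ p : Pos2 d) :
    linearPhase κ p = inner ℝ κ.1 p.2 - inner ℝ κ.2 p.1 := rfl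

/-- The index `α̃ ∈ ℤ^{2d}` as a point of phase space. -/
def idxPoint (α : Idx d) : Pos2 d := (intVec α.1, intVec α.2)

/-- The Wigner transform of two frame vectors is concentrated at their midpoint, where it oscillates
with frequency given by their difference. -/
theorem exists_wigner_frameFun_eq (𝓑 : RegularMagneticField d) (w : Window d) (α γ : Idx d) :
    ∃ c : ℂ, ‖c‖ ≤ 1 ∧ ∀ p : Pos2 d, wigner 𝓑 (frameFun 𝓑 w α) (frameFun 𝓑 w γ) p =
      c * (Complex.exp (Complex.I * (linearPhase (idxPoint α - idxPoint γ)
          (p - (1 / 2 : ℝ) • (idxPoint α + idxPoint γ)) : ℂ)) *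
        packetAmplitude 𝓑 w (intVec γ.1, intVec α.1 - intVec γ.1)
          (p - (1 / 2 : ℝ) • (idxPoint α + idxPoint γ))) := by
  obtain ⟨α, α'⟩ := α
  obtain ⟨γ, γ'⟩ := γ
  set a := intVec α with ha
  set a' := intVec α' with ha'
  set b := intVec γ with hb
  set b' := intVec γ' with hb'
  set cd : ℝ := (2 * Real.pi) ^ (-(d : ℝ) / 2) with hcd
  have hcd0 : 0 ≤ cd := Real.rpow_nonneg (by positivity) _
  have hcd1 : cd ≤ 1 := by
    refine Real.rpow_le_one_of_one_le_of_nonpos ?_ ?_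
    · linarith [Real.pi_gt_three]
    · have : (0 : ℝ) ≤ d := Nat.cast_nonneg d
      linarith
  refine ⟨(cd : ℂ) * (cd : ℂ) *
    Complex.exp (Complex.I * ((inner ℝ ((1 / 2 : ℝ) • (a' + b')) (a - b) : ℝ) : ℂ)), ?_, fun p => ?_⟩
  · rw [norm_mul, norm_mul, norm_expI, Complex.norm_real, Real.norm_of_nonneg hcd0, mul_one]
    exact mul_le_one₀ hcd1 hcd0 hcd1
  obtain ⟨u, ξ⟩ := p
  have hp : ((u, ξ) : Pos2 d) - (1 / 2 : ℝ) • (idxPoint (α, α') + idxPoint (γ, γ')) =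
      (u - (1 / 2 : ℝ) • (a + b), ξ - (1 / 2 : ℝ) • (a' + b')) := rfl
  rw [hp, packetAmplitude_apply, wigner]
  rw [← integral_add_right_eq_self _ (a - b), ← integral_const_mul, ← integral_const_mul]
  refine integral_congr_ae (Filter.Eventually.of_forall fun v => ?_)
  simp only
  have e1 : u + (1 / 2 : ℝ) • (v + (a - b)) = a + (u - (1 / 2 : ℝ) • (a + b) + (1 / 2 : ℝ) • v) := by
    module
  have e2 : u - (1 / 2 : ℝ) • (v + (a - b)) = b + (u - (1 / 2 : ℝ) • (a + b) - (1 / 2 : ℝ) • v) := by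
    module
  rw [e1, e2]
  simp only [frameFun, ← ha, ← ha', ← hb, ← hb', ← hcd, add_sub_cancel_left, map_mul,
    Complex.conj_ofReal, conj_expI, fluxExp, pairEquiv_apply, add_sub_cancel,
    RegularMagneticField.fluxPhase]
  set x := u - (1 / 2 : ℝ) • (a + b) + (1 / 2 : ℝ) • v with hx
  set y := u - (1 / 2 : ℝ) • (a + b) - (1 / 2 : ℝ) • v with hy
  set F1 := 𝓑.circulation (a + x) (b + y)
  set F2 := 𝓑.circulation (a + x) a
  set F3 := 𝓑.circulation (b + y) b
  have key : Complex.exp (Complex.I * ((inner ℝ ξ (v + (a - b)) : ℝ) : ℂ)) *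
      (Complex.exp (Complex.I * (F1 : ℂ)) * ((Complex.exp (-Complex.I * (F2 : ℂ)) *
        Complex.exp (-Complex.I * ((inner ℝ a' x : ℝ) : ℂ))) * (Complex.exp (Complex.I * (F3 : ℂ)) *
        Complex.exp (Complex.I * ((inner ℝ b' y : ℝ) : ℂ))))) =
      Complex.exp (Complex.I * ((inner ℝ ((1 / 2 : ℝ) • (a' + b')) (a - b) : ℝ) : ℂ)) *
      (Complex.exp (Complex.I * (linearPhase (idxPoint (α, α') - idxPoint (γ, γ'))
          (u - (1 / 2 : ℝ) • (a + b), ξ - (1 / 2 : ℝ) • (a' + b')) : ℂ)) *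
        (Complex.exp (Complex.I * ((inner ℝ (ξ - (1 / 2 : ℝ) • (a' + b')) v : ℝ) : ℂ)) *
          Complex.exp (Complex.I * ((F1 - F2 + F3 : ℝ) : ℂ)))) := by
    simp only [← Complex.exp_add]
    congr 1
    have hl : linearPhase (idxPoint (α, α') - idxPoint (γ, γ'))
          (u - (1 / 2 : ℝ) • (a + b), ξ - (1 / 2 : ℝ) • (a' + b')) =
        inner ℝ (a - b) (ξ - (1 / 2 : ℝ) • (a' + b')) - inner ℝ (a' - b') (u - (1 / 2 : ℝ) • (a + b)) := rfl
    have hr : inner ℝ ξ (v + (a - b)) + F1 + (-F2 - inner ℝ a' x) + (F3 + inner ℝ b' y) =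
        inner ℝ ((1 / 2 : ℝ) • (a' + b')) (a - b) +
        (inner ℝ (a - b) (ξ - (1 / 2 : ℝ) • (a' + b')) -
          inner ℝ (a' - b') (u - (1 / 2 : ℝ) • (a + b))) +
        inner ℝ (ξ - (1 / 2 : ℝ) • (a' + b')) v + (F1 - F2 + F3) := by
      rw [hx, hy]
      simp only [inner_add_left, inner_add_right, inner_sub_left, inner_sub_right, inner_smul_left,
        inner_smul_right, conj_trivial]
      rw [real_inner_comm a ξ, real_inner_comm b ξ, real_inner_comm a a', real_inner_comm a b',
        real_inner_comm b a', real_inner_comm b b']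
      ring
    rw [hl]
    have hr' := congrArg (fun t : ℝ => Complex.I * (t : ℂ)) hr
    push_cast at hr' ⊢
    linear_combination hr'
  linear_combination (cd : ℂ) * cd * (w.g x : ℂ) * (w.g y : ℂ) * key

end

/-! ### Bounds for the packet amplitudes -/

section

variable {d : ℕ}

/-- `(u, v) ↦ i v·e`, the factor that differentiating a partial Fourier integral in the dual direction
`e` produces. -/
def dualFactor (e : Pos d) (p : Pos2 d) : ℂ := Complex.I * ((inner ℝ p.2 e : ℝ) : ℂ)

theorem hasTemperateGrowth_dualFactor (e : Pos d) : (dualFactor e).HasTemperateGrowth := by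
  have h : dualFactor e = ⇑(Complex.I • Complex.ofRealCLM ∘L innerSL ℝ e ∘L
      ContinuousLinearMap.snd ℝ (Pos d) (Pos d)) := by
    funext p
    simp [dualFactor, real_inner_comm]
  rw [h]
  exact ContinuousLinearMap.hasTemperateGrowth _

theorem lineDerivOp_partialFourier (e : Pos d) (F : 𝓢(Pos2 d, ℂ)) :
    LineDeriv.lineDerivOp ((0, e) : Pos2 d) (partialFourier (Pos d) (Pos d) 1 one_ne_zero F) =
      partialFourier (Pos d) (Pos d) 1 one_ne_zero (smulLeftCLM ℂ (dualFactor e) F) := by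
  ext p
  rw [lineDerivOp_apply_eq_fderiv, partialFourier_apply]
  have h : fderiv ℝ (partialFourier (Pos d) (Pos d) 1 one_ne_zero F) p =
      partialFourierFun 1 (partialFourierDeriv (Pos d) (Pos d) ℂ 1 F) p :=
    (hasFDerivAt_partialFourierFun 1 F p).fderiv
  rw [h, partialFourierFun, ContinuousLinearMap.integral_apply (integrable_expI_slice _ _ _)]
  refine integral_congr_ae (Filter.Eventually.of_forall fun v => ?_)
  simp [partialFourierDeriv_apply, smulLeftCLM_apply_apply (hasTemperateGrowth_dualFactor e),
    dualFactor, phaseForm]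
  rw [show ((0 : Pos d), (0 : Pos d)) = 0 from rfl, map_zero]
  ring

/-- The exponent `P` depends on the seminorm only, not on the profile `χ`. -/
theorem exists_seminorm_amplitude_bound (𝓑 : RegularMagneticField d) (q : Seminorm ℂ 𝓢(Pos2 d, ℂ))
    (hq : Continuous q) : ∃ P : ℕ, ∀ χ : 𝓢(Pos2 d, ℂ), ∃ C : ℝ, ∀ p : Pos d × Pos d,
      q (partialFourier (Pos d) (Pos d) 1 one_ne_zero (smulLeftCLM ℂ (fluxExp 𝓑 p) χ)) ≤
        C * (1 + ‖p.2‖) ^ P := by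
  obtain ⟨P, h⟩ := (uniformGrowth_fluxExp 𝓑).exists_continuous_seminorm_smul_bound
    (q.comp (partialFourier (Pos d) (Pos d) 1 one_ne_zero).toLinearMap)
    (hq.comp (partialFourier (Pos d) (Pos d) 1 one_ne_zero).continuous)
  refine ⟨P, fun χ => ?_⟩
  obtain ⟨C, hC⟩ := h χ
  exact ⟨C, fun p => by simpa using hC p⟩

theorem iterate_lineDerivOp_packetAmplitude (𝓑 : RegularMagneticField d) (w : Window d) (e : Pos d)
    (p : Pos d × Pos d) (l : ℕ) :
    (fun f : 𝓢(Pos2 d, ℂ) => LineDeriv.lineDerivOp ((0, e) : Pos2 d) f)^[l] (packetAmplitude 𝓑 w p) =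
      partialFourier (Pos d) (Pos d) 1 one_ne_zero (smulLeftCLM ℂ (fluxExp 𝓑 p)
        ((smulLeftCLM ℂ (dualFactor e))^[l] (windowPair w))) := by
  induction l with
  | zero => rfl
  | succ l ih =>
    rw [Function.iterate_succ_apply', ih, lineDerivOp_partialFourier, Function.iterate_succ_apply']
    congr 1
    ext x
    simp only [smulLeftCLM_apply_apply ((uniformGrowth_fluxExp 𝓑).hasTemperateGrowth p),
      smulLeftCLM_apply_apply (hasTemperateGrowth_dualFactor e), smul_eq_mul]
    ring

/-- Derivatives in the dual directions do not increase the growth in the separation `p.2`. -/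
theorem exists_momentum_deriv_amplitude_bound (𝓑 : RegularMagneticField d) (w : Window d) (k : ℕ) :
    ∃ P : ℕ, ∀ (e : Pos d) (l : ℕ), ∃ C : ℝ, ∀ (p : Pos d × Pos d) (Y : Pos2 d),
      (1 + ‖Y‖) ^ k * ‖(fun f : 𝓢(Pos2 d, ℂ) => LineDeriv.lineDerivOp ((0, e) : Pos2 d) f)^[l]
        (packetAmplitude 𝓑 w p) Y‖ ≤ C * (1 + ‖p.2‖) ^ P := by
  obtain ⟨q, hqc, hq⟩ := exists_seminorm_bound k ℂ (E := Pos2 d)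
  obtain ⟨P, hP⟩ := exists_seminorm_amplitude_bound 𝓑 q hqc
  refine ⟨P, fun e l => ?_⟩
  obtain ⟨C, hC⟩ := hP ((smulLeftCLM ℂ (dualFactor e))^[l] (windowPair w))
  refine ⟨C, fun p Y => (hq _ Y).trans ?_⟩
  rw [iterate_lineDerivOp_packetAmplitude]
  exact hC p

theorem exists_iteratedFDeriv_amplitude_bound (𝓑 : RegularMagneticField d) (w : Window d) (k n : ℕ) :
    ∃ (P : ℕ) (C : ℝ), 0 ≤ C ∧ ∀ m ≤ n, ∀ (p : Pos d × Pos d) (Y : Pos2 d),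
      (1 + ‖Y‖) ^ k * ‖iteratedFDeriv ℝ m (packetAmplitude 𝓑 w p) Y‖ ≤ C * (1 + ‖p.2‖) ^ P := by
  have hq : Continuous ((Finset.Iic (k, n)).sup (schwartzSeminormFamily ℂ (Pos2 d) ℂ) :
      Seminorm ℂ 𝓢(Pos2 d, ℂ)) :=
    Seminorm.continuous_finsetSup
      (fun _ _ => (schwartz_withSeminorms ℂ (Pos2 d) ℂ).continuous_seminorm _)
  obtain ⟨P, hP⟩ := exists_seminorm_amplitude_bound 𝓑 _ hq
  obtain ⟨C, hC⟩ := hP (windowPair w)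
  refine ⟨P, 2 ^ k * max C 0, by positivity, fun m hm p Y => ?_⟩
  refine (one_add_le_sup_seminorm_apply (𝕜 := ℂ) (m := (k, n)) (le_refl k) hm
    (packetAmplitude 𝓑 w p) Y).trans ?_
  rw [mul_assoc]
  refine mul_le_mul_of_nonneg_left ?_ (by positivity)
  refine (hC p).trans ?_
  gcongr
  exact le_max_left _ _

/-- The same bound for iterated directional derivatives in an arbitrary direction; here the growth in
the separation depends on the number of derivatives. -/
theorem exists_lineDeriv_amplitude_bound (𝓑 : RegularMagneticField d) (w : Window d) (k : ℕ)
    (v : Pos2 d) (l : ℕ) :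
    ∃ (P : ℕ) (C : ℝ), ∀ (p : Pos d × Pos d) (Y : Pos2 d),
      (1 + ‖Y‖) ^ k * ‖(fun f : 𝓢(Pos2 d, ℂ) => LineDeriv.lineDerivOp v f)^[l]
        (packetAmplitude 𝓑 w p) Y‖ ≤ C * (1 + ‖p.2‖) ^ P := by
  obtain ⟨q, hqc, hq⟩ := exists_seminorm_bound k ℂ (E := Pos2 d)
  have hc : Continuous ((LineDeriv.lineDerivOpCLM ℂ 𝓢(Pos2 d, ℂ) v)^[l]) :=
    (LineDeriv.lineDerivOpCLM ℂ 𝓢(Pos2 d, ℂ) v).continuous.iterate l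
  obtain ⟨P, hP⟩ := exists_seminorm_amplitude_bound 𝓑
    (q.comp ((LineDeriv.lineDerivOpCLM ℂ 𝓢(Pos2 d, ℂ) v).toLinearMap ^ l)) (by
      refine hqc.comp ?_
      convert hc using 1
      ext1 x
      rw [Module.End.pow_apply]
      rfl)
  obtain ⟨C, hC⟩ := hP (windowPair w)
  refine ⟨P, C, fun p Y => (hq _ Y).trans (le_trans (le_of_eq ?_) (hC p))⟩
  rw [Seminorm.comp_apply, Module.End.pow_apply]
  rfl

end

/-! ### Partial derivatives and symbol classes -/

section

variable {d : ℕ}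

section DirDeriv

variable {E : Type} [NormedAddCommGroup E] [NormedSpace ℝ E]

/-- The iterated directional derivative along the vectors of a list. -/
def dirDeriv (L : List E) (Φ : E → ℂ) : E → ℂ := L.foldr (fun e f X => fderiv ℝ f X e) Φ

theorem dirDeriv_cons (e : E) (L : List E) (Φ : E → ℂ) (X : E) :
    dirDeriv (e :: L) Φ X = fderiv ℝ (dirDeriv L Φ) X e := rfl

theorem contDiff_fderiv_apply_const {f : E → ℂ} (hf : ContDiff ℝ ∞ f) (e : E) :
    ContDiff ℝ ∞ fun X => fderiv ℝ f X e :=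
  (hf.fderiv_right (m := ∞) (by simp)).clm_apply contDiff_const

theorem contDiff_dirDeriv {Φ : E → ℂ} (hΦ : ContDiff ℝ ∞ Φ) (L : List E) :
    ContDiff ℝ ∞ (dirDeriv L Φ) := by
  induction L with
  | nil => exact hΦ
  | cons e L ih => exact contDiff_fderiv_apply_const ih e

theorem fderiv_fderiv_comm {f : E → ℂ} (hf : ContDiff ℝ ∞ f) (e e' X : E) :
    fderiv ℝ (fun Y => fderiv ℝ f Y e') X e = fderiv ℝ (fun Y => fderiv ℝ f Y e) X e' := by
  have hd : Differentiable ℝ (fderiv ℝ f) :=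
    (hf.fderiv_right (m := ∞) (by simp)).differentiable (by simp)
  have h (v w : E) : fderiv ℝ (fun Y => fderiv ℝ f Y v) X w = fderiv ℝ (fderiv ℝ f) X w v := by
    rw [fderiv_clm_apply (hd X) (differentiableAt_const v)]
    simp
  rw [h, h]
  have hs : IsSymmSndFDerivAt ℝ f X :=
    (hf.contDiffAt (x := X)).isSymmSndFDerivAt (by
      rw [minSmoothness_of_isRCLikeNormedField]
      exact WithTop.coe_le_coe.2 le_top)
  exact hs e e'

/-- Iterated directional derivatives do not depend on the order of differentiation. -/
theorem dirDeriv_perm {Φ : E → ℂ} (hΦ : ContDiff ℝ ∞ Φ) {L L' : List E} (h : L.Perm L') :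
    dirDeriv L Φ = dirDeriv L' Φ := by
  induction h with
  | nil => rfl
  | cons e _ ih => funext X; rw [dirDeriv_cons, dirDeriv_cons, ih]
  | swap e e' L => funext X; exact fderiv_fderiv_comm (contDiff_dirDeriv hΦ L) e' e X
  | trans _ _ ih ih' => exact ih.trans ih'

theorem iteratedFDeriv_eq_dirDeriv {Φ : E → ℂ} (hΦ : ContDiff ℝ ∞ Φ) (n : ℕ) :
    ∀ (v : Fin n → E) (X : E), iteratedFDeriv ℝ n Φ X v = dirDeriv (List.ofFn v) Φ X := by
  induction n with
  | zero => intro v X; simp [dirDeriv]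
  | succ n ih =>
    intro v X
    rw [List.ofFn_succ, dirDeriv_cons, iteratedFDeriv_succ_apply_left]
    have hd : DifferentiableAt ℝ (iteratedFDeriv ℝ n Φ) X :=
      (hΦ.differentiable_iteratedFDeriv (m := n) (by exact_mod_cast WithTop.coe_lt_top _)) X
    have h : dirDeriv (List.ofFn fun i : Fin n => v i.succ) Φ =
        fun Y => iteratedFDeriv ℝ n Φ Y (Fin.tail v) := by
      funext Y
      exact (ih _ Y).symm
    rw [h]
    have := (ContinuousMultilinearMap.apply ℝ (fun _ : Fin n => E) ℂ (Fin.tail v)).hasFDerivAt.comp X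
      hd.hasFDerivAt
    rw [show (fun Y => iteratedFDeriv ℝ n Φ Y (Fin.tail v)) =
      (ContinuousMultilinearMap.apply ℝ (fun _ : Fin n => E) ℂ (Fin.tail v)) ∘
        iteratedFDeriv ℝ n Φ from rfl, this.fderiv]
    rfl

end DirDeriv

theorem count_flatMap_replicate {α : Type} [DecidableEq α] (l : List α) (γ : α → ℕ) (c : α) :
    Multiset.count c (l.flatMap fun i => List.replicate (γ i) i : List α) =
      (l.map fun i => if i = c then γ i else 0).sum := by
  rw [Multiset.coe_count, List.count_flatMap]
  congr 2
  funext i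
  simp [List.count_replicate]

theorem count_multiList (γ : Coord d → ℕ) (c : Coord d) : Multiset.count c (multiList γ) = γ c := by
  rw [multiList, count_flatMap_replicate, Finset.sum_map_toList, Finset.sum_ite_eq' Finset.univ c γ]
  simp

theorem partialDeriv_eq_dirDeriv {Φ : Pos4 d → ℂ} (hΦ : ContDiff ℝ ∞ Φ) (γ : Coord d → ℕ) (X : Pos4 d) :
    partialDeriv γ Φ X = dirDeriv ((multiList γ).map coordVec) Φ X := by
  rw [partialDeriv, iteratedFDeriv_eq_dirDeriv hΦ]
  congr 1
  refine List.ext_get (by simp) fun n h1 h2 => ?_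
  simp

theorem dirDeriv_map_coordVec {Φ : Pos4 d → ℂ} (hΦ : ContDiff ℝ ∞ Φ) (L : List (Coord d)) (X : Pos4 d) :
    dirDeriv (L.map coordVec) Φ X = partialDeriv (fun c => Multiset.count c L) Φ X := by
  rw [partialDeriv_eq_dirDeriv hΦ]
  refine congrFun (dirDeriv_perm hΦ (List.Perm.map _ (Multiset.coe_eq_coe.1
    (Multiset.ext.2 fun c => ?_)))) X
  rw [count_multiList]

theorem symbolSeminorm_term_nonneg {M : Pos4 d → ℝ} (hM : ∀ X, 0 < M X) (γ : Coord d → ℕ)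
    (Φ : Pos4 d → ℂ) : 0 ≤ ⨆ X, (M X)⁻¹ * ‖partialDeriv γ Φ X‖ :=
  Real.iSup_nonneg fun X => mul_nonneg (inv_nonneg.2 (hM X).le) (norm_nonneg _)

theorem symbolSeminorm_nonneg {M : Pos4 d → ℝ} (hM : ∀ X, 0 < M X) (k : ℕ) (Φ : Pos4 d → ℂ) :
    0 ≤ symbolSeminorm M k Φ :=
  Finset.sum_nonneg fun _ _ => Finset.sum_nonneg fun γ _ => symbolSeminorm_term_nonneg hM γ Φ

theorem norm_partialDeriv_le {M : Pos4 d → ℝ} (hM : ∀ X, 0 < M X) {Φ : Pos4 d → ℂ}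
    (hΦ : Φ ∈ symbolClass M) {k : ℕ} (γ : Coord d → ℕ) (hγ : ∑ c, γ c ≤ k) (X : Pos4 d) :
    ‖partialDeriv γ Φ X‖ ≤ M X * symbolSeminorm M k Φ := by
  have h1 : (M X)⁻¹ * ‖partialDeriv γ Φ X‖ ≤ symbolSeminorm M k Φ := by
    refine (le_ciSup (hΦ.2 γ) X).trans ?_
    have hn : (∑ c, γ c) ∈ Finset.range (k + 1) := Finset.mem_range.2 (by omega)
    have hg : γ ∈ Finset.piAntidiag (Finset.univ : Finset (Coord d)) (∑ c, γ c) := by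
      simp [Finset.mem_piAntidiag]
    refine le_trans ?_ (Finset.single_le_sum (f := fun n => ∑ γ ∈ Finset.piAntidiag
      (Finset.univ : Finset (Coord d)) n, ⨆ X, (M X)⁻¹ * ‖partialDeriv γ Φ X‖)
      (fun _ _ => Finset.sum_nonneg fun γ _ => symbolSeminorm_term_nonneg hM γ Φ) hn)
    exact Finset.single_le_sum (f := fun γ : Coord d → ℕ => ⨆ X, (M X)⁻¹ * ‖partialDeriv γ Φ X‖)
      (fun γ _ => symbolSeminorm_term_nonneg hM γ Φ) hg
  rwa [inv_mul_le_iff₀ (hM X)] at h1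

theorem norm_dirDeriv_le {M : Pos4 d → ℝ} (hM : ∀ X, 0 < M X) {Φ : Pos4 d → ℂ}
    (hΦ : Φ ∈ symbolClass M) {k : ℕ} (L : List (Coord d)) (hL : L.length ≤ k) (X : Pos4 d) :
    ‖dirDeriv (L.map coordVec) Φ X‖ ≤ M X * symbolSeminorm M k Φ := by
  rw [dirDeriv_map_coordVec hΦ.1]
  refine norm_partialDeriv_le hM hΦ _ ?_ X
  have h := Multiset.sum_count_eq_card (s := Finset.univ) (m := (L : Multiset (Coord d))) (by simp)
  rw [h]
  exact hL

/-- The coordinates on `ℝ^{4d}`. -/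
def coordVal : Coord d → Pos4 d → ℝ
  | .inl (.inl i), X => X.1.1 i
  | .inl (.inr i), X => X.1.2 i
  | .inr (.inl i), X => X.2.1 i
  | .inr (.inr i), X => X.2.2 i

theorem abs_coordVal_le (c : Coord d) (X : Pos4 d) : |coordVal c X| ≤ ‖X‖ := by
  have h (x : Pos d) (i : Fin d) : |x i| ≤ ‖x‖ := PiLp.norm_apply_le x i
  rcases c with (i | i) | (i | i)
  · exact (h _ i).trans ((norm_fst_le X.1).trans (norm_fst_le X))
  · exact (h _ i).trans ((norm_snd_le X.1).trans (norm_fst_le X))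
  · exact (h _ i).trans ((norm_fst_le X.2).trans (norm_snd_le X))
  · exact (h _ i).trans ((norm_snd_le X.2).trans (norm_snd_le X))

theorem norm_coordVec_le (c : Coord d) : ‖coordVec c‖ ≤ 1 := by
  rcases c with (i | i) | (i | i) <;> simp [coordVec, Prod.norm_def]

theorem sum_coordVal_smul (X : Pos4 d) : ∑ c, coordVal c X • coordVec c = X := by
  simp only [Fintype.sum_sum_type, coordVal, coordVec, Prod.smul_mk, smul_zero]
  have e : (0 : Pos2 d) = (0, 0) := rfl
  refine Prod.ext (Prod.ext ?_ ?_) (Prod.ext ?_ ?_) <;>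
    simp [Prod.fst_sum, Prod.snd_sum, sum_coord_smul]

theorem norm_iteratedFDeriv_le_of_coord {Φ : Pos4 d → ℂ} (n : ℕ) (X : Pos4 d) {B : ℝ}
    (hB : 0 ≤ B)
    (h : ∀ c : Fin n → Coord d, ‖iteratedFDeriv ℝ n Φ X fun i => coordVec (c i)‖ ≤ B) :
    ‖iteratedFDeriv ℝ n Φ X‖ ≤ (Fintype.card (Fin n → Coord d)) * B := by
  refine ContinuousMultilinearMap.opNorm_le_bound (by positivity) fun v => ?_
  have hv : v = fun i => ∑ c, coordVal c (v i) • coordVec c := by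
    funext i
    exact (sum_coordVal_smul _).symm
  conv_lhs => rw [hv]
  rw [ContinuousMultilinearMap.map_sum]
  refine (norm_sum_le _ _).trans ?_
  calc ∑ c : Fin n → Coord d, ‖iteratedFDeriv ℝ n Φ X fun i => coordVal (c i) (v i) • coordVec (c i)‖
      ≤ ∑ c : Fin n → Coord d, B * ∏ i, ‖v i‖ := by
        refine Finset.sum_le_sum fun c _ => ?_
        rw [ContinuousMultilinearMap.map_smul_univ, norm_smul, mul_comm]
        refine mul_le_mul (h c) ?_ (norm_nonneg _) hB
        rw [norm_prod]
        exact Finset.prod_le_prod (fun i _ => norm_nonneg _) fun i _ => by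
          simpa using abs_coordVal_le (c i) (v i)
    _ = _ := by rw [Finset.sum_const, nsmul_eq_mul, Finset.card_univ]; ring

/-! ### Tempered weights -/

theorem one_le_japanese (X : Pos4 d) : 1 ≤ japanese X := by
  rw [japanese, Real.one_le_sqrt]
  linarith [sq_nonneg ‖X.1.1‖, sq_nonneg ‖X.1.2‖, sq_nonneg ‖X.2.1‖, sq_nonneg ‖X.2.2‖]

theorem japanese_le (X : Pos4 d) : japanese X ≤ 2 * (1 + ‖X‖) := by
  have h1 : ‖X.1.1‖ ≤ ‖X‖ := (norm_fst_le X.1).trans (norm_fst_le X)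
  have h2 : ‖X.1.2‖ ≤ ‖X‖ := (norm_snd_le X.1).trans (norm_fst_le X)
  have h3 : ‖X.2.1‖ ≤ ‖X‖ := (norm_fst_le X.2).trans (norm_snd_le X)
  have h4 : ‖X.2.2‖ ≤ ‖X‖ := (norm_snd_le X.2).trans (norm_snd_le X)
  rw [japanese, Real.sqrt_le_left (by positivity)]
  nlinarith [norm_nonneg X, norm_nonneg X.1.1, norm_nonneg X.1.2, norm_nonneg X.2.1,
    norm_nonneg X.2.2, pow_le_pow_left₀ (norm_nonneg X.1.1) h1 2,
    pow_le_pow_left₀ (norm_nonneg X.1.2) h2 2, pow_le_pow_left₀ (norm_nonneg X.2.1) h3 2,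
    pow_le_pow_left₀ (norm_nonneg X.2.2) h4 2]

theorem one_add_norm_le_japanese (X : Pos4 d) : 1 + ‖X‖ ≤ 2 * japanese X := by
  have h (t : ℝ) (ht : t ^ 2 ≤ ‖X.1.1‖ ^ 2 + ‖X.1.2‖ ^ 2 + ‖X.2.1‖ ^ 2 + ‖X.2.2‖ ^ 2) :
      t ≤ japanese X := by
    rw [japanese]
    exact Real.le_sqrt_of_sq_le (by linarith)
  have h0 : ‖X‖ ≤ japanese X := by
    have := sq_nonneg ‖X.1.1‖
    have := sq_nonneg ‖X.1.2‖
    have := sq_nonneg ‖X.2.1‖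
    have := sq_nonneg ‖X.2.2‖
    refine max_le (max_le (h _ ?_) (h _ ?_)) (max_le (h _ ?_) (h _ ?_)) <;> linarith
  linarith [one_le_japanese X]

/-- A tempered weight changes at most polynomially, with an integer exponent. -/
theorem TemperedWeight.exists_bound {M : Pos4 d → ℝ} (hM : TemperedWeight M) :
    ∃ (a : ℕ) (C : ℝ), 0 < C ∧ ∀ X Y, M (X + Y) ≤ C * M X * (1 + ‖Y‖) ^ a := by
  obtain ⟨a, C, ha, hC, h⟩ := hM.tempered
  refine ⟨⌈a⌉₊, C * 2 ^ ⌈a⌉₊, by positivity, fun X Y => (h X Y).trans ?_⟩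
  have h1 : japanese Y ^ a ≤ (2 * (1 + ‖Y‖)) ^ ⌈a⌉₊ := by
    rw [← Real.rpow_natCast]
    refine (Real.rpow_le_rpow_of_exponent_le (one_le_japanese Y) (Nat.le_ceil a)).trans ?_
    exact Real.rpow_le_rpow (by linarith [one_le_japanese Y]) (japanese_le Y) (by positivity)
  have := hM.pos X
  calc C * M X * japanese Y ^ a ≤ C * M X * (2 * (1 + ‖Y‖)) ^ ⌈a⌉₊ := by gcongr
    _ = _ := by rw [mul_pow]; ring

theorem hasTemperateGrowth_of_mem_symbolClass {M : Pos4 d → ℝ} (hM : TemperedWeight M)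
    {Φ : Pos4 d → ℂ} (hΦ : Φ ∈ symbolClass M) : Φ.HasTemperateGrowth := by
  obtain ⟨a, C, hC, h⟩ := hM.exists_bound
  refine ⟨hΦ.1, fun n => ⟨a, Fintype.card (Fin n → Coord d) * (C * M 0 * symbolSeminorm M n Φ),
    fun X => ?_⟩⟩
  have hs := symbolSeminorm_nonneg hM.pos n Φ
  have hX : M X ≤ C * M 0 * (1 + ‖X‖) ^ a := by simpa using h 0 X
  refine (norm_iteratedFDeriv_le_of_coord n X (B := M X * symbolSeminorm M n Φ)
    (mul_nonneg (hM.pos X).le hs) fun c => ?_).trans ?_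
  · rw [iteratedFDeriv_eq_dirDeriv hΦ.1]
    have := norm_dirDeriv_le hM.pos hΦ (k := n) (List.ofFn c) (by simp) X
    rwa [List.map_ofFn] at this
  · calc _ ≤ Fintype.card (Fin n → Coord d) * ((C * M 0 * (1 + ‖X‖) ^ a) * symbolSeminorm M n Φ) := by
          gcongr
      _ = _ := by ring

end

/-! ### Repeated integration by parts -/

section

variable {d : ℕ}

section Oscillatory

variable {E : Type} [NormedAddCommGroup E] [NormedSpace ℝ E]

/-- The directional derivative of a function. -/
def dirD (e : E) (f : E → ℂ) : E → ℂ := fun X => fderiv ℝ f X e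

theorem iterate_dirD (e : E) (f : E → ℂ) (n : ℕ) :
    (dirD e)^[n] f = dirDeriv (List.replicate n e) f := by
  induction n with
  | zero => rfl
  | succ n ih => rw [Function.iterate_succ_apply', ih]; rfl

theorem contDiff_iterate_dirD (e : E) {f : E → ℂ} (hf : ContDiff ℝ ∞ f) (n : ℕ) :
    ContDiff ℝ ∞ ((dirD e)^[n] f) := by
  rw [iterate_dirD]
  exact contDiff_dirDeriv hf _

theorem iterate_dirD_add (e : E) {f g : E → ℂ} (hf : ContDiff ℝ ∞ f) (hg : ContDiff ℝ ∞ g) (n : ℕ) :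
    (dirD e)^[n] (f + g) = (dirD e)^[n] f + (dirD e)^[n] g := by
  induction n with
  | zero => rfl
  | succ n ih =>
    rw [Function.iterate_succ_apply', ih, Function.iterate_succ_apply', Function.iterate_succ_apply']
    funext X
    have h1 := (contDiff_iterate_dirD e hf n).differentiable (by simp) X
    have h2 := (contDiff_iterate_dirD e hg n).differentiable (by simp) X
    simp [dirD, fderiv_add h1 h2]

/-- Leibniz bound for pure derivatives in one direction. With these, the momentum derivatives can be
treated apart from the position derivatives. -/
theorem norm_iterate_dirD_mul_le (e X : E) (n : ℕ) : ∀ {f g : E → ℂ}, ContDiff ℝ ∞ f →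
    ContDiff ℝ ∞ g → ∀ {A B : ℝ}, 0 ≤ A → (∀ j ≤ n, ‖(dirD e)^[j] f X‖ ≤ A) →
    (∀ j ≤ n, ‖(dirD e)^[j] g X‖ ≤ B) → ‖(dirD e)^[n] (f * g) X‖ ≤ 2 ^ n * (A * B) := by
  induction n with
  | zero =>
    intro f g _ _ A B hA h1 h2
    have h1 := h1 0 le_rfl
    have h2 := h2 0 le_rfl
    simp only [Function.iterate_zero, id] at h1 h2 ⊢
    rw [Pi.mul_apply, norm_mul, pow_zero, one_mul]
    exact mul_le_mul h1 h2 (norm_nonneg _) hA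
  | succ n ih =>
    intro f g hf hg A B hA h1 h2
    have hf' : ContDiff ℝ ∞ (dirD e f) := contDiff_iterate_dirD e hf 1
    have hg' : ContDiff ℝ ∞ (dirD e g) := contDiff_iterate_dirD e hg 1
    have hd : dirD e (f * g) = dirD e f * g + f * dirD e g := by
      funext Y
      have h1 := hf.differentiable (by simp) Y
      have h2 := hg.differentiable (by simp) Y
      simp [dirD, fderiv_mul h1 h2]
      ring
    rw [Function.iterate_succ_apply, hd, iterate_dirD_add e (f := dirD e f * g) (g := f * dirD e g)
      (hf'.mul hg) (hf.mul hg')]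
    have a1 := ih hf' hg hA (fun j hj => h1 (j + 1) (by omega)) (fun j hj => h2 j (by omega))
    have a2 := ih hf hg' hA (fun j hj => h1 j (by omega)) (fun j hj => h2 (j + 1) (by omega))
    calc _ ≤ 2 ^ n * (A * B) + 2 ^ n * (A * B) := (norm_add_le _ _).trans (add_le_add a1 a2)
      _ = _ := by ring

theorem iterate_lineDerivOp_coe (e : E) (F : 𝓢(E, ℂ)) (n : ℕ) :
    ⇑((fun f : 𝓢(E, ℂ) => LineDeriv.lineDerivOp e f)^[n] F) = (dirD e)^[n] F := by
  induction n with
  | zero => rfl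
  | succ n ih =>
    rw [Function.iterate_succ_apply', Function.iterate_succ_apply', ← ih]
    rfl

variable [FiniteDimensional ℝ E] [MeasureSpace E] [BorelSpace E]
  [(volume : Measure E).IsAddHaarMeasure]

theorem integrable_expI_mul (l : E →L[ℝ] ℝ) (F : 𝓢(E, ℂ)) :
    Integrable fun X => Complex.exp (Complex.I * (l X : ℂ)) * F X := by
  refine F.integrable.norm.mono' ?_ (Filter.Eventually.of_forall fun X => ?_)
  · refine Continuous.aestronglyMeasurable ?_
    have := F.continuous
    fun_prop
  · rw [norm_mul, norm_expI, one_mul]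

theorem mul_integral_expI (l : E →L[ℝ] ℝ) (F : 𝓢(E, ℂ)) (e : E) :
    (Complex.I * (l e : ℂ)) * ∫ X, Complex.exp (Complex.I * (l X : ℂ)) * F X =
      -∫ X, Complex.exp (Complex.I * (l X : ℂ)) * LineDeriv.lineDerivOp e F X := by
  have hd (X : E) : HasFDerivAt (fun X => Complex.exp (Complex.I * (l X : ℂ)))
      (Complex.exp (Complex.I * (l X : ℂ)) • (Complex.I • Complex.ofRealCLM.comp l)) X :=
    ((Complex.ofRealCLM.hasFDerivAt.comp X l.hasFDerivAt).const_mul Complex.I).cexp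
  have key := integral_mul_fderiv_eq_neg_fderiv_mul_of_integrable (μ := (volume : Measure E))
    (f := fun X => Complex.exp (Complex.I * (l X : ℂ))) (g := F) (v := e) ?_
    (integrable_expI_mul l (LineDeriv.lineDerivOp e F)) (integrable_expI_mul l F)
    (fun X _ => (hd X).differentiableAt) (fun X _ => F.differentiableAt)
  · simp only [lineDerivOp_apply_eq_fderiv]
    rw [key, neg_neg, ← integral_const_mul]
    refine integral_congr_ae (Filter.Eventually.of_forall fun X => ?_)
    simp [(hd X).fderiv]
    ring
  · refine ((integrable_expI_mul l F).const_mul (Complex.I * (l e : ℂ))).congr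
      (Filter.Eventually.of_forall fun X => ?_)
    simp [(hd X).fderiv]
    ring

theorem abs_pow_mul_norm_integral_expI (l : E →L[ℝ] ℝ) (F : 𝓢(E, ℂ)) (e : E) (n : ℕ) :
    |l e| ^ n * ‖∫ X, Complex.exp (Complex.I * (l X : ℂ)) * F X‖ =
      ‖∫ X, Complex.exp (Complex.I * (l X : ℂ)) *
        (fun f : 𝓢(E, ℂ) => LineDeriv.lineDerivOp e f)^[n] F X‖ := by
  induction n with
  | zero => simp
  | succ n ih =>
    rw [pow_succ', mul_assoc, ih, Function.iterate_succ_apply']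
    have := congrArg norm (mul_integral_expI l
      ((fun f : 𝓢(E, ℂ) => LineDeriv.lineDerivOp e f)^[n] F) e)
    rwa [norm_neg, norm_mul, norm_mul, Complex.norm_I, one_mul, Complex.norm_real,
      Real.norm_eq_abs] at this

/-- Non-stationary phase: `n` integrations by parts along `e` gain the factor `|l e|^n`. -/
theorem exists_oscillatory_bound (a n : ℕ) : ∃ C : ℝ, 0 ≤ C ∧ ∀ (l : E →L[ℝ] ℝ) (e : E)
    {f : E → ℂ} (_ : f.HasTemperateGrowth) (η : 𝓢(E, ℂ)) {A B : ℝ}, 0 ≤ A →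
    (∀ j ≤ n, ∀ X, ‖(dirD e)^[j] f X‖ ≤ A * (1 + ‖X‖) ^ a) →
    (∀ j ≤ n, ∀ X, (1 + ‖X‖) ^ (a + (Module.finrank ℝ E + 1)) *
      ‖(fun f : 𝓢(E, ℂ) => LineDeriv.lineDerivOp e f)^[j] η X‖ ≤ B) →
    |l e| ^ n * ‖∫ X, Complex.exp (Complex.I * (l X : ℂ)) * (f X * η X)‖ ≤ C * (A * B) := by
  have hi : Integrable (fun X : E => (1 + ‖X‖) ^ (-((Module.finrank ℝ E + 1 : ℕ) : ℝ))) :=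
    integrable_one_add_norm (by push_cast; linarith)
  refine ⟨2 ^ n * ∫ X : E, (1 + ‖X‖) ^ (-((Module.finrank ℝ E + 1 : ℕ) : ℝ)),
    mul_nonneg (by positivity) (integral_nonneg fun X => by positivity), ?_⟩
  intro l e f hf η A B hA h1 h2
  have h3 := abs_pow_mul_norm_integral_expI l (smulLeftCLM ℂ f η) e n
  simp only [smulLeftCLM_apply_apply hf, smul_eq_mul] at h3
  rw [h3]
  refine (norm_integral_le_of_norm_le (hi.const_mul (2 ^ n * (A * B)))
    (Filter.Eventually.of_forall fun X => ?_)).trans (le_of_eq ?_)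
  · rw [norm_mul, norm_expI, one_mul, iterate_lineDerivOp_coe]
    have hc : ⇑(smulLeftCLM ℂ f η) = f * η := by
      funext Y
      rw [smulLeftCLM_apply_apply hf]
      rfl
    rw [hc]
    set s : ℝ := 1 + ‖X‖ with hs
    have hs0 : 0 < s := by positivity
    refine (norm_iterate_dirD_mul_le e X n hf.1 (η.smooth ⊤) (A := A * s ^ a)
      (B := B / s ^ (a + (Module.finrank ℝ E + 1))) (by positivity) (fun j hj => h1 j hj X)
      (fun j hj => ?_)).trans (le_of_eq ?_)
    · rw [le_div_iff₀ (by positivity), mul_comm, ← iterate_lineDerivOp_coe]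
      exact h2 j hj X
    · rw [Real.rpow_neg hs0.le, Real.rpow_natCast, pow_add]
      field_simp
  · rw [integral_const_mul]
    ring

end Oscillatory

/-! ### Profiles of the frame packets -/

/-- Complex conjugation of Schwartz functions on phase space. -/
def conjPhase (f : 𝓢(Pos2 d, ℂ)) : 𝓢(Pos2 d, ℂ) :=
  postcompCLM (𝕜 := ℝ) (Complex.conjCLE : ℂ →L[ℝ] ℂ) f

theorem conjPhase_apply (f : 𝓢(Pos2 d, ℂ)) (x : Pos2 d) : conjPhase f x = (starRingEnd ℂ) (f x) := rfl

theorem lineDerivOp_conjPhase (v : Pos2 d) (f : 𝓢(Pos2 d, ℂ)) :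
    LineDeriv.lineDerivOp v (conjPhase f) = conjPhase (LineDeriv.lineDerivOp v f) := by
  ext x
  rw [conjPhase_apply, lineDerivOp_apply_eq_fderiv, lineDerivOp_apply_eq_fderiv]
  have h : HasFDerivAt (conjPhase f) ((Complex.conjCLE : ℂ →L[ℝ] ℂ) ∘L fderiv ℝ f x) x :=
    (Complex.conjCLE : ℂ →L[ℝ] ℂ).hasFDerivAt.comp x f.differentiableAt.hasFDerivAt
  rw [h.fderiv]
  rfl

theorem lineDerivOp_tensor (v v' : Pos2 d) (f g : 𝓢(Pos2 d, ℂ)) (X : Pos4 d) :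
    LineDeriv.lineDerivOp ((v, v') : Pos4 d) (tensor f g) X =
      LineDeriv.lineDerivOp v f X.1 * g X.2 + f X.1 * LineDeriv.lineDerivOp v' g X.2 := by
  simp only [lineDerivOp_apply_eq_fderiv]
  have h1 : HasFDerivAt (fun X : Pos4 d => f X.1)
      (fderiv ℝ f X.1 ∘L ContinuousLinearMap.fst ℝ (Pos2 d) (Pos2 d)) X :=
    f.differentiableAt.hasFDerivAt.comp X hasFDerivAt_fst
  have h2 : HasFDerivAt (fun X : Pos4 d => g X.2)
      (fderiv ℝ g X.2 ∘L ContinuousLinearMap.snd ℝ (Pos2 d) (Pos2 d)) X :=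
    g.differentiableAt.hasFDerivAt.comp X hasFDerivAt_snd
  have h3 : fderiv ℝ (tensor f g) X = _ := (h1.mul h2).fderiv
  rw [h3]
  simp
  ring

theorem iterate_lineDerivOp_tensor_left (v : Pos2 d) (f g : 𝓢(Pos2 d, ℂ)) (n : ℕ) :
    (fun F : 𝓢(Pos4 d, ℂ) => LineDeriv.lineDerivOp ((v, 0) : Pos4 d) F)^[n] (tensor f g) =
      tensor ((fun F : 𝓢(Pos2 d, ℂ) => LineDeriv.lineDerivOp v F)^[n] f) g := by
  induction n with
  | zero => rfl
  | succ n ih =>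
    rw [Function.iterate_succ_apply', ih, Function.iterate_succ_apply']
    ext X
    have hz : LineDeriv.lineDerivOp (0 : Pos2 d) g X.2 = 0 := by
      rw [lineDerivOp_apply_eq_fderiv, map_zero]
    rw [lineDerivOp_tensor, tensor_apply, hz, mul_zero, add_zero]

theorem iterate_lineDerivOp_tensor_right (v : Pos2 d) (f g : 𝓢(Pos2 d, ℂ)) (n : ℕ) :
    (fun F : 𝓢(Pos4 d, ℂ) => LineDeriv.lineDerivOp ((0, v) : Pos4 d) F)^[n] (tensor f (conjPhase g)) =
      tensor f (conjPhase ((fun F : 𝓢(Pos2 d, ℂ) => LineDeriv.lineDerivOp v F)^[n] g)) := by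
  induction n with
  | zero => rfl
  | succ n ih =>
    rw [Function.iterate_succ_apply', ih, Function.iterate_succ_apply']
    ext X
    have hz : LineDeriv.lineDerivOp (0 : Pos2 d) f X.1 = 0 := by
      rw [lineDerivOp_apply_eq_fderiv, map_zero]
    rw [lineDerivOp_tensor, tensor_apply, hz, zero_mul, zero_add, lineDerivOp_conjPhase]

/-- The envelope of a frame packet, for the indices `p.1`, `p.2` of the left and the right amplitude. -/
def packetProfile (𝓑 : RegularMagneticField d) (w : Window d)
    (p : (Pos d × Pos d) × (Pos d × Pos d)) : 𝓢(Pos4 d, ℂ) :=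
  tensor (packetAmplitude 𝓑 w p.1) (conjPhase (packetAmplitude 𝓑 w p.2))

/-- The size `1 + max(|κ_L|, |κ_R|)` of the separations. -/
def separation (p : (Pos d × Pos d) × (Pos d × Pos d)) : ℝ := 1 + max ‖p.1.2‖ ‖p.2.2‖

theorem one_le_separation (p : (Pos d × Pos d) × (Pos d × Pos d)) : 1 ≤ separation p := by
  have := (norm_nonneg p.1.2).trans (le_max_left _ ‖p.2.2‖)
  unfold separation
  linarith

theorem norm_tensor_bound {f g : 𝓢(Pos2 d, ℂ)} {k P Q : ℕ} {C D : ℝ}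
    (p : (Pos d × Pos d) × (Pos d × Pos d))
    (hf : ∀ Y, (1 + ‖Y‖) ^ k * ‖f Y‖ ≤ C * (1 + ‖p.1.2‖) ^ P)
    (hg : ∀ Y, (1 + ‖Y‖) ^ k * ‖g Y‖ ≤ D * (1 + ‖p.2.2‖) ^ Q) (X : Pos4 d) :
    (1 + ‖X‖) ^ k * ‖tensor f (conjPhase g) X‖ ≤ (|C| * |D|) * separation p ^ (P + Q) := by
  have h1 : 1 + ‖X‖ ≤ (1 + ‖X.1‖) * (1 + ‖X.2‖) := by
    rw [Prod.norm_def]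
    rcases max_cases ‖X.1‖ ‖X.2‖ with h | h <;> rw [h.1] <;>
      nlinarith [norm_nonneg X.1, norm_nonneg X.2]
  have hs := one_le_separation p
  have hL : 1 + ‖p.1.2‖ ≤ separation p := by unfold separation; gcongr; exact le_max_left _ _
  have hR : 1 + ‖p.2.2‖ ≤ separation p := by unfold separation; gcongr; exact le_max_right _ _
  have hn : ‖tensor f (conjPhase g) X‖ = ‖f X.1‖ * ‖g X.2‖ := by
    rw [tensor_apply, conjPhase_apply, norm_mul, RCLike.norm_conj]
  calc _ ≤ ((1 + ‖X.1‖) * (1 + ‖X.2‖)) ^ k * (‖f X.1‖ * ‖g X.2‖) := by rw [hn]; gcongr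
    _ = ((1 + ‖X.1‖) ^ k * ‖f X.1‖) * ((1 + ‖X.2‖) ^ k * ‖g X.2‖) := by rw [mul_pow]; ring
    _ ≤ (|C| * separation p ^ P) * (|D| * separation p ^ Q) := by
      refine mul_le_mul ((hf X.1).trans ?_) ((hg X.2).trans ?_) (by positivity) (by positivity)
      · refine mul_le_mul (le_abs_self C) ?_ (by positivity) (abs_nonneg C)
        gcongr
      · refine mul_le_mul (le_abs_self D) ?_ (by positivity) (abs_nonneg D)
        gcongr
    _ = _ := by rw [pow_add]; ring

/-- Derivatives of the profile in any coordinate direction. -/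
theorem exists_profile_bound (𝓑 : RegularMagneticField d) (w : Window d) (k n : ℕ) :
    ∃ (P : ℕ) (C : ℝ), 0 ≤ C ∧ ∀ (c : Coord d), ∀ j ≤ n, ∀ p X,
      (1 + ‖X‖) ^ k * ‖(fun F : 𝓢(Pos4 d, ℂ) => LineDeriv.lineDerivOp (coordVec c) F)^[j]
        (packetProfile 𝓑 w p) X‖ ≤ C * separation p ^ P := by
  have h : ∀ (c : Coord d) (j : ℕ), ∃ (P : ℕ) (C : ℝ), ∀ p X,
      (1 + ‖X‖) ^ k * ‖(fun F : 𝓢(Pos4 d, ℂ) => LineDeriv.lineDerivOp (coordVec c) F)^[j]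
        (packetProfile 𝓑 w p) X‖ ≤ C * separation p ^ P := by
    intro c j
    obtain ⟨P0, C0, h0⟩ := exists_lineDeriv_amplitude_bound 𝓑 w k 0 0
    rcases c with c | c
    · obtain ⟨v, hv⟩ : ∃ v : Pos2 d, coordVec (Sum.inl c) = ((v, 0) : Pos4 d) := by
        rcases c with c | c <;> exact ⟨_, rfl⟩
      obtain ⟨P, C, h⟩ := exists_lineDeriv_amplitude_bound 𝓑 w k v j
      refine ⟨P + P0, |C| * |C0|, fun p X => ?_⟩
      rw [hv, packetProfile, iterate_lineDerivOp_tensor_left]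
      exact norm_tensor_bound p (h p.1) (h0 p.2) X
    · obtain ⟨v, hv⟩ : ∃ v : Pos2 d, coordVec (Sum.inr c) = ((0, v) : Pos4 d) := by
        rcases c with c | c <;> exact ⟨_, rfl⟩
      obtain ⟨P, C, h⟩ := exists_lineDeriv_amplitude_bound 𝓑 w k v j
      refine ⟨P0 + P, |C0| * |C|, fun p X => ?_⟩
      rw [hv, packetProfile, iterate_lineDerivOp_tensor_right]
      exact norm_tensor_bound p (h0 p.1) (h p.2) X
  choose P C h using h
  refine ⟨∑ c, ∑ j ∈ Finset.range (n + 1), P c j, ∑ c, ∑ j ∈ Finset.range (n + 1), |C c j|,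
    by positivity, fun c j hj p X => (h c j p X).trans ?_⟩
  have hj' : j ∈ Finset.range (n + 1) := Finset.mem_range.2 (by omega)
  have h1 : C c j ≤ ∑ c, ∑ j ∈ Finset.range (n + 1), |C c j| :=
    (le_abs_self _).trans ((Finset.single_le_sum (f := fun j => |C c j|) (fun _ _ => abs_nonneg _)
      hj').trans (Finset.single_le_sum (f := fun c => ∑ j ∈ Finset.range (n + 1), |C c j|)
        (fun _ _ => Finset.sum_nonneg fun _ _ => abs_nonneg _) (Finset.mem_univ c)))
  have h2 : P c j ≤ ∑ c, ∑ j ∈ Finset.range (n + 1), P c j :=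
    (Finset.single_le_sum (f := fun j => P c j) (fun _ _ => Nat.zero_le _)
      hj').trans (Finset.single_le_sum (f := fun c => ∑ j ∈ Finset.range (n + 1), P c j)
        (fun _ _ => Nat.zero_le _) (Finset.mem_univ c))
  have hs := one_le_separation p
  exact mul_le_mul h1 (pow_le_pow_right₀ hs h2) (by positivity) (by positivity)

/-- The coordinate of momentum on one of the two sides. -/
def momentumCoord : Fin d ⊕ Fin d → Coord d
  | .inl c => .inl (.inr c)
  | .inr c => .inr (.inr c)

/-- For derivatives in the momentum directions the growth exponent in the separation does not depend on
the number of derivatives. -/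
theorem exists_profile_momentum_bound (𝓑 : RegularMagneticField d) (w : Window d) (k : ℕ) :
    ∃ P : ℕ, ∀ n : ℕ, ∃ C : ℝ, 0 ≤ C ∧ ∀ c : Fin d ⊕ Fin d, ∀ j ≤ n, ∀ p X,
      (1 + ‖X‖) ^ k * ‖(fun F : 𝓢(Pos4 d, ℂ) => LineDeriv.lineDerivOp (coordVec (momentumCoord c)) F)^[j]
        (packetProfile 𝓑 w p) X‖ ≤ C * separation p ^ P := by
  obtain ⟨P, h⟩ := exists_momentum_deriv_amplitude_bound 𝓑 w k
  choose C h using h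
  have key : ∀ (c : Fin d ⊕ Fin d) (j : ℕ), ∃ D : ℝ, ∀ p X,
      (1 + ‖X‖) ^ k * ‖(fun F : 𝓢(Pos4 d, ℂ) => LineDeriv.lineDerivOp (coordVec (momentumCoord c)) F)^[j]
        (packetProfile 𝓑 w p) X‖ ≤ D * separation p ^ (P + P) := by
    intro c j
    rcases c with c | c
    · refine ⟨|C (EuclideanSpace.single c 1) j| * |C 0 0|, fun p X => ?_⟩
      have hv : coordVec (momentumCoord (Sum.inl c)) =
        (((0, EuclideanSpace.single c 1), 0) : Pos4 d) := rfl
      rw [hv, packetProfile, iterate_lineDerivOp_tensor_left]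
      exact norm_tensor_bound p (h (EuclideanSpace.single c 1) j p.1) (h 0 0 p.2) X
    · refine ⟨|C 0 0| * |C (EuclideanSpace.single c 1) j|, fun p X => ?_⟩
      have hv : coordVec (momentumCoord (Sum.inr c)) =
        ((0, (0, EuclideanSpace.single c 1)) : Pos4 d) := rfl
      rw [hv, packetProfile, iterate_lineDerivOp_tensor_right]
      exact norm_tensor_bound p (h 0 0 p.1) (h (EuclideanSpace.single c 1) j p.2) X
  choose D hD using key
  refine ⟨P + P, fun n => ⟨∑ c, ∑ j ∈ Finset.range (n + 1), |D c j|, by positivity,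
    fun c j hj p X => (hD c j p X).trans ?_⟩⟩
  have hj' : j ∈ Finset.range (n + 1) := Finset.mem_range.2 (by omega)
  have h1 : D c j ≤ ∑ c, ∑ j ∈ Finset.range (n + 1), |D c j| :=
    (le_abs_self _).trans ((Finset.single_le_sum (f := fun j => |D c j|) (fun _ _ => abs_nonneg _)
      hj').trans (Finset.single_le_sum (f := fun c => ∑ j ∈ Finset.range (n + 1), |D c j|)
        (fun _ _ => Finset.sum_nonneg fun _ _ => abs_nonneg _) (Finset.mem_univ c)))
  have hs := one_le_separation p
  exact mul_le_mul_of_nonneg_right h1 (by positivity)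

end

/-! ### Decay of the matrix of a quantized symbol -/

section

variable {d : ℕ}

section
variable {E : Type} [NormedAddCommGroup E] [NormedSpace ℝ E] [FiniteDimensional ℝ E] [MeasureSpace E]
  [BorelSpace E] [(volume : Measure E).IsAddHaarMeasure]

/-- `exists_oscillatory_bound` with `1 + r |l e|` in place of `|l e|`, which also covers small frequencies. -/
theorem exists_one_add_oscillatory_bound (a n : ℕ) (r : ℝ) (hr : 0 ≤ r) :
    ∃ C : ℝ, 0 ≤ C ∧ ∀ (l : E →L[ℝ] ℝ) (e : E)
    {f : E → ℂ} (_ : f.HasTemperateGrowth) (η : 𝓢(E, ℂ)) {A B : ℝ}, 0 ≤ A →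
    (∀ j ≤ n, ∀ X, ‖(dirD e)^[j] f X‖ ≤ A * (1 + ‖X‖) ^ a) →
    (∀ j ≤ n, ∀ X, (1 + ‖X‖) ^ (a + (Module.finrank ℝ E + 1)) *
      ‖(fun f : 𝓢(E, ℂ) => LineDeriv.lineDerivOp e f)^[j] η X‖ ≤ B) →
    (1 + r * |l e|) ^ n * ‖∫ X, Complex.exp (Complex.I * (l X : ℂ)) * (f X * η X)‖ ≤ C * (A * B) := by
  obtain ⟨C0, hC0, h0⟩ := exists_oscillatory_bound (E := E) a 0
  obtain ⟨C, hC, h⟩ := exists_oscillatory_bound (E := E) a n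
  refine ⟨2 ^ (n - 1) * (C0 + r ^ n * C), by positivity, fun l e f hf η A B hA h1 h2 => ?_⟩
  have b0 := h0 l e hf η hA (fun j hj => h1 j (by omega)) (fun j hj => h2 j (by omega))
  have b := h l e hf η hA h1 h2
  rw [pow_zero, one_mul] at b0
  set J := ‖∫ X, Complex.exp (Complex.I * (l X : ℂ)) * (f X * η X)‖ with hJ
  have hJ0 : 0 ≤ J := norm_nonneg _
  calc (1 + r * |l e|) ^ n * J ≤ (2 ^ (n - 1) * (1 ^ n + (r * |l e|) ^ n)) * J := by
        gcongr
        exact add_pow_le zero_le_one (by positivity) n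
    _ = 2 ^ (n - 1) * (J + r ^ n * (|l e| ^ n * J)) := by rw [one_pow, mul_pow]; ring
    _ ≤ 2 ^ (n - 1) * (C0 * (A * B) + r ^ n * (C * (A * B))) := by gcongr
    _ = _ := by ring

end

/-- The midpoint of two lattice points. -/
def latticeMid (i j : SuperIdx d) : Pos4 d := (1 / 2 : ℝ) • (latticePoint i + latticePoint j)

/-- The linear phase with which the frame packet of `i` and `j` oscillates. -/
def packetPhase (i j : SuperIdx d) : Pos4 d →L[ℝ] ℝ :=
  linearPhase (idxPoint i.1 - idxPoint j.1) ∘L ContinuousLinearMap.fst ℝ _ _ -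
    linearPhase (idxPoint i.2 - idxPoint j.2) ∘L ContinuousLinearMap.snd ℝ _ _

/-- The parameters of the left and right amplitudes of the frame packet of `i` and `j`. -/
def packetIndex (i j : SuperIdx d) : (Pos d × Pos d) × (Pos d × Pos d) :=
  ((intVec j.1.1, intVec i.1.1 - intVec j.1.1), (intVec j.2.1, intVec i.2.1 - intVec j.2.1))

theorem exists_framePacket_eq (𝓑 : RegularMagneticField d) (w : Window d) (i j : SuperIdx d) :
    ∃ c : ℂ, ‖c‖ ≤ 1 ∧ ∀ X, framePacket 𝓑 w i j X =
      c * (Complex.exp (Complex.I * (packetPhase i j (X - latticeMid i j) : ℂ)) *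
        packetProfile 𝓑 w (packetIndex i j) (X - latticeMid i j)) := by
  obtain ⟨c, hc, h⟩ := exists_wigner_frameFun_eq 𝓑 w i.1 j.1
  obtain ⟨c', hc', h'⟩ := exists_wigner_frameFun_eq 𝓑 w i.2 j.2
  refine ⟨c * (starRingEnd ℂ) c', ?_, fun X => ?_⟩
  · rw [norm_mul, RCLike.norm_conj]
    exact mul_le_one₀ hc (norm_nonneg _) hc'
  rw [framePacket, h, h', map_mul, map_mul, conj_expI, packetProfile, tensor_apply, conjPhase_apply]
  have e1 : (X - latticeMid i j).1 = X.1 - (1 / 2 : ℝ) • (idxPoint i.1 + idxPoint j.1) := rfl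
  have e2 : (X - latticeMid i j).2 = X.2 - (1 / 2 : ℝ) • (idxPoint i.2 + idxPoint j.2) := rfl
  have e3 : packetPhase i j (X - latticeMid i j) =
      linearPhase (idxPoint i.1 - idxPoint j.1) (X.1 - (1 / 2 : ℝ) • (idxPoint i.1 + idxPoint j.1)) -
      linearPhase (idxPoint i.2 - idxPoint j.2) (X.2 - (1 / 2 : ℝ) • (idxPoint i.2 + idxPoint j.2)) := rfl
  have hx (s t : ℝ) : Complex.exp (Complex.I * ((s - t : ℝ) : ℂ)) =
      Complex.exp (Complex.I * (s : ℂ)) * Complex.exp (-Complex.I * (t : ℂ)) := by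
    rw [← Complex.exp_add]
    congr 1
    push_cast
    ring
  rw [e1, e2, e3, hx]
  simp only [packetIndex]
  ring

theorem norm_le_sum_abs (x : Pos d) : ‖x‖ ≤ ∑ c, |x c| := by
  conv_lhs => rw [← sum_coord_smul x]
  refine (norm_sum_le _ _).trans (le_of_eq ?_)
  simp [norm_smul]

theorem exists_norm_le_mul_abs_coord (hd : 1 ≤ d) (x : Pos d) : ∃ c, ‖x‖ ≤ d * |x c| := by
  have : Nonempty (Fin d) := ⟨⟨0, hd⟩⟩
  have hd' : (0 : ℝ) < d := by exact_mod_cast hd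
  have h2 : ∑ _c : Fin d, ‖x‖ / d ≤ ∑ c, |x c| := by
    rw [Finset.sum_const, Finset.card_univ, Fintype.card_fin, nsmul_eq_mul]
    rw [mul_div_cancel₀ _ hd'.ne']
    exact norm_le_sum_abs x
  obtain ⟨c, -, hc⟩ := Finset.exists_le_of_sum_le Finset.univ_nonempty h2
  refine ⟨c, ?_⟩
  rwa [div_le_iff₀ hd', mul_comm] at hc

/-- The separation of the positions is controlled by the frequency in one momentum direction: the
largest coordinate of the larger component. A coordinate exists because `1 ≤ d`. -/
theorem exists_separation_le (hd : 1 ≤ d) (i j : SuperIdx d) : ∃ c,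
    separation (packetIndex i j) ≤ 1 + d * |packetPhase i j (coordVec (momentumCoord c))| := by
  unfold separation
  rcases le_total ‖(packetIndex i j).1.2‖ ‖(packetIndex i j).2.2‖ with h | h
  · obtain ⟨c, hc⟩ := exists_norm_le_mul_abs_coord hd (packetIndex i j).2.2
    refine ⟨Sum.inr c, ?_⟩
    rw [max_eq_right h]
    have e : packetPhase i j (coordVec (momentumCoord (Sum.inr c))) = -((packetIndex i j).2.2 c) := by
      simp [packetPhase, coordVec, momentumCoord, linearPhase_apply, packetIndex, idxPoint,
        EuclideanSpace.inner_single_right]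
    rw [e, abs_neg]
    linarith
  · obtain ⟨c, hc⟩ := exists_norm_le_mul_abs_coord hd (packetIndex i j).1.2
    refine ⟨Sum.inl c, ?_⟩
    rw [max_eq_left h]
    have e : packetPhase i j (coordVec (momentumCoord (Sum.inl c))) = (packetIndex i j).1.2 c := by
      simp [packetPhase, coordVec, momentumCoord, linearPhase_apply, packetIndex, idxPoint,
        EuclideanSpace.inner_single_right]
    rw [e]
    linarith

/-- The size `1 + max(|κ'_L|, |κ'_R|)` of the momentum separations. -/
def momentumSeparation (i j : SuperIdx d) : ℝ :=
  1 + max ‖intVec i.1.2 - intVec j.1.2‖ ‖intVec i.2.2 - intVec j.2.2‖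

theorem exists_momentumSeparation_le (hd : 1 ≤ d) (i j : SuperIdx d) : ∃ c,
    momentumSeparation i j ≤ 1 + d * |packetPhase i j (coordVec c)| := by
  unfold momentumSeparation
  rcases le_total ‖intVec i.1.2 - intVec j.1.2‖ ‖intVec i.2.2 - intVec j.2.2‖ with h | h
  · obtain ⟨c, hc⟩ := exists_norm_le_mul_abs_coord hd (intVec i.2.2 - intVec j.2.2)
    refine ⟨Sum.inr (Sum.inl c), ?_⟩
    rw [max_eq_right h]
    have e : packetPhase i j (coordVec (Sum.inr (Sum.inl c))) = (intVec i.2.2 - intVec j.2.2) c := by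
      simp [packetPhase, coordVec, linearPhase_apply, idxPoint, EuclideanSpace.inner_single_right]
    rw [e]
    linarith
  · obtain ⟨c, hc⟩ := exists_norm_le_mul_abs_coord hd (intVec i.1.2 - intVec j.1.2)
    refine ⟨Sum.inl (Sum.inl c), ?_⟩
    rw [max_eq_left h]
    have e : packetPhase i j (coordVec (Sum.inl (Sum.inl c))) =
        -((intVec i.1.2 - intVec j.1.2) c) := by
      simp [packetPhase, coordVec, linearPhase_apply, idxPoint, EuclideanSpace.inner_single_right]
    rw [e, abs_neg]
    linarith

theorem one_add_norm_le_separation (i j : SuperIdx d) : 1 + ‖latticePoint i - latticePoint j‖ ≤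
    separation (packetIndex i j) * momentumSeparation i j := by
  have hn : ‖latticePoint i - latticePoint j‖ =
    max (max ‖intVec i.1.1 - intVec j.1.1‖ ‖intVec i.1.2 - intVec j.1.2‖)
      (max ‖intVec i.2.1 - intVec j.2.1‖ ‖intVec i.2.2 - intVec j.2.2‖) := rfl
  rw [hn, separation, momentumSeparation, packetIndex]
  set a := ‖intVec i.1.1 - intVec j.1.1‖
  set b := ‖intVec i.1.2 - intVec j.1.2‖
  set a' := ‖intVec i.2.1 - intVec j.2.1‖
  set b' := ‖intVec i.2.2 - intVec j.2.2‖
  have h1 : max (max a b) (max a' b') ≤ max a a' + max b b' := by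
    have ha : 0 ≤ max a a' := le_max_of_le_left (norm_nonneg _)
    have hb : 0 ≤ max b b' := le_max_of_le_left (norm_nonneg _)
    have := le_max_left a a'
    have := le_max_right a a'
    have := le_max_left b b'
    have := le_max_right b b'
    refine max_le (max_le ?_ ?_) (max_le ?_ ?_) <;> linarith
  have ha : 0 ≤ max a a' := le_max_of_le_left (norm_nonneg _)
  have hb : 0 ≤ max b b' := le_max_of_le_left (norm_nonneg _)
  nlinarith

theorem hasTemperateGrowth_comp_add {Φ : Pos4 d → ℂ} (hΦ : Φ.HasTemperateGrowth) (m : Pos4 d) :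
    (fun X => Φ (X + m)).HasTemperateGrowth := by
  refine hΦ.comp (g := Φ) (f := fun X => X + m) ?_
  fun_prop

theorem iterate_dirD_comp_add (e m : Pos4 d) (Φ : Pos4 d → ℂ) (n : ℕ) (X : Pos4 d) :
    (dirD e)^[n] (fun X => Φ (X + m)) X = (dirD e)^[n] Φ (X + m) := by
  induction n generalizing X with
  | zero => rfl
  | succ n ih =>
    rw [Function.iterate_succ_apply', Function.iterate_succ_apply', funext ih]
    simp only [dirD]
    rw [fderiv_comp_add_right]

theorem norm_iterate_dirD_comp_add_le {M : Pos4 d → ℝ} (hM : ∀ X, 0 < M X) {a : ℕ} {C : ℝ}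
    (h : ∀ X Y, M (X + Y) ≤ C * M X * (1 + ‖Y‖) ^ a) {Φ : Pos4 d → ℂ} (hΦ : Φ ∈ symbolClass M)
    (c : Coord d) (m : Pos4 d) {n j : ℕ} (hj : j ≤ n) (X : Pos4 d) :
    ‖(dirD (coordVec c))^[j] (fun X => Φ (X + m)) X‖ ≤
      (C * M m * symbolSeminorm M n Φ) * (1 + ‖X‖) ^ a := by
  rw [iterate_dirD_comp_add, iterate_dirD]
  have h1 := norm_dirDeriv_le hM hΦ (k := n) (List.replicate j c) (by simpa using hj) (X + m)
  rw [List.map_replicate] at h1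
  refine h1.trans ?_
  have h2 : M (X + m) ≤ C * M m * (1 + ‖X‖) ^ a := by
    rw [add_comm]
    exact h m X
  calc _ ≤ (C * M m * (1 + ‖X‖) ^ a) * symbolSeminorm M n Φ := by
        gcongr
        exact symbolSeminorm_nonneg hM n Φ
    _ = _ := by ring

theorem norm_integral_framePacket_le (𝓑 : RegularMagneticField d) (w : Window d)
    (Φ : Pos4 d → ℂ) (i j : SuperIdx d) : ‖∫ X, Φ X * framePacket 𝓑 w i j X‖ ≤
      ‖∫ X, Complex.exp (Complex.I * (packetPhase i j X : ℂ)) *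
        (Φ (X + latticeMid i j) * packetProfile 𝓑 w (packetIndex i j) X)‖ := by
  obtain ⟨c, hc, h⟩ := exists_framePacket_eq 𝓑 w i j
  rw [← integral_add_right_eq_self _ (latticeMid i j)]
  have e : ∀ X, Φ (X + latticeMid i j) * framePacket 𝓑 w i j (X + latticeMid i j) =
      c * (Complex.exp (Complex.I * (packetPhase i j X : ℂ)) *
        (Φ (X + latticeMid i j) * packetProfile 𝓑 w (packetIndex i j) X)) := by
    intro X
    rw [h, add_sub_cancel_right]
    ring
  simp only [e]
  rw [integral_const_mul, norm_mul]
  exact mul_le_of_le_one_left (norm_nonneg _) hc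

/-- The pairing of a symbol with a frame packet decays rapidly in the separation of the indices.
Integration by parts in momentum gives decay in the separation of the positions without loss; then
integration by parts in position gives decay in the separation of the momenta, at the price of a power
of the separation of the positions, which the first estimate absorbs. -/
theorem exists_integral_framePacket_bound (hd : 1 ≤ d) (𝓑 : RegularMagneticField d) (w : Window d)
    {M : Pos4 d → ℝ} (hM : TemperedWeight M) (n : ℕ) : ∃ (C : ℝ) (k : ℕ), 0 ≤ C ∧
      ∀ Φ ∈ symbolClass M, ∀ i j : SuperIdx d,
        (1 + ‖latticePoint i - latticePoint j‖) ^ n * ‖∫ X, Φ X * framePacket 𝓑 w i j X‖ ≤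
          C * (M (latticeMid i j) * symbolSeminorm M k Φ) := by
  obtain ⟨a, Cw, hCw, hw⟩ := hM.exists_bound
  set D := a + (Module.finrank ℝ (Pos4 d) + 1) with hD
  obtain ⟨P, hP⟩ := exists_profile_momentum_bound 𝓑 w D
  obtain ⟨Q, B2, hB2, h2⟩ := exists_profile_bound 𝓑 w D (2 * n)
  obtain ⟨B1, hB1, h1⟩ := hP (2 * n + Q + P)
  obtain ⟨C1, hC1, o1⟩ := exists_one_add_oscillatory_bound (E := Pos4 d) a (2 * n + Q + P) d
    (Nat.cast_nonneg d)
  obtain ⟨C2, hC2, o2⟩ := exists_one_add_oscillatory_bound (E := Pos4 d) a (2 * n) d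
    (Nat.cast_nonneg d)
  refine ⟨1 + (C1 * Cw * B1) * (C2 * Cw * B2), 2 * n + Q + P, by positivity, fun Φ hΦ i j => ?_⟩
  set m := latticeMid i j with hm
  set S := symbolSeminorm M (2 * n + Q + P) Φ with hS
  have hS0 : 0 ≤ S := symbolSeminorm_nonneg hM.pos _ Φ
  have hMm := hM.pos m
  have hT := hasTemperateGrowth_comp_add (hasTemperateGrowth_of_mem_symbolClass hM hΦ) m
  set J := ‖∫ X, Complex.exp (Complex.I * (packetPhase i j X : ℂ)) *
        (Φ (X + m) * packetProfile 𝓑 w (packetIndex i j) X)‖ with hJ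
  have hJ0 : 0 ≤ J := norm_nonneg _
  set ρ := separation (packetIndex i j) with hρ
  set σ := momentumSeparation i j with hσ
  have hρ1 : 1 ≤ ρ := one_le_separation _
  have hσ0 : 0 ≤ σ := by
    have := (norm_nonneg (intVec i.1.2 - intVec j.1.2)).trans
      (le_max_left _ ‖intVec i.2.2 - intVec j.2.2‖)
    rw [hσ, momentumSeparation]
    linarith
  set U := M m * S with hU
  have hU0 : 0 ≤ U := by positivity
  have hA (l : ℕ) (hl : l ≤ 2 * n + Q + P) (c : Coord d) (X : Pos4 d) :
      ‖(dirD (coordVec c))^[l] (fun X => Φ (X + m)) X‖ ≤ (Cw * M m * S) * (1 + ‖X‖) ^ a :=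
    norm_iterate_dirD_comp_add_le hM.pos hw hΦ c m hl X
  have s1 : ρ ^ (2 * n + Q) * J ≤ (C1 * Cw * B1) * U := by
    obtain ⟨c, hc⟩ := exists_separation_le hd i j
    have := o1 (packetPhase i j) (coordVec (momentumCoord c)) hT (packetProfile 𝓑 w (packetIndex i j))
      (A := Cw * M m * S) (B := B1 * ρ ^ P) (by positivity) (fun l hl X => hA l hl _ X)
      (fun l hl X => h1 c l hl _ X)
    have h3 : ρ ^ (2 * n + Q + P) * J ≤ C1 * (Cw * M m * S * (B1 * ρ ^ P)) := by
      refine le_trans ?_ this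
      gcongr
    refine le_of_mul_le_mul_right (a := ρ ^ P) ?_ (by positivity)
    calc _ = ρ ^ (2 * n + Q + P) * J := by rw [pow_add ρ (2 * n + Q)]; ring
      _ ≤ _ := h3
      _ = _ := by rw [hU]; ring
  have s2 : σ ^ (2 * n) * J ≤ (C2 * Cw * B2) * U * ρ ^ Q := by
    obtain ⟨c, hc⟩ := exists_momentumSeparation_le hd i j
    have := o2 (packetPhase i j) (coordVec c) hT (packetProfile 𝓑 w (packetIndex i j))
      (A := Cw * M m * S) (B := B2 * ρ ^ Q) (by positivity) (fun l hl X => hA l (by omega) _ X)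
      (fun l hl X => h2 c l hl _ X)
    calc σ ^ (2 * n) * J ≤ _ := by gcongr
      _ ≤ _ := this
      _ = _ := by rw [hU]; ring
  have s3 : ((ρ * σ) ^ n * J) ^ 2 ≤ ((1 + (C1 * Cw * B1) * (C2 * Cw * B2)) * U) ^ 2 := by
    have h4 : ((ρ * σ) ^ n * J) ^ 2 ≤ (C1 * Cw * B1) * (C2 * Cw * B2) * U ^ 2 := by
      refine le_of_mul_le_mul_right (a := ρ ^ Q) ?_ (by positivity)
      calc _ = (ρ ^ (2 * n + Q) * J) * (σ ^ (2 * n) * J) := by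
            rw [pow_add, pow_mul, pow_mul, mul_pow, mul_pow, mul_pow]
            ring
        _ ≤ ((C1 * Cw * B1) * U) * ((C2 * Cw * B2) * U * ρ ^ Q) := by gcongr
        _ = _ := by ring
    refine h4.trans ?_
    rw [mul_pow _ U 2]
    refine mul_le_mul_of_nonneg_right ?_ (sq_nonneg U)
    have : 0 ≤ (C1 * Cw * B1) * (C2 * Cw * B2) := by positivity
    nlinarith
  have s4 : (ρ * σ) ^ n * J ≤ (1 + (C1 * Cw * B1) * (C2 * Cw * B2)) * U :=
    (pow_le_pow_iff_left₀ (by positivity) (by positivity) two_ne_zero).1 s3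
  refine le_trans ?_ s4
  have h5 := norm_integral_framePacket_le 𝓑 w Φ i j
  have h6 := one_add_norm_le_separation i j
  have hρσ : 0 ≤ ρ * σ := by positivity
  exact mul_le_mul (pow_le_pow_left₀ (by positivity) h6 n) h5 (norm_nonneg _) (pow_nonneg hρσ n)

theorem exists_matrixEntry_bound (hd : 1 ≤ d) (𝓑 : RegularMagneticField d) (w : Window d)
    {M : Pos4 d → ℝ} (hM : TemperedWeight M) (n : ℕ) : ∃ C : ℝ, 0 < C ∧ ∃ k : ℕ,
      ∀ Φ ∈ symbolClass M, ∀ i j : SuperIdx d,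
      decayTerm M n (matrixEntry 𝓑 w (superOp 𝓑 (ofFun Φ))) (i, j) ≤ C * symbolSeminorm M k Φ := by
  obtain ⟨C, k, hC, h⟩ := exists_integral_framePacket_bound hd 𝓑 w hM n
  set K : ℝ := ‖((2 * Real.pi : ℝ) ^ (2 * d) : ℂ)⁻¹‖ with hK
  refine ⟨2 ^ n * (K * C) + 1, by positivity, k, fun Φ hΦ i j => ?_⟩
  have hT := hasTemperateGrowth_of_mem_symbolClass hM hΦ
  have hS := symbolSeminorm_nonneg hM.pos k Φ
  have hMm := hM.pos (latticeMid i j)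
  rw [decayTerm, matrixEntry_superOp_ofFun 𝓑 w hT, norm_mul, ← hK]
  change japanese (latticePoint i - latticePoint j) ^ n * (M (latticeMid i j))⁻¹ * _ ≤ _
  set J := ‖∫ X, Φ X * framePacket 𝓑 w i j X‖ with hJ
  have hJ0 : 0 ≤ J := norm_nonneg _
  have hj : japanese (latticePoint i - latticePoint j) ^ n ≤
      2 ^ n * (1 + ‖latticePoint i - latticePoint j‖) ^ n := by
    rw [← mul_pow]
    exact pow_le_pow_left₀ (zero_le_one.trans (one_le_japanese _)) (japanese_le _) n
  calc japanese (latticePoint i - latticePoint j) ^ n * (M (latticeMid i j))⁻¹ * (K * J)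
      ≤ (2 ^ n * (1 + ‖latticePoint i - latticePoint j‖) ^ n) * (M (latticeMid i j))⁻¹ * (K * J) := by
        gcongr
    _ = 2 ^ n * K * (M (latticeMid i j))⁻¹ * ((1 + ‖latticePoint i - latticePoint j‖) ^ n * J) := by
        ring
    _ ≤ 2 ^ n * K * (M (latticeMid i j))⁻¹ * (C * (M (latticeMid i j) * symbolSeminorm M k Φ)) :=
        mul_le_mul_of_nonneg_left (h Φ hΦ i j) (by positivity)
    _ = 2 ^ n * (K * C) * symbolSeminorm M k Φ := by field_simp
    _ ≤ _ := by nlinarith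

end

/-! ### Smooth series with locally uniform bounds -/

section

variable {d : ℕ}

section SmoothSeries

variable {ι E F : Type} [NormedAddCommGroup E] [NormedSpace ℝ E] [NormedAddCommGroup F]
  [NormedSpace ℝ F] [CompleteSpace F]

/-- All derivatives of the functions `f i` are summable, uniformly on every ball around the origin. -/
def LocallySummable (f : ι → E → F) : Prop :=
  ∀ (n : ℕ) (R : ℝ), ∃ u : ι → ℝ, Summable u ∧ ∀ i x, ‖x‖ < R → ‖iteratedFDeriv ℝ n (f i) x‖ ≤ u i

namespace LocallySummable

variable {f : ι → E → F}

theorem summable (hs : LocallySummable f) (n : ℕ) (x : E) :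
    Summable fun i => iteratedFDeriv ℝ n (f i) x := by
  obtain ⟨u, hu, h⟩ := hs n (‖x‖ + 1)
  exact Summable.of_norm_bounded hu fun i => h i x (by linarith)

theorem hasFDerivAt_tsum (hs : LocallySummable f) (hf : ∀ i, ContDiff ℝ ∞ (f i)) (n : ℕ) (x : E) :
    HasFDerivAt (fun x => ∑' i, iteratedFDeriv ℝ n (f i) x)
      (∑' i, fderiv ℝ (iteratedFDeriv ℝ n (f i)) x) x := by
  obtain ⟨u, hu, h⟩ := hs (n + 1) (‖x‖ + 1)
  have hx : x ∈ Metric.ball (0 : E) (‖x‖ + 1) := by simp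
  refine hasFDerivAt_tsum_of_isPreconnected hu Metric.isOpen_ball
    (convex_ball (0 : E) (‖x‖ + 1)).isPreconnected (fun i y _ => ?_) (fun i y hy => ?_) hx
    (hs.summable n x) hx
  · exact ((hf i).differentiable_iteratedFDeriv (m := n)
      (by exact_mod_cast WithTop.coe_lt_top _) y).hasFDerivAt
  · rw [fderiv_iteratedFDeriv, Function.comp_apply, LinearIsometryEquiv.norm_map]
    exact h i y (by simpa using hy)

theorem iteratedFDeriv_tsum (hs : LocallySummable f) (hf : ∀ i, ContDiff ℝ ∞ (f i)) (n : ℕ) :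
    iteratedFDeriv ℝ n (fun x => ∑' i, f i x) = fun x => ∑' i, iteratedFDeriv ℝ n (f i) x := by
  induction n with
  | zero =>
    funext x
    simp_rw [iteratedFDeriv_zero_eq_comp]
    exact (continuousMultilinearCurryFin0 ℝ E F).symm.toContinuousLinearEquiv.map_tsum
  | succ n ih =>
    funext x
    simp_rw [iteratedFDeriv_succ_eq_comp_left, ih, Function.comp_apply,
      (hs.hasFDerivAt_tsum hf n x).fderiv]
    exact (continuousMultilinearCurryLeftEquiv ℝ
      (fun _ : Fin (n + 1) => E) F).symm.toContinuousLinearEquiv.map_tsum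

theorem contDiff_tsum (hs : LocallySummable f) (hf : ∀ i, ContDiff ℝ ∞ (f i)) :
    ContDiff ℝ ∞ fun x => ∑' i, f i x := by
  refine contDiff_of_differentiable_iteratedFDeriv fun n _ => ?_
  rw [hs.iteratedFDeriv_tsum hf n]
  exact fun x => (hs.hasFDerivAt_tsum hf n x).differentiableAt

theorem norm_iteratedFDeriv_tsum_le (hs : LocallySummable f) (hf : ∀ i, ContDiff ℝ ∞ (f i)) (n : ℕ)
    (x : E) {u : ι → ℝ} {B : ℝ} (hu : HasSum u B) (h : ∀ i, ‖iteratedFDeriv ℝ n (f i) x‖ ≤ u i) :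
    ‖iteratedFDeriv ℝ n (fun x => ∑' i, f i x) x‖ ≤ B := by
  rw [hs.iteratedFDeriv_tsum hf n]
  exact tsum_of_norm_bounded hu h

theorem tendstoUniformlyOn (hs : LocallySummable f) {K : Set E} (hK : IsCompact K) :
    TendstoUniformlyOn (fun (s : Finset ι) x => ∑ i ∈ s, f i x) (fun x => ∑' i, f i x)
      Filter.atTop K := by
  obtain ⟨R, hR⟩ := hK.isBounded.subset_ball (0 : E)
  obtain ⟨u, hu, h⟩ := hs 0 R
  refine tendstoUniformlyOn_tsum hu fun i x hx => ?_
  have := h i x (by simpa using hR hx)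
  rwa [norm_iteratedFDeriv_zero] at this

end LocallySummable

end SmoothSeries

/-! ### Lattice sums -/

variable (d) in
/-- The standard basis of `ℝ^{4d}`. -/
def coordBasis : Module.Basis (Coord d) ℝ (Pos4 d) :=
  (((EuclideanSpace.basisFun (Fin d) ℝ).toBasis.prod (EuclideanSpace.basisFun (Fin d) ℝ).toBasis).prod
    ((EuclideanSpace.basisFun (Fin d) ℝ).toBasis.prod (EuclideanSpace.basisFun (Fin d) ℝ).toBasis))

theorem latticePoint_mem_span (i : SuperIdx d) :
    latticePoint i ∈ Submodule.span ℤ (Set.range (coordBasis d)) := by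
  rw [Module.Basis.mem_span_iff_repr_mem ℤ]
  rintro ((c | c) | (c | c))
  · exact ⟨i.1.1 c, by simp [coordBasis, latticePoint, intVec]⟩
  · exact ⟨i.1.2 c, by simp [coordBasis, latticePoint, intVec]⟩
  · exact ⟨i.2.1 c, by simp [coordBasis, latticePoint, intVec]⟩
  · exact ⟨i.2.2 c, by simp [coordBasis, latticePoint, intVec]⟩

theorem intVec_injective : Function.Injective (intVec (d := d)) := by
  intro α β h
  funext c
  have := congrArg (fun x : Pos d => x c) h
  simpa [intVec] using this

theorem latticePoint_injective : Function.Injective (latticePoint (d := d)) := by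
  rintro ⟨⟨a, b⟩, ⟨a', b'⟩⟩ ⟨⟨e, f⟩, ⟨e', f'⟩⟩ h
  simp only [latticePoint, Prod.mk.injEq] at h
  obtain ⟨⟨h1, h2⟩, ⟨h3, h4⟩⟩ := h
  rw [intVec_injective h1, intVec_injective h2, intVec_injective h3, intVec_injective h4]

theorem intVec_sub (α β : Fin d → ℤ) : intVec (α - β) = intVec α - intVec β := by
  ext c
  simp [intVec]

theorem latticePoint_sub (i j : SuperIdx d) : latticePoint (i - j) = latticePoint i - latticePoint j := by
  simp [latticePoint, intVec_sub]

variable (d) in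
theorem exists_summable_latticePoint : ∃ s : ℕ,
    Summable fun i : SuperIdx d => ((1 + ‖latticePoint i‖) ^ s)⁻¹ := by
  set L := Submodule.span ℤ (Set.range (coordBasis d)) with hL
  have h := ZLattice.summable_norm_pow_inv L (Module.finrank ℤ L + 1) (by omega)
  refine ⟨Module.finrank ℤ L + 1, ?_⟩
  have h' := h.comp_injective (i := fun i : SuperIdx d => (⟨latticePoint i, latticePoint_mem_span i⟩ : L))
    fun i j hij => latticePoint_injective (congrArg Subtype.val hij)
  refine Summable.of_norm_bounded_eventually h' ?_
  have : ∀ᶠ i : SuperIdx d in Filter.cofinite, i ≠ 0 := by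
    simp [Filter.eventually_cofinite]
  filter_upwards [this] with i hi
  have h0 : 0 < ‖latticePoint i‖ := by
    refine norm_pos_iff.2 fun hz => hi (latticePoint_injective ?_)
    rw [hz]
    have := latticePoint_sub (0 : SuperIdx d) 0
    rw [sub_self, sub_self] at this
    exact this.symm
  rw [Real.norm_of_nonneg (by positivity)]
  simp only [Function.comp_apply]
  rw [← inv_pow]
  refine pow_le_pow_left₀ (by positivity) (inv_anti₀ ?_ ?_) _
  · exact h0
  · change ‖latticePoint i‖ ≤ _
    linarith

theorem exists_near_latticePoint (X : Pos4 d) : ∃ l : SuperIdx d, ‖X - latticePoint l‖ ≤ d := by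
  have h (x : Pos d) : ∃ α : Fin d → ℤ, ‖x - intVec α‖ ≤ d := by
    refine ⟨fun c => ⌊x c⌋, ?_⟩
    refine (norm_le_sum_abs _).trans ?_
    calc ∑ c, |(x - intVec fun c => ⌊x c⌋) c| ≤ ∑ _c : Fin d, (1 : ℝ) := by
          refine Finset.sum_le_sum fun c _ => ?_
          have h1 := Int.floor_le (x c)
          have h2 := Int.lt_floor_add_one (x c)
          have : (x - intVec fun c => ⌊x c⌋) c = x c - ⌊x c⌋ := rfl
          rw [this, abs_le]
          constructor <;> linarith
      _ = d := by simp
  obtain ⟨a, ha⟩ := h X.1.1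
  obtain ⟨b, hb⟩ := h X.1.2
  obtain ⟨a', ha'⟩ := h X.2.1
  obtain ⟨b', hb'⟩ := h X.2.2
  exact ⟨((a, b), (a', b')), max_le (max_le ha hb) (max_le ha' hb')⟩

theorem one_add_norm_le_mul {E : Type} [NormedAddCommGroup E] (x y : E) :
    1 + ‖x‖ ≤ (1 + ‖x - y‖) * (1 + ‖y‖) := by
  have h : ‖x‖ ≤ ‖x - y‖ + ‖y‖ := by simpa using norm_add_le (x - y) y
  nlinarith [norm_nonneg (x - y), norm_nonneg y]

theorem inv_one_add_norm_le {E : Type} [NormedAddCommGroup E] (x y : E) (s : ℕ) :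
    ((1 + ‖x - y‖) ^ s)⁻¹ ≤ (1 + ‖x‖) ^ s * ((1 + ‖y‖) ^ s)⁻¹ := by
  rw [← div_eq_mul_inv, inv_eq_one_div, div_le_div_iff₀ (by positivity) (by positivity), one_mul,
    ← mul_pow]
  refine pow_le_pow_left₀ (by positivity) ?_ s
  have := one_add_norm_le_mul y x
  rw [norm_sub_rev] at this
  linarith

theorem summable_lattice_pair {s : ℕ}
    (hs : Summable fun i : SuperIdx d => ((1 + ‖latticePoint i‖) ^ s)⁻¹) :
    Summable fun p : SuperIdx d × SuperIdx d =>
      ((1 + ‖latticePoint p.1‖) ^ s)⁻¹ * ((1 + ‖latticePoint p.1 - latticePoint p.2‖) ^ s)⁻¹ := by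
  have h := hs.mul_of_nonneg hs (fun i => by positivity) (fun i => by positivity)
  have e : Function.Injective fun p : SuperIdx d × SuperIdx d => (p.1, p.1 - p.2) := by
    rintro ⟨a, b⟩ ⟨a', b'⟩ h
    simp only [Prod.mk.injEq] at h
    obtain ⟨rfl, h⟩ := h
    rw [sub_right_inj.1 h]
  refine (h.comp_injective e).congr fun p => ?_
  simp only [Function.comp_apply, latticePoint_sub]

/-- The sums over the lattice are bounded uniformly in the point `X`. -/
theorem exists_tsum_lattice_pair_le {s : ℕ}
    (hs : Summable fun i : SuperIdx d => ((1 + ‖latticePoint i‖) ^ s)⁻¹) : ∃ C : ℝ, 0 ≤ C ∧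
    ∀ X : Pos4 d, ∃ B ≤ C, HasSum (fun p : SuperIdx d × SuperIdx d =>
      ((1 + ‖X - latticePoint p.1‖) ^ s)⁻¹ * ((1 + ‖latticePoint p.1 - latticePoint p.2‖) ^ s)⁻¹) B := by
  set T := ∑' p : SuperIdx d × SuperIdx d,
      ((1 + ‖latticePoint p.1‖) ^ s)⁻¹ * ((1 + ‖latticePoint p.1 - latticePoint p.2‖) ^ s)⁻¹
  have hsum := summable_lattice_pair hs
  refine ⟨(1 + d) ^ s * T, mul_nonneg (by positivity) (tsum_nonneg fun p => by positivity),
    fun X => ?_⟩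
  obtain ⟨l, hl⟩ := exists_near_latticePoint X
  -- translate the lattice by the point `l` near `X`
  let e : SuperIdx d × SuperIdx d ≃ SuperIdx d × SuperIdx d :=
    (Equiv.subRight l).prodCongr (Equiv.subRight l)
  have hsum' := e.summable_iff.2 hsum
  have hT : ∑' p, _ = T := e.tsum_eq (fun p : SuperIdx d × SuperIdx d =>
      ((1 + ‖latticePoint p.1‖) ^ s)⁻¹ * ((1 + ‖latticePoint p.1 - latticePoint p.2‖) ^ s)⁻¹)
  have hle : ∀ p : SuperIdx d × SuperIdx d,
      ((1 + ‖X - latticePoint p.1‖) ^ s)⁻¹ * ((1 + ‖latticePoint p.1 - latticePoint p.2‖) ^ s)⁻¹ ≤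
      (1 + d) ^ s * (((1 + ‖latticePoint (e p).1‖) ^ s)⁻¹ *
        ((1 + ‖latticePoint (e p).1 - latticePoint (e p).2‖) ^ s)⁻¹) := by
    intro p
    have h1 := inv_one_add_norm_le (X - latticePoint l) (latticePoint (p.1 - l)) s
    have e1 : X - latticePoint l - latticePoint (p.1 - l) = X - latticePoint p.1 := by
      rw [latticePoint_sub]
      abel
    have e2 : latticePoint (e p).1 - latticePoint (e p).2 = latticePoint p.1 - latticePoint p.2 := by
      change latticePoint (p.1 - l) - latticePoint (p.2 - l) = _
      rw [latticePoint_sub, latticePoint_sub]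
      abel
    rw [e1] at h1
    rw [e2, ← mul_assoc]
    refine mul_le_mul_of_nonneg_right (h1.trans ?_) (by positivity)
    change _ ≤ (1 + (d : ℝ)) ^ s * ((1 + ‖latticePoint (p.1 - l)‖) ^ s)⁻¹
    gcongr
  have hsX := Summable.of_nonneg_of_le (fun p => by positivity) hle (hsum'.mul_left ((1 + (d : ℝ)) ^ s))
  refine ⟨_, ?_, hsX.hasSum⟩
  refine (hsX.tsum_le_tsum hle (hsum'.mul_left ((1 + (d : ℝ)) ^ s))).trans (le_of_eq ?_)
  rw [tsum_mul_left]
  congr 1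

end

/-! ### Localization of the frame packets -/

section

variable {d : ℕ}

theorem norm_iteratedFDeriv_mul_le_two_pow {E : Type} [NormedAddCommGroup E] [NormedSpace ℝ E]
    {f g : E → ℂ} (hf : ContDiff ℝ ∞ f) (hg : ContDiff ℝ ∞ g) (X : E) {n : ℕ} {A B : ℝ} (hA : 0 ≤ A)
    (h1 : ∀ j ≤ n, ‖iteratedFDeriv ℝ j f X‖ ≤ A) (h2 : ∀ j ≤ n, ‖iteratedFDeriv ℝ j g X‖ ≤ B) {m : ℕ}
    (hm : m ≤ n) : ‖iteratedFDeriv ℝ m (fun X => f X * g X) X‖ ≤ 2 ^ n * (A * B) := by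
  have hB : 0 ≤ B := (norm_nonneg _).trans (h2 0 (by omega))
  refine (norm_iteratedFDeriv_mul_le (N := ∞) hf hg X (by exact_mod_cast le_top)).trans ?_
  calc _ ≤ ∑ j ∈ Finset.range (m + 1), (m.choose j : ℝ) * (A * B) := by
        refine Finset.sum_le_sum fun j hj => ?_
        have hj : j ≤ m := Nat.lt_succ_iff.1 (Finset.mem_range.1 hj)
        rw [mul_assoc]
        refine mul_le_mul_of_nonneg_left ?_ (Nat.cast_nonneg _)
        exact mul_le_mul (h1 j (by omega)) (h2 _ (by omega)) (norm_nonneg _) hA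
    _ = 2 ^ m * (A * B) := by
        rw [← Finset.sum_mul]
        congr 1
        exact_mod_cast Nat.sum_range_choose m
    _ ≤ _ := by
        gcongr
        norm_num

theorem norm_iteratedFDeriv_comp_clm_le {E E' : Type} [NormedAddCommGroup E] [NormedSpace ℝ E]
    [NormedAddCommGroup E'] [NormedSpace ℝ E'] {f : E' → ℂ} (hf : ContDiff ℝ ∞ f) (L : E →L[ℝ] E')
    (hL : ‖L‖ ≤ 1) (X : E) (n : ℕ) :
    ‖iteratedFDeriv ℝ n (fun X => f (L X)) X‖ ≤ ‖iteratedFDeriv ℝ n f (L X)‖ := by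
  have h : (fun X => f (L X)) = f ∘ L := rfl
  rw [h, L.iteratedFDeriv_comp_right hf X (i := n) (by exact_mod_cast le_top)]
  refine (ContinuousMultilinearMap.norm_compContinuousLinearMap_le _ _).trans ?_
  exact mul_le_of_le_one_right (norm_nonneg _)
    (Finset.prod_le_one (fun _ _ => norm_nonneg _) fun _ _ => hL)

theorem norm_linearPhase_le (κ : Pos2 d) : ‖linearPhase κ‖ ≤ 2 * ‖κ‖ := by
  refine ContinuousLinearMap.opNorm_le_bound _ (by positivity) fun p => ?_
  rw [linearPhase_apply]
  have h1 : ‖(inner ℝ κ.1 p.2 : ℝ)‖ ≤ ‖κ‖ * ‖p‖ := (norm_inner_le_norm κ.1 p.2).trans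
    (mul_le_mul (norm_fst_le κ) (norm_snd_le p) (norm_nonneg _) (norm_nonneg _))
  have h2 : ‖(inner ℝ κ.2 p.1 : ℝ)‖ ≤ ‖κ‖ * ‖p‖ := (norm_inner_le_norm κ.2 p.1).trans
    (mul_le_mul (norm_snd_le κ) (norm_fst_le p) (norm_nonneg _) (norm_nonneg _))
  refine (norm_sub_le _ _).trans ?_
  linarith

theorem norm_packetPhase_le (i j : SuperIdx d) :
    ‖packetPhase i j‖ ≤ 4 * ‖latticePoint i - latticePoint j‖ := by
  have h1 : ‖idxPoint i.1 - idxPoint j.1‖ ≤ ‖latticePoint i - latticePoint j‖ :=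
    norm_fst_le (latticePoint i - latticePoint j)
  have h2 : ‖idxPoint i.2 - idxPoint j.2‖ ≤ ‖latticePoint i - latticePoint j‖ :=
    norm_snd_le (latticePoint i - latticePoint j)
  have h3 : ‖linearPhase (idxPoint i.1 - idxPoint j.1) ∘L ContinuousLinearMap.fst ℝ (Pos2 d) (Pos2 d)‖ ≤
      2 * ‖idxPoint i.1 - idxPoint j.1‖ := by
    refine (ContinuousLinearMap.opNorm_comp_le _ _).trans ?_
    refine (mul_le_of_le_one_right (norm_nonneg _) (ContinuousLinearMap.norm_fst_le _ _ _)).trans ?_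
    exact norm_linearPhase_le _
  have h4 : ‖linearPhase (idxPoint i.2 - idxPoint j.2) ∘L ContinuousLinearMap.snd ℝ (Pos2 d) (Pos2 d)‖ ≤
      2 * ‖idxPoint i.2 - idxPoint j.2‖ := by
    refine (ContinuousLinearMap.opNorm_comp_le _ _).trans ?_
    refine (mul_le_of_le_one_right (norm_nonneg _) (ContinuousLinearMap.norm_snd_le _ _ _)).trans ?_
    exact norm_linearPhase_le _
  refine (norm_sub_le _ _).trans ?_
  linarith

theorem uniformGrowth_expI_packetPhase : UniformGrowth
    (fun p : SuperIdx d × SuperIdx d => 1 + ‖latticePoint p.1 - latticePoint p.2‖)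
    (fun p X => Complex.exp (Complex.I * (packetPhase p.1 p.2 X : ℂ))) := by
  refine UniformGrowth.expI (fun p => (packetPhase p.1 p.2).contDiff) ?_
  have e (p : SuperIdx d × SuperIdx d) :
      fderiv ℝ (packetPhase p.1 p.2) = fun _ => packetPhase p.1 p.2 := by
    funext X
    exact (packetPhase p.1 p.2).fderiv
  simp only [e]
  refine ⟨fun p => by simp, fun p => contDiff_const, fun n => ⟨1, 4, fun p X => ?_⟩⟩
  have h : ‖packetPhase p.1 p.2‖ ≤
      4 * ((1 + ‖latticePoint p.1 - latticePoint p.2‖) * (1 + ‖X‖)) ^ 1 := by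
    refine (norm_packetPhase_le p.1 p.2).trans ?_
    have := mul_nonneg (norm_nonneg (latticePoint p.1 - latticePoint p.2)) (norm_nonneg X)
    rw [pow_one]
    nlinarith [norm_nonneg X]
  rcases n with _ | n
  · rwa [norm_iteratedFDeriv_zero]
  · rw [iteratedFDeriv_succ_const]
    simp only [Pi.zero_apply, norm_zero]
    positivity

theorem norm_packetIndex_fst_snd_le (i j : SuperIdx d) :
    ‖(packetIndex i j).1.2‖ ≤ ‖latticePoint i - latticePoint j‖ :=
  (norm_fst_le (latticePoint i - latticePoint j).1).trans (norm_fst_le _)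

theorem norm_packetIndex_snd_snd_le (i j : SuperIdx d) :
    ‖(packetIndex i j).2.2‖ ≤ ‖latticePoint i - latticePoint j‖ :=
  (norm_fst_le (latticePoint i - latticePoint j).2).trans (norm_snd_le _)

theorem contDiff_framePacket (𝓑 : RegularMagneticField d) (w : Window d) (i j : SuperIdx d) :
    ContDiff ℝ ∞ (framePacket 𝓑 w i j) := by
  have h : framePacket 𝓑 w i j = fun X => (starRingEnd ℂ)
      (superOpInv 𝓑 (bowtieSuper (frameOp 𝓑 w i) (frameOpConj 𝓑 w j)) X) := by
    funext X
    rw [superOpInv_frame_apply, Complex.conj_conj]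
  rw [h]
  exact (Complex.conjCLE : ℂ →L[ℝ] ℂ).contDiff.comp (SchwartzMap.smooth _ ⊤)

/-- Frame packets are localized at the midpoint of their indices, with all derivatives, up to a
polynomial loss in the separation of the indices. -/
theorem exists_framePacket_bound (𝓑 : RegularMagneticField d) (w : Window d) (k n : ℕ) :
    ∃ (P : ℕ) (C : ℝ), 0 ≤ C ∧ ∀ m ≤ n, ∀ (i j : SuperIdx d) (X : Pos4 d),
      (1 + ‖X - latticeMid i j‖) ^ k * ‖iteratedFDeriv ℝ m (framePacket 𝓑 w i j) X‖ ≤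
        C * (1 + ‖latticePoint i - latticePoint j‖) ^ P := by
  obtain ⟨p, De, hDe, hE⟩ := (uniformGrowth_expI_packetPhase (d := d)).exists_bound_le n
  obtain ⟨P, C, hC, hA⟩ := exists_iteratedFDeriv_amplitude_bound 𝓑 w (k + p) n
  refine ⟨p + 2 * P, 2 ^ n * (De * (2 ^ n * (C * C))), by positivity, fun m hm i j X => ?_⟩
  obtain ⟨c, hc, h⟩ := exists_framePacket_eq 𝓑 w i j
  set ρ := 1 + ‖latticePoint i - latticePoint j‖ with hρ
  have hρ0 : 0 < ρ := by positivity
  set Y := X - latticeMid i j with hY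
  set G : Pos4 d → ℂ := fun Y => Complex.exp (Complex.I * (packetPhase i j Y : ℂ)) *
    packetProfile 𝓑 w (packetIndex i j) Y with hG
  have hGs : ContDiff ℝ ∞ G := ((uniformGrowth_expI_packetPhase (d := d)).contDiff (i, j)).mul
    (SchwartzMap.smooth _ ⊤)
  have e1 : ‖iteratedFDeriv ℝ m (framePacket 𝓑 w i j) X‖ ≤ ‖iteratedFDeriv ℝ m G Y‖ := by
    have : framePacket 𝓑 w i j = c • fun X => G (X - latticeMid i j) := funext h
    have hGt : ContDiff ℝ ∞ fun X => G (X - latticeMid i j) :=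
      hGs.comp (contDiff_id.sub contDiff_const)
    rw [this, iteratedFDeriv_const_smul_apply (hGt.contDiffAt.of_le (by exact_mod_cast le_top)),
      iteratedFDeriv_comp_sub, norm_smul]
    exact mul_le_of_le_one_left (norm_nonneg _) hc
  set s1 := 1 + ‖Y.1‖ with hs1
  set s2 := 1 + ‖Y.2‖ with hs2
  have hs10 : 0 < s1 := by positivity
  have hs20 : 0 < s2 := by positivity
  have a1 (l : ℕ) (hl : l ≤ n) :
      ‖iteratedFDeriv ℝ l (fun X : Pos4 d => packetAmplitude 𝓑 w (packetIndex i j).1 X.1) Y‖ ≤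
        C * ρ ^ P / s1 ^ (k + p) := by
    refine (norm_iteratedFDeriv_comp_clm_le (SchwartzMap.smooth _ ⊤)
      (ContinuousLinearMap.fst ℝ (Pos2 d) (Pos2 d)) (ContinuousLinearMap.norm_fst_le _ _ _) Y l).trans ?_
    rw [le_div_iff₀ (by positivity), mul_comm]
    refine (hA l hl _ _).trans ?_
    gcongr C * ?_ ^ P
    exact add_le_add_right (norm_packetIndex_fst_snd_le i j) 1
  have a2 (l : ℕ) (hl : l ≤ n) : ‖iteratedFDeriv ℝ l
      (fun X : Pos4 d => conjPhase (packetAmplitude 𝓑 w (packetIndex i j).2) X.2) Y‖ ≤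
        C * ρ ^ P / s2 ^ (k + p) := by
    refine (norm_iteratedFDeriv_comp_clm_le (SchwartzMap.smooth _ ⊤)
      (ContinuousLinearMap.snd ℝ (Pos2 d) (Pos2 d)) (ContinuousLinearMap.norm_snd_le _ _ _) Y l).trans ?_
    have hconj : ⇑(conjPhase (packetAmplitude 𝓑 w (packetIndex i j).2)) =
      Complex.conjLIE ∘ (packetAmplitude 𝓑 w (packetIndex i j).2) := rfl
    rw [hconj, LinearIsometryEquiv.norm_iteratedFDeriv_comp_left]
    rw [le_div_iff₀ (by positivity), mul_comm]
    refine (hA l hl _ _).trans ?_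
    gcongr C * ?_ ^ P
    exact add_le_add_right (norm_packetIndex_snd_snd_le i j) 1
  have a3 (l : ℕ) (hl : l ≤ n) : ‖iteratedFDeriv ℝ l (packetProfile 𝓑 w (packetIndex i j)) Y‖ ≤
      2 ^ n * (C * ρ ^ P / s1 ^ (k + p) * (C * ρ ^ P / s2 ^ (k + p))) :=
    norm_iteratedFDeriv_mul_le_two_pow
      ((SchwartzMap.smooth (packetAmplitude 𝓑 w (packetIndex i j).1) ⊤).comp contDiff_fst)
      ((SchwartzMap.smooth (conjPhase (packetAmplitude 𝓑 w (packetIndex i j).2)) ⊤).comp contDiff_snd) Y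
      (by positivity) a1 a2 hl
  have a4 : ‖iteratedFDeriv ℝ m G Y‖ ≤ 2 ^ n * (De * (ρ * (1 + ‖Y‖)) ^ p *
      (2 ^ n * (C * ρ ^ P / s1 ^ (k + p) * (C * ρ ^ P / s2 ^ (k + p))))) :=
    norm_iteratedFDeriv_mul_le_two_pow ((uniformGrowth_expI_packetPhase (d := d)).contDiff (i, j))
      (SchwartzMap.smooth _ ⊤) Y (by positivity) (fun l hl => hE l hl (i, j) Y) a3 hm
  have h1 : 1 + ‖Y‖ ≤ s1 * s2 := by
    rw [Prod.norm_def, hs1, hs2]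
    rcases max_cases ‖Y.1‖ ‖Y.2‖ with h | h <;> rw [h.1] <;>
      nlinarith [norm_nonneg Y.1, norm_nonneg Y.2]
  calc (1 + ‖Y‖) ^ k * ‖iteratedFDeriv ℝ m (framePacket 𝓑 w i j) X‖
      ≤ (1 + ‖Y‖) ^ k * (2 ^ n * (De * (ρ * (1 + ‖Y‖)) ^ p *
      (2 ^ n * (C * ρ ^ P / s1 ^ (k + p) * (C * ρ ^ P / s2 ^ (k + p)))))) := by
        gcongr
        exact e1.trans a4
    _ = (2 ^ n * (De * (2 ^ n * (C * C)))) * ρ ^ (p + 2 * P) *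
        ((1 + ‖Y‖) ^ (k + p) / (s1 * s2) ^ (k + p)) := by
        rw [mul_pow ρ, mul_pow s1, pow_add ρ, pow_add (1 + ‖Y‖), two_mul P, pow_add ρ P P]
        field_simp
    _ ≤ (2 ^ n * (De * (2 ^ n * (C * C)))) * ρ ^ (p + 2 * P) * 1 := by
        gcongr
        rw [div_le_one (by positivity)]
        gcongr
    _ = _ := mul_one _

/-! ### Convergence of the dequantization series -/

theorem dequantTerm_eq (𝓑 : RegularMagneticField d) (w : Window d) (N : SuperIdx d → SuperIdx d → ℂ)
    (p : SuperIdx d × SuperIdx d) :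
    dequantTerm 𝓑 w N p = N p.1 p.2 • (Complex.conjLIE ∘ framePacket 𝓑 w p.1 p.2) := by
  funext X
  rw [dequantTerm, superOpInv_frame_apply]
  rfl

theorem contDiff_dequantTerm (𝓑 : RegularMagneticField d) (w : Window d)
    (N : SuperIdx d → SuperIdx d → ℂ) (p : SuperIdx d × SuperIdx d) :
    ContDiff ℝ ∞ (dequantTerm 𝓑 w N p) := by
  exact contDiff_const.mul (SchwartzMap.smooth _ ⊤)

theorem norm_iteratedFDeriv_dequantTerm (𝓑 : RegularMagneticField d) (w : Window d)
    (N : SuperIdx d → SuperIdx d → ℂ) (p : SuperIdx d × SuperIdx d) (m : ℕ) (X : Pos4 d) :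
    ‖iteratedFDeriv ℝ m (dequantTerm 𝓑 w N p) X‖ =
      ‖N p.1 p.2‖ * ‖iteratedFDeriv ℝ m (framePacket 𝓑 w p.1 p.2) X‖ := by
  have hs : ContDiff ℝ ∞ (Complex.conjLIE ∘ framePacket 𝓑 w p.1 p.2) :=
    Complex.conjLIE.contDiff.comp (contDiff_framePacket 𝓑 w p.1 p.2)
  rw [dequantTerm_eq, iteratedFDeriv_const_smul_apply
    (hs.contDiffAt.of_le (by exact_mod_cast le_top)), norm_smul,
    LinearIsometryEquiv.norm_iteratedFDeriv_comp_left]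

theorem decayTerm_nonneg {M : Pos4 d → ℝ} (hM : ∀ X, 0 < M X) (n : ℕ)
    (N : SuperIdx d → SuperIdx d → ℂ) (p : SuperIdx d × SuperIdx d) : 0 ≤ decayTerm M n N p :=
  mul_nonneg (mul_nonneg (pow_nonneg (zero_le_one.trans (one_le_japanese _)) _)
    (inv_nonneg.2 (hM _).le)) (norm_nonneg _)

/-- Each derivative of the terms of the dequantization series is bounded by the weight times a summable
function of the lattice points, which is concentrated where both indices are close to `X`. -/
theorem exists_dequantTerm_bound (𝓑 : RegularMagneticField d) (w : Window d) {M : Pos4 d → ℝ}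
    (hM : TemperedWeight M) (m s : ℕ) : ∃ (C : ℝ) (n : ℕ), 0 ≤ C ∧ ∀ N : SuperIdx d → SuperIdx d → ℂ,
      (∀ n : ℕ, BddAbove (Set.range (decayTerm M n N))) → ∀ (p : SuperIdx d × SuperIdx d) (X : Pos4 d),
      ∀ l ≤ m, ‖iteratedFDeriv ℝ l (dequantTerm 𝓑 w N p) X‖ ≤ C * (⨆ p, decayTerm M n N p) * M X *
        (((1 + ‖X - latticePoint p.1‖) ^ s)⁻¹ *
          ((1 + ‖latticePoint p.1 - latticePoint p.2‖) ^ s)⁻¹) := by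
  obtain ⟨a, Cw, hCw, hw⟩ := hM.exists_bound
  obtain ⟨P, C, hC, hP⟩ := exists_framePacket_bound 𝓑 w (s + a) m
  refine ⟨C * Cw * 2 ^ (P + 2 * s), P + 2 * s, by positivity, fun N hN p X l hl => ?_⟩
  obtain ⟨i, j⟩ := p
  rw [norm_iteratedFDeriv_dequantTerm]
  simp only
  set S := ⨆ p, decayTerm M (P + 2 * s) N p with hS
  have hS1 : decayTerm M (P + 2 * s) N (i, j) ≤ S := le_ciSup (hN _) (i, j)
  have hS0 : 0 ≤ S := (decayTerm_nonneg hM.pos _ N (i, j)).trans hS1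
  set ρ := 1 + ‖latticePoint i - latticePoint j‖ with hρ
  have hρ0 : 0 < ρ := by positivity
  set Y := X - latticeMid i j with hY
  set τ := 1 + ‖Y‖ with hτ
  have hτ0 : 0 < τ := by positivity
  have hMX := hM.pos X
  have hMm := hM.pos (latticeMid i j)
  have b1 : ‖N i j‖ ≤ S * (2 ^ (P + 2 * s) * (ρ ^ (P + 2 * s))⁻¹) * (Cw * M X * τ ^ a) := by
    have hmid : M (latticeMid i j) ≤ Cw * M X * τ ^ a := by
      have := hw X (-Y)
      rw [norm_neg] at this
      rwa [show X + -Y = latticeMid i j by rw [hY]; abel] at this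
    have hj : ρ ^ (P + 2 * s) ≤ 2 ^ (P + 2 * s) * japanese (latticePoint i - latticePoint j) ^ (P + 2 * s) := by
      rw [← mul_pow]
      exact pow_le_pow_left₀ hρ0.le (one_add_norm_le_japanese _) _
    change japanese (latticePoint i - latticePoint j) ^ (P + 2 * s) * (M (latticeMid i j))⁻¹ * ‖N i j‖ ≤ S
      at hS1
    have hS2 : ρ ^ (P + 2 * s) * (M (latticeMid i j))⁻¹ * ‖N i j‖ ≤ 2 ^ (P + 2 * s) * S := by
      calc _ ≤ 2 ^ (P + 2 * s) * japanese (latticePoint i - latticePoint j) ^ (P + 2 * s) *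
            (M (latticeMid i j))⁻¹ * ‖N i j‖ := by gcongr
        _ = 2 ^ (P + 2 * s) * (japanese (latticePoint i - latticePoint j) ^ (P + 2 * s) *
            (M (latticeMid i j))⁻¹ * ‖N i j‖) := by ring
        _ ≤ _ := by gcongr
    calc ‖N i j‖ = (ρ ^ (P + 2 * s))⁻¹ * M (latticeMid i j) *
          (ρ ^ (P + 2 * s) * (M (latticeMid i j))⁻¹ * ‖N i j‖) := by field_simp
      _ ≤ (ρ ^ (P + 2 * s))⁻¹ * (Cw * M X * τ ^ a) * (2 ^ (P + 2 * s) * S) := by gcongr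
      _ = _ := by ring
  have b2 : ‖iteratedFDeriv ℝ l (framePacket 𝓑 w i j) X‖ ≤ C * ρ ^ P / τ ^ (s + a) := by
    rw [le_div_iff₀ (by positivity), mul_comm]
    exact hP l hl i j X
  -- `X - i` is the difference of `X - (i + j) / 2` and `(i - j) / 2`
  have b3 : 1 + ‖X - latticePoint i‖ ≤ τ * ρ := by
    have h1 : ‖X - latticePoint i‖ ≤ ‖Y‖ + ‖latticePoint i - latticePoint j‖ := by
      have e : X - latticePoint i = Y - (1 / 2 : ℝ) • (latticePoint i - latticePoint j) := by
        rw [hY, latticeMid]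
        module
      rw [e]
      refine (norm_sub_le _ _).trans ?_
      rw [norm_smul]
      norm_num
      linarith [norm_nonneg (latticePoint i - latticePoint j)]
    nlinarith [norm_nonneg Y, norm_nonneg (latticePoint i - latticePoint j)]
  calc ‖N i j‖ * ‖iteratedFDeriv ℝ l (framePacket 𝓑 w i j) X‖
      ≤ (S * (2 ^ (P + 2 * s) * (ρ ^ (P + 2 * s))⁻¹) * (Cw * M X * τ ^ a)) *
        (C * ρ ^ P / τ ^ (s + a)) := by gcongr
    _ = C * Cw * 2 ^ (P + 2 * s) * S * M X * (((τ * ρ) ^ s)⁻¹ * (ρ ^ s)⁻¹) := by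
        rw [two_mul s, pow_add ρ P, pow_add ρ s s, pow_add τ, mul_pow]
        field_simp
    _ ≤ _ := by gcongr

theorem locallySummable_dequantTerm (𝓑 : RegularMagneticField d) (w : Window d) {M : Pos4 d → ℝ}
    (hM : TemperedWeight M) {N : SuperIdx d → SuperIdx d → ℂ}
    (hN : ∀ n : ℕ, BddAbove (Set.range (decayTerm M n N))) :
    LocallySummable (dequantTerm 𝓑 w N) := by
  intro m R
  obtain ⟨a, Cw, hCw, hw⟩ := hM.exists_bound
  obtain ⟨s, hs⟩ := exists_summable_latticePoint d
  obtain ⟨C, n, hC, h⟩ := exists_dequantTerm_bound 𝓑 w hM m s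
  have hS0 : 0 ≤ ⨆ p, decayTerm M n N p := Real.iSup_nonneg fun p => decayTerm_nonneg hM.pos n N p
  have hM0 := hM.pos 0
  refine ⟨_, (summable_lattice_pair hs).mul_left
    (C * (⨆ p, decayTerm M n N p) * (Cw * M 0 * (1 + R) ^ a) * (1 + R) ^ s), fun p X hX => ?_⟩
  refine (h N hN p X m le_rfl).trans ?_
  have hMX : M X ≤ Cw * M 0 * (1 + R) ^ a := by
    have := hw 0 X
    rw [zero_add] at this
    refine this.trans ?_
    gcongr
  have hx : ((1 + ‖X - latticePoint p.1‖) ^ s)⁻¹ ≤ (1 + R) ^ s * ((1 + ‖latticePoint p.1‖) ^ s)⁻¹ := by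
    refine (inv_one_add_norm_le X (latticePoint p.1) s).trans ?_
    gcongr
  have hR : 0 ≤ R := (norm_nonneg X).trans hX.le
  calc _ ≤ C * (⨆ p, decayTerm M n N p) * (Cw * M 0 * (1 + R) ^ a) *
        (((1 + R) ^ s * ((1 + ‖latticePoint p.1‖) ^ s)⁻¹) *
          ((1 + ‖latticePoint p.1 - latticePoint p.2‖) ^ s)⁻¹) := by gcongr
    _ = _ := by ring

theorem dequantConvergesTo_tsum (𝓑 : RegularMagneticField d) (w : Window d) {M : Pos4 d → ℝ}
    (hM : TemperedWeight M) {N : SuperIdx d → SuperIdx d → ℂ}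
    (hN : ∀ n : ℕ, BddAbove (Set.range (decayTerm M n N))) :
    DequantConvergesTo 𝓑 w N fun X => ∑' p, dequantTerm 𝓑 w N p X :=
  fun _ hK => (locallySummable_dequantTerm 𝓑 w hM hN).tendstoUniformlyOn hK

theorem DequantConvergesTo.eq_tsum {𝓑 : RegularMagneticField d} {w : Window d}
    {N : SuperIdx d → SuperIdx d → ℂ} {Φ : Pos4 d → ℂ} (h : DequantConvergesTo 𝓑 w N Φ) :
    Φ = fun X => ∑' p, dequantTerm 𝓑 w N p X := by
  funext X
  have h1 : HasSum (fun p => dequantTerm 𝓑 w N p X) (Φ X) := by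
    simpa [HasSum] using (h {X} isCompact_singleton).tendsto_at (Set.mem_singleton X)
  exact h1.tsum_eq.symm

theorem norm_partialDeriv_le_norm_iteratedFDeriv (γ : Coord d → ℕ) (Φ : Pos4 d → ℂ) (X : Pos4 d) :
    ‖partialDeriv γ Φ X‖ ≤ ‖iteratedFDeriv ℝ (multiList γ).length Φ X‖ := by
  refine (ContinuousMultilinearMap.le_opNorm _ _).trans ?_
  exact mul_le_of_le_one_right (norm_nonneg _)
    (Finset.prod_le_one (fun _ _ => norm_nonneg _) fun _ _ => norm_coordVec_le _)

theorem length_multiList (γ : Coord d → ℕ) : (multiList γ).length = ∑ c, γ c := by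
  have h := Multiset.sum_count_eq_card (s := Finset.univ) (m := (multiList γ : Multiset (Coord d)))
    (by simp)
  simp only [count_multiList] at h
  exact h.symm

/-- The sum of the dequantization series is bounded by the weight, with all partial derivatives. -/
theorem exists_partialDeriv_tsum_bound (𝓑 : RegularMagneticField d) (w : Window d) {M : Pos4 d → ℝ}
    (hM : TemperedWeight M) (k : ℕ) : ∃ (C : ℝ) (n : ℕ), 0 ≤ C ∧ ∀ N : SuperIdx d → SuperIdx d → ℂ,
      (∀ n : ℕ, BddAbove (Set.range (decayTerm M n N))) → ∀ γ : Coord d → ℕ, ∑ c, γ c ≤ k →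
      ∀ X, (M X)⁻¹ * ‖partialDeriv γ (fun X => ∑' p, dequantTerm 𝓑 w N p X) X‖ ≤
        C * ⨆ p, decayTerm M n N p := by
  obtain ⟨s, hs⟩ := exists_summable_latticePoint d
  obtain ⟨T, hT, hsum⟩ := exists_tsum_lattice_pair_le hs
  obtain ⟨C, n, hC, h⟩ := exists_dequantTerm_bound 𝓑 w hM k s
  refine ⟨C * T, n, by positivity, fun N hN γ hγ X => ?_⟩
  obtain ⟨B, hB, hBs⟩ := hsum X
  have hS0 : 0 ≤ ⨆ p, decayTerm M n N p := Real.iSup_nonneg fun p => decayTerm_nonneg hM.pos n N p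
  have hMX := hM.pos X
  have h1 := (locallySummable_dequantTerm 𝓑 w hM hN).norm_iteratedFDeriv_tsum_le
    (contDiff_dequantTerm 𝓑 w N) (multiList γ).length X
    (hBs.mul_left (C * (⨆ p, decayTerm M n N p) * M X))
    (fun p => h N hN p X _ (by rwa [length_multiList]))
  rw [inv_mul_le_iff₀ hMX]
  refine ((norm_partialDeriv_le_norm_iteratedFDeriv γ _ X).trans h1).trans ?_
  calc _ ≤ C * (⨆ p, decayTerm M n N p) * M X * T := by gcongr
    _ = _ := by ring

theorem tsum_mem_symbolClass (𝓑 : RegularMagneticField d) (w : Window d) {M : Pos4 d → ℝ}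
    (hM : TemperedWeight M) {N : SuperIdx d → SuperIdx d → ℂ}
    (hN : ∀ n : ℕ, BddAbove (Set.range (decayTerm M n N))) :
    (fun X => ∑' p, dequantTerm 𝓑 w N p X) ∈ symbolClass M := by
  refine ⟨(locallySummable_dequantTerm 𝓑 w hM hN).contDiff_tsum (contDiff_dequantTerm 𝓑 w N),
    fun γ => ?_⟩
  obtain ⟨C, n, -, h⟩ := exists_partialDeriv_tsum_bound 𝓑 w hM (∑ c, γ c)
  refine ⟨C * ⨆ p, decayTerm M n N p, ?_⟩
  rintro _ ⟨X, rfl⟩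
  exact h N hN γ le_rfl X

theorem exists_symbolSeminorm_bound (𝓑 : RegularMagneticField d) (w : Window d) {M : Pos4 d → ℝ}
    (hM : TemperedWeight M) (k : ℕ) : ∃ C : ℝ, 0 < C ∧ ∃ n : ℕ, ∀ N : SuperIdx d → SuperIdx d → ℂ,
      (∀ n' : ℕ, BddAbove (Set.range (decayTerm M n' N))) →
        ∀ Φ : Pos4 d → ℂ, DequantConvergesTo 𝓑 w N Φ →
          symbolSeminorm M k Φ ≤ C * ⨆ p, decayTerm M n N p := by
  obtain ⟨C, n, hC, h⟩ := exists_partialDeriv_tsum_bound 𝓑 w hM k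
  obtain ⟨K, hK⟩ : ∃ K : ℝ, K = ∑ m ∈ Finset.range (k + 1),
    ∑ _γ ∈ Finset.piAntidiag (Finset.univ : Finset (Coord d)) m, (1 : ℝ) := ⟨_, rfl⟩
  have hK0 : 0 ≤ K :=
    hK ▸ Finset.sum_nonneg fun _ _ => Finset.sum_nonneg fun _ _ => zero_le_one
  refine ⟨K * C + 1, by positivity, n, fun N hN Φ hΦ => ?_⟩
  have hS0 : 0 ≤ ⨆ p, decayTerm M n N p := Real.iSup_nonneg fun p => decayTerm_nonneg hM.pos n N p
  have h1 : symbolSeminorm M k Φ ≤ K * (C * ⨆ p, decayTerm M n N p) := by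
    rw [hΦ.eq_tsum, hK, Finset.sum_mul]
    refine Finset.sum_le_sum fun m hm => ?_
    rw [Finset.sum_mul]
    refine Finset.sum_le_sum fun γ hγ => ?_
    have hm : m ≤ k := Nat.lt_succ_iff.1 (Finset.mem_range.1 hm)
    have hγ : ∑ c, γ c = m := (Finset.mem_piAntidiag.1 hγ).1
    rw [one_mul]
    exact ciSup_le fun X => h N hN γ (hγ.trans_le hm) X
  refine h1.trans ?_
  rw [← mul_assoc]
  exact mul_le_mul_of_nonneg_right (by linarith) hS0

end

end MagneticWeyl

end

open MagneticWeyl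
theorem theorem3p3 (d : ℕ) (hd : 1 ≤ d) (𝓑 : RegularMagneticField d) (w : Window d)
    (M : Pos4 d → ℝ) (hM : TemperedWeight M) :
    (∀ n : ℕ, ∃ C : ℝ, 0 < C ∧ ∃ k : ℕ, ∀ Φ ∈ symbolClass M, ∀ i j : SuperIdx d,
      decayTerm M n (matrixEntry 𝓑 w (superOp 𝓑 (ofFun Φ))) (i, j) ≤ C * symbolSeminorm M k Φ) ∧
    (∀ i j : SuperIdx d,
      superOp 𝓑 (embed (superOpInv 𝓑 (bowtieSuper (frameOp 𝓑 w i) (frameOpConj 𝓑 w j)))) =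
        bowtieSuper (frameOp 𝓑 w i) (frameOpConj 𝓑 w j)) ∧
    (∀ N : SuperIdx d → SuperIdx d → ℂ,
      (∀ n : ℕ, BddAbove (Set.range (decayTerm M n N))) →
        ∃ Φ ∈ symbolClass M, DequantConvergesTo 𝓑 w N Φ) ∧
    (∀ k : ℕ, ∃ C : ℝ, 0 < C ∧ ∃ n : ℕ, ∀ N : SuperIdx d → SuperIdx d → ℂ,
      (∀ n' : ℕ, BddAbove (Set.range (decayTerm M n' N))) →
        ∀ Φ : Pos4 d → ℂ, DequantConvergesTo 𝓑 w N Φ →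
          symbolSeminorm M k Φ ≤ C * ⨆ p, decayTerm M n N p) :=
  ⟨fun n => exists_matrixEntry_bound hd 𝓑 w hM n, superOp_superOpInv_frame 𝓑 w,
    fun _ hN => ⟨_, tsum_mem_symbolClass 𝓑 w hM hN, dequantConvergesTo_tsum 𝓑 w hM hN⟩,
    exists_symbolSeminorm_bound 𝓑 w hM⟩
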